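/- Notation. Fix $r\ge 0$. Let $\mathcal P$ be the set of all partitions (including $0$). For $\boldsymbol\mu=(\mu^1,\dots,\mu^r)\in\mathcal P^r$ put $|\boldsymbol\mu|=(|\mu^1|,\dots,|\mu^r|)$. A *type* is a finitely supported function $\boldsymbol\omega:\mathbb Z_{\ge0}\times\mathcal P^r\to\mathbb Z_{\ge0}$ whose support contains no pair $(0,\boldsymbol\mu)$ and no pair $(d,0)$. For $\mathbf v\in(\mathbb Z_{\ge0})^r$ and a finite field $\mathbb F_q$ let $\mathrm{GL}_{\mathbf v}(\mathbb F_q)=\prod_i\mathrm{GL}_{v_i}(\mathbb F_q)$. Let $\mathfrak O$ be the set of Frobenius orbits on $\overline{\mathbb F}_q^{\times}$. The conjugacy class of $g=(g_1,\dots,g_r)\in\mathrm{GL}_{\mathbf v}(\mathbb F_q)$ is given by the map $h=(h_1,\dots,h_r):\mathfrak O\to\mathcal P^r$, where $h_i(\gamma)$ is the partition formed by the sizes of the Jordan blocks of $g_i$ at any one eigenvalue in $\gamma$; the type of $g$ assigns to $(d,\boldsymbol\mu)$, $\boldsymbol\mu\ne0$, the number of $\gamma\in\mathfrak O$ with $|\gamma|=d$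 and $h(\gamma)=\boldsymbol\mu$. A unipotent $g\in\mathrm{GL}_{|\boldsymbol\mu|}(\mathbb F_q)$ has type $\boldsymbol\mu$ if its type takes the value $1$ at $(1,\boldsymbol\mu)$ and $0$ elsewhere (the zero type if $\boldsymbol\mu=0$). A family of functions $F_{\mathbf v}:\mathrm{GL}_{\mathbf v}(\mathbb F_q)\to\mathbb Q$ (for all $\mathbf v$ and all finite fields $\mathbb F_q$), with $F_0=1$, is *Log compatible* if there are rational functions $F_{\boldsymbol\omega}(t)\in\mathbb Q(t)$, indexed by types, such that for every $g\in \mathrm{GL}_{\mathbf v}(\mathbb F_q)$ of type $\boldsymbol\omega$, $F_{\boldsymbol\omega}$ has no pole at $q$ and $F_{\mathbf v}(g)=F_{\boldsymbol\omega}(q)$, and such that $$F_{\boldsymbol\omega}(t)=\prod_{(d,\boldsymbol\mu)}F_{\boldsymbol\mu}(t^d)^{\boldsymbol\omega(d,\boldsymbol\mu)}\quad\text{for all types }\boldsymbol\omega,$$ where $F_{\boldsymbol\mu}$ is the rational function attached to the type of unipotent elements of type $\boldsymbol\mu$. Let $\kappa$ denote an algebraically closed field of characteristic $0$ with a field endomorphism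 $x\mapsto\overline x$ inverting all roots of unity (e.g. $\mathbb C$ with complex conjugation), and put $$\langle f,g\rangle=\frac1{|\mathrm{GL}_{\mathbf v}(\mathbb F_q)|}\sum_{x\in\mathrm{GL}_{\mathbf v}(\mathbb F_q)}f(x)\overline{g(x)}$$ for $\kappa$-valued $f,g$. For $\alpha:\mathbb F_q^\times\to\kappa^\times$ let $1^{\alpha}(x)=\prod_i\alpha(\det x_i)$. On series in $T_1,\dots,T_r$ over $\mathbb Q(t)$ let $\psi_d(f)(t;T_1,\dots,T_r)=f(t^d;T_1^d,\dots,T_r^d)$ and, for $f$ with constant term $1$, $\mathrm{Log}(f)=\sum_{d\ge1}\frac{\mu(d)}d\psi_d(\log f)$, with $\mu(d)$ the Möbius function. Theorem. Let $\{F_{\mathbf v}\}$ be a Log compatible family. For each $\boldsymbol\mu\in\mathcal P^r$ let $Z_{\boldsymbol\mu}(t)\in\mathbb Q[t]$ be the polynomial such that, for every finite field $\mathbb F_q$, $Z_{\boldsymbol\mu}(q)$ is the cardinality of the centralizer in $\mathrm{GL}_{|\boldsymbol\mu|}(\mathbb F_q)$ of any unipotent element of type $\boldsymbol\mu$ (the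 existence of this polynomial being part of the assertion). Then there exist rational functions $V_{\mathbf v}(t),V^{\rm gen}_{\mathbf v}(t)\in\mathbb Q(t)$ such that, for every finite field $\mathbb F_q$ and every $\kappa$ as above: (a) for every $\mathbf v$, $V_{\mathbf v}$ has no pole at $q$ and $V_{\mathbf v}(q)=\langle F_{\mathbf v},1\rangle$; (b) for every $\mathbf v\ne0$ and every character $\alpha_{\mathbf v}:\mathbb F_q^\times\to\kappa^\times$ of order exactly $\sum_iv_i$, $V^{\rm gen}_{\mathbf v}$ has no pole at $q$ and $V^{\rm gen}_{\mathbf v}(q)=\langle F_{\mathbf v},1^{\alpha_{\mathbf v}}\rangle$. Moreover $$(t-1)\,\mathrm{Log}\Big(\sum_{\boldsymbol\mu\in\mathcal P^r}\frac{F_{\boldsymbol\mu}(t)}{Z_{\boldsymbol\mu}(t)}T^{|\boldsymbol\mu|}\Big)=\mathrm{Log}\Big(\sum_{\mathbf v}V_{\mathbf v}(t)T^{\mathbf v}\Big)=\sum_{\mathbf v\neq0}V^{\rm gen}_{\mathbf v}(t)T^{\mathbf v}.$$ -/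

import Mathlib

open Polynomial

universe u w

noncomputable section

namespace LogCompat

/-! ### Partitions, multi-partitions and types -/

/-- An `r`-tuple of partitions `(μ¹, …, μʳ)` of arbitrary sizes; the first component records the
sizes `(|μ¹|, …, |μʳ|)`. -/
abbrev MultiPartition (r : ℕ) : Type := Σ v : Fin r → ℕ, ∀ i, Nat.Partition (v i)

/-- The size `(|μ¹|, …, |μʳ|)` of a multi-partition. It vanishes only for the zero
multi-partition. -/
def MultiPartition.size {r : ℕ} (μ : MultiPartition r) : Fin r → ℕ := μ.1

/-- A type: a finitely supported function `ω : ℕ × 𝒫ʳ → ℕ` whose support contains no pair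
`(0, μ)` and no pair `(d, 0)`. -/
abbrev MultiType (r : ℕ) : Type :=
  {ω : (ℕ × MultiPartition r) →₀ ℕ // ∀ p ∈ ω.support, p.1 ≠ 0 ∧ p.2.size ≠ 0}

open Classical in
/-- The type of a unipotent class with Jordan blocks given by `μ`: it takes the value `1` at
`(1, μ)` and `0` elsewhere (it is the empty type if `μ = 0`). -/
def unipotentType {r : ℕ} (μ : MultiPartition r) : MultiType r :=
  if h : μ.size = 0 then ⟨0, by simp⟩
  else ⟨Finsupp.single (1, μ) 1, by
    intro p hp
    have hp' := Finsupp.support_single_subset hp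
    rw [Finset.mem_singleton] at hp'
    subst hp'
    exact ⟨one_ne_zero, h⟩⟩

/-! ### Conjugacy classes of `GL_v(K)` and their types -/

/-- The group `GL_v(K) = ∏ i, GL_{v i}(K)`. -/
abbrev GLv {r : ℕ} (K : Type*) [Field K] (v : Fin r → ℕ) : Type _ := ∀ i, GL (Fin (v i)) K

/-- The set `𝔒` of Frobenius orbits on the non-zero elements of an algebraic closure of the finite
field `K`: an orbit is represented by the common minimal polynomial over `K` of its elements, so
that orbits are the monic irreducible polynomials other than `X`. -/
abbrev FrobOrbit (K : Type*) [Field K] : Type _ :=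
  {f : K[X] // f.Monic ∧ Irreducible f ∧ f ≠ X}

/-- The number of elements of a Frobenius orbit. -/
def FrobOrbit.deg {K : Type*} [Field K] (γ : FrobOrbit K) : ℕ := γ.1.natDegree

/-- The dimension of the kernel of `f(A)ᵏ`. -/
def kerDim {K : Type*} [Field K] {n : ℕ} (A : Matrix (Fin n) (Fin n) K) (f : K[X]) (k : ℕ) : ℕ :=
  Module.finrank K (LinearMap.ker (Matrix.toLin' ((aeval A f) ^ k)))

/-- For `f` irreducible and `k ≥ 1`, the number of Jordan blocks of `A` of size at least `k`
attached to (any) one of the roots of `f`. -/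
def blocksGE {K : Type*} [Field K] {n : ℕ} (A : Matrix (Fin n) (Fin n) K) (f : K[X]) (k : ℕ) : ℕ :=
  (kerDim A f k - kerDim A f (k - 1)) / f.natDegree

/-- For `f` irreducible, the sizes (with multiplicities) of the Jordan blocks of `A` attached to
one of the roots of `f`; equivalently, the multiset of the `m` such that `K[X] / (f ^ m)` occurs in
the primary decomposition of the `K[X]`-module defined by `A`. -/
def jordanBlocks {K : Type*} [Field K] {n : ℕ} (A : Matrix (Fin n) (Fin n) K) (f : K[X]) :
    Multiset ℕ :=
  ∑ k ∈ Finset.Icc 1 n, Multiset.replicate (blocksGE A f k - blocksGE A f (k + 1)) k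

/-- The map `h = (h₁, …, h_r) : 𝔒 → 𝒫ʳ` which parametrizes the conjugacy class of `g`. -/
def jordanMap {r : ℕ} {K : Type*} [Field K] {v : Fin r → ℕ} (g : GLv K v) (γ : FrobOrbit K) :
    MultiPartition r :=
  ⟨fun i => (jordanBlocks (g i).1 γ.1).sum,
   fun i => Nat.Partition.ofMultiset (jordanBlocks (g i).1 γ.1)⟩

theorem kerDim_eq_zero {K : Type*} [Field K] {n : ℕ} (A : Matrix (Fin n) (Fin n) K) {f : K[X]}
    (hf : Irreducible f) (hA : ¬ f ∣ A.charpoly) (k : ℕ) : kerDim A f k = 0 := by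
  have hc : IsCoprime (f ^ k) A.charpoly := (hf.coprime_iff_not_dvd.mpr hA).pow_left
  obtain ⟨a, b, hab⟩ := hc
  have h1 : aeval A a * (aeval A f) ^ k = 1 := by
    have h := congrArg (aeval A) hab
    simpa [Matrix.aeval_self_charpoly] using h
  have h2 : LinearMap.ker (Matrix.toLin' ((aeval A f) ^ k)) = ⊥ := by
    rw [LinearMap.ker_eq_bot']
    intro m hm
    have h3 : Matrix.toLin' (aeval A a * (aeval A f) ^ k) m = 0 := by
      rw [Matrix.toLin'_mul, LinearMap.comp_apply, hm, map_zero]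
    simpa [h1] using h3
  rw [kerDim, h2, finrank_bot]

theorem finite_jordanMap_size_ne_zero {r : ℕ} {K : Type*} [Field K] {v : Fin r → ℕ}
    (g : GLv K v) : {γ : FrobOrbit K | (jordanMap g γ).size ≠ 0}.Finite := by
  classical
  have hP : (∏ i, (g i).1.charpoly) ≠ 0 :=
    Finset.prod_ne_zero_iff.mpr fun i _ => (Matrix.charpoly_monic _).ne_zero
  refine Set.Finite.subset (Set.Finite.preimage Subtype.val_injective.injOn
    (UniqueFactorizationMonoid.normalizedFactors (∏ i, (g i).1.charpoly)).toFinset.finite_toSet) ?_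
  intro γ hγ
  obtain ⟨i, hi⟩ := Function.ne_iff.mp hγ
  simp only [Set.mem_preimage, Finset.mem_coe, Multiset.mem_toFinset]
  rw [UniqueFactorizationMonoid.mem_normalizedFactors_iff' hP]
  refine ⟨γ.2.2.1, γ.2.1.normalize_eq_self, ?_⟩
  refine dvd_trans ?_ (Finset.dvd_prod_of_mem (fun i => (g i).1.charpoly) (Finset.mem_univ i))
  by_contra hdvd
  apply hi
  have h0 := kerDim_eq_zero (g i).1 γ.2.2.1 hdvd
  simp [MultiPartition.size, jordanMap, jordanBlocks, blocksGE, h0]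

open Classical in
/-- The type of (the conjugacy class of) `g ∈ GL_v(K)`: its value at `(d, μ)`, `μ ≠ 0`, is the number
of Frobenius orbits of size `d` at which `h` takes the value `μ`. -/
def typeOf {r : ℕ} {K : Type*} [Field K] {v : Fin r → ℕ} (g : GLv K v) : MultiType r :=
  ⟨Finsupp.ofSupportFinite
    (fun p => if p.2.size = 0 then 0
      else Set.ncard {γ : FrobOrbit K | γ.deg = p.1 ∧ jordanMap g γ = p.2}) (by
      refine Set.Finite.subset ((finite_jordanMap_size_ne_zero g).image
        fun γ => (γ.deg, jordanMap g γ)) ?_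
      intro p hp
      rw [Function.mem_support] at hp
      split_ifs at hp with h
      · exact absurd rfl hp
      · obtain ⟨γ, hγ⟩ := Set.nonempty_of_ncard_ne_zero hp
        refine ⟨γ, ?_, Prod.ext hγ.1 hγ.2⟩
        change (jordanMap g γ).size ≠ 0
        rw [hγ.2]
        exact h), by
    intro p hp
    rw [Finsupp.mem_support_iff, Finsupp.ofSupportFinite_coe] at hp
    split_ifs at hp with h
    · exact absurd rfl hp
    · obtain ⟨γ, hγ⟩ := Set.nonempty_of_ncard_ne_zero hp
      refine ⟨?_, h⟩
      rw [← hγ.1]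
      exact γ.2.2.1.natDegree_pos.ne'⟩

/-- All the components of `g` are unipotent matrices. -/
def IsUnipotent {r : ℕ} {K : Type*} [Field K] {v : Fin r → ℕ} (g : GLv K v) : Prop :=
  ∀ i, IsNilpotent ((g i).1 - 1)

/-! ### Log compatible families -/

/-- The rational function `f` has no pole at `q` and its value there is `y`. -/
def TakesValueAt {κ : Type*} [DivisionRing κ] (f : RatFunc ℚ) (q : ℕ) (y : κ) : Prop :=
  f.denom.eval (q : ℚ) ≠ 0 ∧ y = ((f.eval (RingHom.id ℚ) (q : ℚ) : ℚ) : κ)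

/-- The substitution `f(t) ↦ f(t ^ d)` on `ℚ(t)` (for `d ≥ 1`). -/
def substPow (d : ℕ) (f : RatFunc ℚ) : RatFunc ℚ :=
  f.eval (algebraMap ℚ (RatFunc ℚ)) (RatFunc.X ^ d)

/-- A family of functions `F_v : GL_v(K) → ℚ`, for all finite fields `K` and all dimension vectors
`v`. -/
abbrev FunctionFamily (r : ℕ) : Type (u + 1) :=
  ∀ (K : Type u) [Field K] [Finite K] (v : Fin r → ℕ), GLv K v → ℚ

/-- The family `F` is Log compatible, the value of `F_v` at the elements of `GL_v(𝔽_q)` of type `ω`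
being given by the value at `q` of the rational function `Fty ω`. -/
structure IsLogCompatible {r : ℕ} (F : FunctionFamily.{u} r) (Fty : MultiType r → RatFunc ℚ) :
    Prop where
  zero : ∀ (K : Type u) [Field K] [Finite K] (g : GLv K (0 : Fin r → ℕ)), F K 0 g = 1
  value : ∀ (K : Type u) [Field K] [Finite K] (v : Fin r → ℕ) (g : GLv K v),
    TakesValueAt (Fty (typeOf g)) (Nat.card K) (F K v g)
  prod : ∀ ω : MultiType r,
    Fty ω = ω.1.prod fun p m => substPow p.1 (Fty (unipotentType p.2)) ^ m

/-! ### Inner products and linear characters -/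

/-- A ring endomorphism of `κ` is a complex conjugation on the roots of unity if it inverts all of
them. -/
def InvertsRootsOfUnity {κ : Type*} [Field κ] (conj : κ →+* κ) : Prop :=
  ∀ (n : ℕ) (ζ : κ), 0 < n → ζ ^ n = 1 → conj ζ = ζ⁻¹

theorem invertsRootsOfUnity_complex : InvertsRootsOfUnity (starRingEnd ℂ) := by
  intro n ζ hn h
  exact (Complex.inv_eq_conj (Complex.norm_eq_one_of_pow_eq_one h hn.ne')).symm

/-- The inner product `⟨f, g⟩ = |GL_v(K)|⁻¹ ∑ₓ f(x) conj(g(x))`. -/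
def inner {r : ℕ} {K : Type*} [Field K] {v : Fin r → ℕ} {κ : Type*} [Field κ]
    (conj : κ →+* κ) (f g : GLv K v → κ) : κ :=
  (Nat.card (GLv K v) : κ)⁻¹ * ∑ᶠ x : GLv K v, f x * conj (g x)

/-- The linear character `1^α : x ↦ ∏ i, α(det xᵢ)` of `GL_v(K)`. -/
def twistedChar {r : ℕ} {K : Type*} [Field K] {κ : Type*} [Field κ] (α : Kˣ →* κˣ)
    (v : Fin r → ℕ) (x : GLv K v) : κ :=
  ∏ i, (α (Matrix.GeneralLinearGroup.det (x i)) : κ)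

/-! ### The plethystic logarithm -/

/-- Formal power series in `T₁, …, T_r` with coefficients in `ℚ(t)`. -/
abbrev Series (r : ℕ) : Type := MvPowerSeries (Fin r) (RatFunc ℚ)

/-- The Adams operation `ψ_d : f(t; T₁, …, T_r) ↦ f(t ^ d; T₁ ^ d, …, T_r ^ d)` (for `d ≥ 1`). -/
def adams {r : ℕ} (d : ℕ) (f : Series r) : Series r := fun v =>
  if ∀ i, d ∣ v i then
    substPow d (MvPowerSeries.coeff (v.mapRange (· / d) (Nat.zero_div d)) f)
  else 0

/-- `Ψ⁻¹(f) = ∑_{d ≥ 1} μ(d) ψ_d(f) / d` for `f` without constant term. The coefficient of `T ^ v` in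
`ψ_d(f)` vanishes for `d > ∑ vᵢ` (see `coeff_adams_eq_zero`), so that the sum over `d` can be stopped
there. -/
def psiInv {r : ℕ} (f : Series r) : Series r := fun v =>
  ∑ d ∈ Finset.Icc 1 v.degree,
    ((ArithmeticFunction.moebius d : RatFunc ℚ) / (d : RatFunc ℚ)) *
      MvPowerSeries.coeff v (adams d f)

theorem coeff_adams_eq_zero {r : ℕ} (f : Series r) (hf : MvPowerSeries.constantCoeff f = 0)
    (d : ℕ) (v : Fin r →₀ ℕ) (hd : v.degree < d) : MvPowerSeries.coeff v (adams d f) = 0 := by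
  change (if ∀ i, d ∣ v i then
    substPow d (MvPowerSeries.coeff (v.mapRange (· / d) (Nat.zero_div d)) f) else 0) = 0
  split_ifs with h
  · have h0 : v.mapRange (· / d) (Nat.zero_div d) = 0 := by
      ext i
      simpa using Nat.div_eq_of_lt (lt_of_le_of_lt (Finsupp.le_degree i v) hd)
    rw [h0, MvPowerSeries.coeff_zero_eq_constantCoeff_apply, hf]
    simp [substPow, RatFunc.eval]
  · rfl

/-- `Log(f) = Ψ⁻¹(log f)` for `f` with constant term `1`, where
`log f = ∑_{n ≥ 1} (-1)ⁿ⁺¹ (f - 1)ⁿ / n`. -/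
def Log {r : ℕ} (f : Series r) : Series r :=
  psiInv (PowerSeries.subst (f - 1) (PowerSeries.log (RatFunc ℚ)))

/-- The generating series `∑_{μ ∈ 𝒫ʳ} H_μ(t) T^{|μ|}`. -/
def partitionSeries {r : ℕ} (H : MultiPartition r → RatFunc ℚ) : Series r := fun v =>
  ∑ μ : (∀ i, Nat.Partition (v i)), H ⟨v, μ⟩

/-- The generating series `∑_v V_v(t) T^v`. -/
def vectorSeries {r : ℕ} (V : (Fin r → ℕ) → RatFunc ℚ) : Series r := fun v => V v

/-- The generating series `∑_{v ≠ 0} V_v(t) T^v`. -/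
def vectorSeriesPos {r : ℕ} (V : (Fin r → ℕ) → RatFunc ℚ) : Series r := fun v =>
  if v = 0 then 0 else V v

end LogCompat

end

/-! Write Ω(t;T) for the series ∑ F_μ/Z_μ T^{|μ|}, q for the order of K, N(γ) for the norm of an
orbit γ, and |w| for the total degree of an exponent w. Each component of g is a K[X]-module whose
elementary divisors are recorded by the Jordan map h. The centralizer of g consists of module
automorphisms and has order ∏_γ Z_{h(γ)}(q^{|γ|}) (`card_centralizer`), and the elements with Jordan
map h number |GL_v| divided by this product (`card_class_mul`). Log compatibility factors F_v(g)
over the same orbits, and so does θ(det g) for a character θ. Hence the average of F_v(g) θ(det g)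
is the coefficient of T^v in an Euler product over γ of Ω(q^d; θ(N(γ)) T_1^d, …, θ(N(γ)) T_r^d),
with d = |γ| (`sum_prod_jordanMap`).

The logarithm of this product has T^w-coefficient ∑_{d ∣ w} s_d · (log Ω)_{w/d}(q^d), where s_d is
the sum of θ(N(γ))^{|w|/d} over the orbits of size d (`exists_isLogOf_average`). The sums s_d come
from summing θ^k ∘ norm over the units of a finite extension and inverting over divisors
(`sum_divisors_charSum`). If θ = 1, then s_d is the number of orbits of size d, and the logarithm is
the value at q of Ψ((t-1) Ψ⁻¹ log Ω); its exponential is the series of the V_v. If θ has order |v|,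
then s_d vanishes for 0 < |w| < |v|, and s_d = μ(d)(q-1)/d for |w| = |v|. The logarithm then has no
terms below degree |v|, so the average is its T^v-coefficient, which is the value at q of the one in
(t-1) Log Ω.

The polynomials Z_μ come from counting isomorphisms out of a direct sum of cyclic modules, by
choosing generators in order of decreasing exponent (`card_isCyclicFamily`). Logarithms are handled
through the differential equation E f = f · E L for the Euler operator E (`IsLogOf`). It is stable
under products, rescaling, T ↦ T^d and specialization at q, and it determines L, and the
coefficients of f degree by degree. -/

noncomputable section

namespace LogCompat

/-! ### Families generating direct sums of cyclic modules -/

section CyclicFamily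

variable {R : Type*} [CommRing R] {M : Type*} [AddCommGroup M] [Module R M]

/-- The elements `x j` generate a direct sum of the cyclic modules `R / (c j)`. -/
def IsCyclicFamily {ι : Type*} [Fintype ι] (c : ι → R) (x : ι → M) : Prop :=
  (∀ j, c j • x j = 0) ∧ ∀ a : ι → R, ∑ j, a j • x j = 0 → ∀ j, c j ∣ a j

/-- The scalars sending the last element into the span of the others form an ideal containing `f ^
m`. It equals `(f ^ m)` exactly when it misses `f ^ (m - 1)`, so one non-membership condition
suffices and generators can be counted one at a time. -/
theorem isCyclicFamily_succ_iff [IsDomain R] [IsPrincipalIdealRing R] {f : R} (hf : Irreducible f)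
    {n : ℕ} (e : Fin (n + 1) → ℕ) (he : ∀ j, e j ≠ 0) (x : Fin (n + 1) → M) :
    IsCyclicFamily (fun j => f ^ e j) x ↔
      IsCyclicFamily (fun j : Fin n => f ^ e j.castSucc) (fun j : Fin n => x j.castSucc) ∧
        f ^ e (Fin.last n) • x (Fin.last n) = 0 ∧
        f ^ (e (Fin.last n) - 1) • x (Fin.last n) ∉
          Submodule.span R (Set.range fun j : Fin n => x j.castSucc) := by
  set m := e (Fin.last n) with hm
  have hm0 : m ≠ 0 := he _
  constructor
  · rintro ⟨h1, h2⟩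
    refine ⟨⟨fun j => h1 _, fun a ha j => ?_⟩, h1 _, fun hmem => ?_⟩
    · have h := h2 (Fin.snoc a 0) (by simpa [Fin.sum_univ_castSucc] using ha) j.castSucc
      simpa using h
    · obtain ⟨a, ha⟩ := (Submodule.mem_span_range_iff_exists_fun R).mp hmem
      have h := h2 (Fin.snoc (fun j => - a j) (f ^ (m - 1)))
        (by simp [Fin.sum_univ_castSucc, ha]) (Fin.last n)
      simp only [Fin.snoc_last, ← hm] at h
      have h3 := (pow_dvd_pow_iff hf.ne_zero hf.not_isUnit).mp h
      omega
  · rintro ⟨⟨h1, h2⟩, h3, h4⟩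
    have hdvd : ∀ b : R, b • x (Fin.last n) ∈
        Submodule.span R (Set.range fun j : Fin n => x j.castSucc) → f ^ m ∣ b := by
      intro b hb
      by_contra hnd
      obtain ⟨k, hk, hk'⟩ : ∃ k, f ^ k ∣ b ∧ ¬ f ^ (k + 1) ∣ b := by
        by_contra! hcon
        have : ∀ k, f ^ k ∣ b := fun k => by
          induction k with
          | zero => simp
          | succ k ih => exact hcon k ih
        exact hnd (this m)
      have hkm : k < m := by
        by_contra! hle
        exact hnd ((pow_dvd_pow f hle).trans hk)
      obtain ⟨u, rfl⟩ := hk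
      have hu : ¬ f ∣ u := fun h => hk' (by rw [pow_succ]; exact mul_dvd_mul_left _ h)
      -- With `b = f ^ k * u`, `k < m` and `u` prime to `f`, a Bézout relation expresses `f ^ (m -
      -- 1)` through `b` and `f ^ m`. Hence `f ^ (m - 1)` would also send the last element into the
      -- span.
      obtain ⟨v, w, hvw⟩ := (hf.coprime_iff_not_dvd.mpr hu)
      apply h4
      have h5 : f ^ (m - 1) • x (Fin.last n) =
          (w * f ^ (m - 1 - k)) • ((f ^ k * u) • x (Fin.last n)) := by
        have e1 : f ^ (m - 1) = v * f ^ m + (w * f ^ (m - 1 - k)) * (f ^ k * u) := by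
          have e2 : f ^ (m - 1) = f ^ (m - 1 - k) * f ^ k := by
            rw [← pow_add]; congr 1; omega
          have e3 : f ^ m = f * f ^ (m - 1) := by
            rw [← pow_succ']; congr 1; omega
          calc f ^ (m - 1) = (v * f + w * u) * f ^ (m - 1) := by rw [hvw, one_mul]
            _ = v * (f * f ^ (m - 1)) + w * u * f ^ (m - 1) := by ring
            _ = v * f ^ m + w * u * (f ^ (m - 1 - k) * f ^ k) := by rw [← e3, ← e2]
            _ = _ := by ring
        rw [smul_smul]
        conv_lhs => rw [e1, add_smul, mul_smul v, h3, smul_zero, zero_add]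
      rw [h5]
      exact Submodule.smul_mem _ _ hb
    refine ⟨fun j => Fin.lastCases h3 h1 j, fun a ha => ?_⟩
    rw [Fin.sum_univ_castSucc] at ha
    have h5 : f ^ m ∣ a (Fin.last n) := by
      apply hdvd
      rw [← neg_eq_of_add_eq_zero_right ha]
      exact Submodule.neg_mem _ (Submodule.sum_mem _ fun j _ =>
        Submodule.smul_mem _ _ (Submodule.subset_span ⟨j, rfl⟩))
    have h6 : a (Fin.last n) • x (Fin.last n) = 0 := by
      obtain ⟨b, hb⟩ := h5
      rw [hb, mul_comm, mul_smul, h3, smul_zero]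
    rw [h6, add_zero] at ha
    exact fun j => Fin.lastCases h5 (h2 _ ha) j

/-- By independence, `f` kills `∑ a j • x j` iff `f ^ e j ∣ f * a j` for all `j`, that is, iff `f ^
(e j - 1) ∣ a j`. -/
theorem range_sum_smul_pow_eq [IsDomain R] {f : R} (hf : f ≠ 0)
    {n : ℕ} (e : Fin n → ℕ) (he : ∀ j, e j ≠ 0) (x : Fin n → M)
    (hx : IsCyclicFamily (fun j => f ^ e j) x) :
    LinearMap.range (Fintype.linearCombination R fun j => f ^ (e j - 1) • x j) =
      Submodule.span R (Set.range x) ⊓ Submodule.torsionBy R M f := by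
  have hpow : ∀ j, f ^ e j = f ^ (e j - 1) * f := fun j => by
    rw [← pow_succ]; congr 1; have := he j; omega
  ext y
  simp only [LinearMap.mem_range, Submodule.mem_inf, Submodule.mem_torsionBy_iff,
    Submodule.mem_span_range_iff_exists_fun, Fintype.linearCombination_apply]
  constructor
  · rintro ⟨b, rfl⟩
    refine ⟨⟨fun j => b j * f ^ (e j - 1), by simp [mul_smul]⟩, ?_⟩
    rw [Finset.smul_sum]
    refine Finset.sum_eq_zero fun j _ => ?_
    have := hx.1 j
    rw [smul_comm, smul_smul f, mul_comm f, ← hpow, this, smul_zero]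
  · rintro ⟨⟨a, rfl⟩, h⟩
    have h1 : ∀ j, f ^ e j ∣ f * a j :=
      hx.2 (fun j => f * a j) (by simpa [Finset.smul_sum, mul_smul] using h)
    have h2 : ∀ j, f ^ (e j - 1) ∣ a j := fun j => by
      have := h1 j
      rwa [hpow, mul_comm, mul_dvd_mul_iff_left hf] at this
    choose b hb using h2
    refine ⟨b, Finset.sum_congr rfl fun j _ => ?_⟩
    rw [smul_smul, mul_comm, ← hb]

/-- The elements `f ^ (e j - 1) • x j` form a direct sum of `n` copies of `R / (f)`. -/
theorem card_span_inf_torsionBy [IsDomain R] {f : R} (hf : f ≠ 0)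
    {n : ℕ} (e : Fin n → ℕ) (he : ∀ j, e j ≠ 0) (x : Fin n → M)
    (hx : IsCyclicFamily (fun j => f ^ e j) x) :
    Nat.card (Submodule.span R (Set.range x) ⊓ Submodule.torsionBy R M f : Submodule R M) =
      Nat.card (R ⧸ Ideal.span {f}) ^ n := by
  classical
  have hpow : ∀ j, f ^ e j = f ^ (e j - 1) * f := fun j => by
    rw [← pow_succ]; congr 1; have := he j; omega
  have hmem : ∀ (j) (a : R), f ^ e j ∣ a * f ^ (e j - 1) ↔ f ∣ a := fun j a => by
    rw [hpow, mul_comm a, mul_dvd_mul_iff_left (pow_ne_zero _ hf)]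
  set θ := Fintype.linearCombination R fun j => f ^ (e j - 1) • x j with hθ
  have hker : LinearMap.ker θ = Submodule.pi Set.univ (fun _ => Ideal.span {f}) := by
    ext b
    simp only [LinearMap.mem_ker, Submodule.mem_pi, Set.mem_univ, true_implies,
      Ideal.mem_span_singleton, hθ, Fintype.linearCombination_apply]
    constructor
    · intro h j
      have := hx.2 (fun j => b j * f ^ (e j - 1)) (by simpa [mul_smul] using h) j
      exact (hmem j _).mp this
    · intro h
      refine Finset.sum_eq_zero fun j _ => ?_
      obtain ⟨c, hc⟩ := (hmem j _).mpr (h j)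
      rw [smul_smul, hc, mul_comm, mul_smul, hx.1, smul_zero]
  rw [← range_sum_smul_pow_eq hf e he x hx, ← hθ, ← Nat.card_congr θ.quotKerEquivRange.toEquiv,
    hker, Nat.card_congr (Submodule.quotientPi _).toEquiv, Nat.card_pi]
  simp

theorem card_comap_of_le_range {N : Type*} [AddCommGroup N] [Module R N] (φ : M →ₗ[R] N)
    (P : Submodule R N) (hP : P ≤ LinearMap.range φ) :
    Nat.card (P.comap φ) = Nat.card (LinearMap.ker φ) * Nat.card P := by
  let ψ : P.comap φ →ₗ[R] P := φ.restrict fun x hx => hx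
  have hψ : Function.Surjective ψ := by
    rintro ⟨y, hy⟩
    obtain ⟨x, rfl⟩ := hP hy
    exact ⟨⟨x, hy⟩, rfl⟩
  rw [Submodule.card_eq_card_quotient_mul_card (LinearMap.ker ψ),
    Nat.card_congr (ψ.quotKerEquivOfSurjective hψ).toEquiv]
  congr 1
  refine Nat.card_congr ⟨fun z => ⟨z.1.1, congrArg Subtype.val z.2⟩,
    fun z => ⟨⟨z.1, ?_⟩, Subtype.ext z.2⟩, fun _ => rfl, fun _ => rfl⟩
  have : φ z.1 = 0 := z.2
  simp [this]

/-- The admissible `y` are the `f ^ m`-torsion minus the preimage, under multiplication by `f ^ (m -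
1)`, of the `f`-torsion of the span. Because `m ≤ e j`, this `f`-torsion lies in the image of `f ^
(m - 1)`, so the preimage has the expected size. This is why generators are added in decreasing
order of exponent. -/
theorem card_extend_cyclicFamily [IsDomain R] [Finite M] {f : R} (hf : f ≠ 0)
    {n : ℕ} (e : Fin n → ℕ) (m : ℕ) (hm : m ≠ 0) (he : ∀ j, m ≤ e j) (x : Fin n → M)
    (hx : IsCyclicFamily (fun j => f ^ e j) x) :
    (Nat.card {y : M // f ^ m • y = 0 ∧ f ^ (m - 1) • y ∉ Submodule.span R (Set.range x)} : ℚ) =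
      Nat.card (Submodule.torsionBy R M (f ^ m)) -
        Nat.card (Submodule.torsionBy R M (f ^ (m - 1))) *
          (Nat.card (R ⧸ Ideal.span {f}) : ℚ) ^ n := by
  set N := Submodule.span R (Set.range x) with hN
  have he' : ∀ j, e j ≠ 0 := fun j => by have := he j; omega
  set P := (N ⊓ Submodule.torsionBy R M f).comap (LinearMap.lsmul R M (f ^ (m - 1))) with hP
  have hpow : f ^ m = f * f ^ (m - 1) := by
    rw [← pow_succ']; congr 1; omega
  have h1 : Nat.card P = Nat.card (Submodule.torsionBy R M (f ^ (m - 1))) *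
      Nat.card (R ⧸ Ideal.span {f}) ^ n := by
    rw [hP, card_comap_of_le_range, card_span_inf_torsionBy hf e he' x hx]
    · rfl
    · rw [← range_sum_smul_pow_eq hf e he' x hx]
      rintro _ ⟨b, rfl⟩
      refine ⟨∑ j, b j • f ^ (e j - m) • x j, ?_⟩
      rw [Fintype.linearCombination_apply, LinearMap.lsmul_apply, Finset.smul_sum]
      refine Finset.sum_congr rfl fun j _ => ?_
      rw [smul_comm, smul_smul (f ^ (m - 1)), ← pow_add]
      congr 3
      have := he j
      omega
  have h2 : {y : M | f ^ m • y = 0 ∧ f ^ (m - 1) • y ∉ N} =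
      (Submodule.torsionBy R M (f ^ m) : Set M) \ (P : Set M) := by
    ext y
    simp only [Set.mem_ofPred_eq, Set.mem_sdiff, SetLike.mem_coe, Submodule.mem_torsionBy_iff, hP,
      Submodule.mem_comap, Submodule.mem_inf, LinearMap.lsmul_apply, smul_smul f, ← hpow]
    tauto
  have h3 : (P : Set M) ⊆ (Submodule.torsionBy R M (f ^ m) : Set M) := by
    intro y hy
    have := hy.2
    rw [SetLike.mem_coe, Submodule.mem_torsionBy_iff]
    rwa [LinearMap.lsmul_apply, SetLike.mem_coe, Submodule.mem_torsionBy_iff, smul_smul,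
      ← hpow] at this
  have h4 := Set.ncard_sdiff_add_ncard_of_subset h3
  rw [← h2] at h4
  simp only [← Nat.card_coe_set_eq] at h4
  have h5 : Nat.card {y : M // f ^ m • y = 0 ∧ f ^ (m - 1) • y ∉ N} + Nat.card P =
      Nat.card (Submodule.torsionBy R M (f ^ m)) := h4
  rw [← h5, h1]
  push_cast
  ring

/-- The number of choices for the next generator does not depend on the earlier ones, so the count
is a product. -/
theorem card_isCyclicFamily [IsDomain R] [IsPrincipalIdealRing R] [Finite M] {f : R}
    (hf : Irreducible f) {n : ℕ} (e : Fin n → ℕ) (he : ∀ j, e j ≠ 0) (hanti : Antitone e) :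
    (Nat.card {x : Fin n → M // IsCyclicFamily (fun j => f ^ e j) x} : ℚ) =
      ∏ j, ((Nat.card (Submodule.torsionBy R M (f ^ e j)) : ℚ) -
        Nat.card (Submodule.torsionBy R M (f ^ (e j - 1))) *
          (Nat.card (R ⧸ Ideal.span {f}) : ℚ) ^ (j : ℕ)) := by
  classical
  induction n with
  | zero =>
    have : Nat.card {x : Fin 0 → M // IsCyclicFamily (fun j => f ^ e j) x} = 1 := by
      rw [Nat.card_eq_one_iff_unique]
      exact ⟨inferInstance, ⟨0, fun j => j.elim0, fun _ _ j => j.elim0⟩⟩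
    rw [this]
    simp
  | succ n ih =>
    have ih' := ih (fun j => e j.castSucc) (fun j => he _)
      (fun i j hij => hanti (Fin.castSucc_le_castSucc_iff.mpr hij))
    let E : {x : Fin (n + 1) → M // IsCyclicFamily (fun j => f ^ e j) x} ≃
        Σ x : {x : Fin n → M // IsCyclicFamily (fun j => f ^ e j.castSucc) x},
          {y : M // f ^ e (Fin.last n) • y = 0 ∧
            f ^ (e (Fin.last n) - 1) • y ∉ Submodule.span R (Set.range x.1)} :=
      { toFun := fun x =>
          ⟨⟨fun j => x.1 j.castSucc, ((isCyclicFamily_succ_iff hf e he x.1).mp x.2).1⟩,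
            ⟨x.1 (Fin.last n), ((isCyclicFamily_succ_iff hf e he x.1).mp x.2).2⟩⟩
        invFun := fun z => ⟨Fin.snoc (α := fun _ => M) z.1.1 z.2.1,
          (isCyclicFamily_succ_iff hf e he _).mpr
            ⟨by simpa using z.1.2, by simpa using z.2.2⟩⟩
        left_inv := fun x => Subtype.ext (by
          funext j
          refine Fin.lastCases ?_ (fun j => ?_) j <;> simp)
        right_inv := by
          rintro ⟨⟨x, hx⟩, ⟨y, hy⟩⟩
          refine Sigma.ext (Subtype.ext (by funext j; simp)) ?_
          exact (Subtype.heq_iff_coe_eq (fun z => by simp)).mpr (by simp) }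
    have : Fintype {x : Fin n → M // IsCyclicFamily (fun j => f ^ e j.castSucc) x} :=
      Fintype.ofFinite _
    rw [Nat.card_congr E, Nat.card_sigma, Fin.prod_univ_castSucc]
    simp only [Fin.val_castSucc]
    rw [← ih']
    push_cast
    rw [Finset.sum_congr rfl fun x _ => card_extend_cyclicFamily hf.ne_zero
      (fun j => e j.castSucc) (e (Fin.last n)) (he _) (fun j => hanti (Fin.le_last _)) x.1 x.2]
    simp only [Finset.sum_const, Finset.card_univ, nsmul_eq_mul, Nat.card_eq_fintype_card]

end CyclicFamily

/-! ### Gluing primary components; cyclic families as isomorphisms -/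

section Gluing

variable {R : Type*} [CommRing R] {M : Type*} [AddCommGroup M] [Module R M]

/-- Torsion submodules for pairwise coprime elements are independent, so a relation among all the
elements splits into one relation for each `k`. -/
theorem isCyclicFamily_sigma_iff {κ : Type*} [Fintype κ] {ι : κ → Type*} [∀ k, Fintype (ι k)]
    (p : κ → R) (hp : Pairwise fun i j => IsCoprime (p i) (p j)) (e : ∀ k, ι k → ℕ)
    (x : (Σ k, ι k) → M) :
    IsCyclicFamily (fun z => p z.1 ^ e z.1 z.2) x ↔
      ∀ k, IsCyclicFamily (fun j => p k ^ e k j) fun j => x ⟨k, j⟩ := by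
  classical
  constructor
  · rintro ⟨h1, h2⟩ k
    refine ⟨fun j => h1 ⟨k, j⟩, fun a ha j => ?_⟩
    have h := h2 (fun z => if h : z.1 = k then a (h ▸ z.2) else 0) (by
      rw [Fintype.sum_sigma, Finset.sum_eq_single k]
      · simpa using ha
      · intro k' _ hk'
        simp [hk']
      · simp) ⟨k, j⟩
    simpa using h
  · intro h
    refine ⟨fun z => (h z.1).1 z.2, fun a ha z => ?_⟩
    rw [Fintype.sum_sigma] at ha
    -- The sum of the exponents serves as a common exponent that kills every element of block `k`.
    have hco : Set.Pairwise ((Finset.univ : Finset κ) : Set κ)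
        (Function.onFun IsCoprime fun k => p k ^ ∑ j, e k j) :=
      fun i _ j _ hij => (hp hij).pow
    have hind := (Submodule.supIndep_torsionBy (M := M) hco).iSupIndep_of_univ
    rw [iSupIndep_iff_finsetSum_eq_zero_imp_eq_zero] at hind
    have hmem : ∀ k, ∑ j, a ⟨k, j⟩ • x ⟨k, j⟩ ∈
        Submodule.torsionBy R M (p k ^ ∑ j, e k j) := fun k => by
      refine Submodule.sum_mem _ fun j _ => Submodule.smul_mem _ _ ?_
      rw [Submodule.mem_torsionBy_iff]
      obtain ⟨d, hd⟩ := Nat.exists_eq_add_of_le' (Finset.single_le_sum (f := e k)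
        (fun _ _ => Nat.zero_le _) (Finset.mem_univ j))
      rw [hd, pow_add, mul_smul, (h k).1 j, smul_zero]
    have := hind Finset.univ (fun k => ∑ j, a ⟨k, j⟩ • x ⟨k, j⟩) (fun k _ => hmem k) ha
    exact (h z.1).2 (fun j => a ⟨z.1, j⟩) (this z.1 (Finset.mem_univ _)) z.2

theorem card_isCyclicFamily_sigma {κ : Type*} [Fintype κ] {ι : κ → Type*} [∀ k, Fintype (ι k)]
    (p : κ → R) (hp : Pairwise fun i j => IsCoprime (p i) (p j)) (e : ∀ k, ι k → ℕ) :
    Nat.card {x : (Σ k, ι k) → M // IsCyclicFamily (fun z => p z.1 ^ e z.1 z.2) x} =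
      ∏ k, Nat.card {x : ι k → M // IsCyclicFamily (fun j => p k ^ e k j) x} := by
  rw [← Nat.card_pi]
  refine Nat.card_congr
    { toFun := fun x k => ⟨fun j => x.1 ⟨k, j⟩, (isCyclicFamily_sigma_iff p hp e _).mp x.2 k⟩
      invFun := fun y => ⟨fun z => (y z.1).1 z.2,
        (isCyclicFamily_sigma_iff p hp e _).mpr fun k => (y k).2⟩
      left_inv := fun x => rfl
      right_inv := fun y => rfl }

/-- A cyclic family in a finite module of the right cardinality defines an isomorphism with a direct
sum of cyclic modules, and conversely. -/
def cyclicFamilyEquiv {ι : Type*} [Fintype ι] [DecidableEq ι] (c : ι → R) [Finite M]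
    (hM : Nat.card M = ∏ j, Nat.card (R ⧸ Ideal.span {c j})) :
    {x : ι → M // IsCyclicFamily c x} ≃ ((∀ j, R ⧸ Ideal.span {c j}) ≃ₗ[R] M) := by
  have hN : Nat.card M = Nat.card (∀ j, R ⧸ Ideal.span {c j}) := by rw [hM, Nat.card_pi]
  -- `Nat.card` is `0` on infinite types, so equality with the positive cardinality of `M` forces
  -- finiteness.
  have hfin : Finite (∀ j, R ⧸ Ideal.span {c j}) :=
    (Nat.card_pos_iff.mp (hN ▸ Nat.card_pos (α := M))).2
  have hmk : ∀ (j) (b : R ⧸ Ideal.span {c j}), ∃ a : R, Ideal.Quotient.mk _ a = b :=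
    fun j b => Ideal.Quotient.mk_surjective b
  let φ (x : {x : ι → M // IsCyclicFamily c x}) : (∀ j, R ⧸ Ideal.span {c j}) →ₗ[R] M :=
    LinearMap.lsum R _ ℕ fun j => Submodule.liftQ _ (LinearMap.toSpanSingleton R M (x.1 j)) (by
      rw [Ideal.span, Submodule.span_le, Set.singleton_subset_iff]
      exact x.2.1 j)
  have hφ : ∀ x (a : ι → R), φ x (fun j => Ideal.Quotient.mk _ (a j)) = ∑ j, a j • x.1 j := by
    intro x a
    simp only [φ, LinearMap.lsum_apply, LinearMap.sum_apply, LinearMap.comp_apply,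
      LinearMap.proj_apply]
    rfl
  have hinj : ∀ x, Function.Injective (φ x) := fun x => by
    rw [injective_iff_map_eq_zero]
    intro b hb
    choose a ha using fun j => hmk j (b j)
    obtain rfl : (fun j => Ideal.Quotient.mk _ (a j)) = b := funext ha
    rw [hφ] at hb
    funext j
    exact Ideal.Quotient.eq_zero_iff_mem.mpr (Ideal.mem_span_singleton.mpr (x.2.2 a hb j))
  -- Injectivity is the independence clause of a cyclic family; surjectivity follows by comparing
  -- cardinalities.
  have hbij : ∀ x, Function.Bijective (φ x) := fun x =>
    (Nat.bijective_iff_injective_and_card _).mpr ⟨hinj x, hN.symm⟩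
  have hsum : ∀ (ψ : (∀ j, R ⧸ Ideal.span {c j}) →ₗ[R] M) (a : ι → R),
      ψ (fun j => Ideal.Quotient.mk _ (a j)) = ∑ j, a j • ψ (Pi.single j 1) := fun ψ a => by
    simp_rw [← map_smul, ← map_sum]
    congr 1
    funext i
    rw [Finset.sum_apply, Finset.sum_eq_single i]
    · simp [Pi.single_eq_same, Algebra.smul_def]
    · intro j _ hj
      simp [Pi.single_eq_of_ne (Ne.symm hj)]
    · simp
  refine
    { toFun := fun x => LinearEquiv.ofBijective (φ x) (hbij x)
      invFun := fun ψ => ⟨fun j => ψ (Pi.single j 1), fun j => ?_, fun a ha j => ?_⟩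
      left_inv := fun x => ?_
      right_inv := fun ψ => ?_ }
  · rw [← map_smul, ← map_zero ψ]
    congr 1
    rw [← Pi.single_smul, ← Pi.single_zero j]
    congr 1
    rw [Algebra.smul_def, mul_one]
    exact Ideal.Quotient.eq_zero_iff_mem.mpr (Ideal.mem_span_singleton_self _)
  · have h := (hsum ψ.toLinearMap a).trans ha
    have h0 : (fun j => Ideal.Quotient.mk (Ideal.span {c j}) (a j)) = 0 :=
      ψ.injective (h.trans (map_zero ψ).symm)
    exact Ideal.mem_span_singleton.mp (Ideal.Quotient.eq_zero_iff_mem.mp (congrFun h0 j))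
  · refine Subtype.ext (funext fun j => ?_)
    change φ x (Pi.single j 1) = x.1 j
    have := hφ x (Pi.single j 1)
    have h1 : (fun i => Ideal.Quotient.mk (Ideal.span {c i}) ((Pi.single j 1 : ι → R) i)) =
        Pi.single j 1 := by
      funext i
      by_cases hij : i = j
      · subst hij; simp
      · simp [Pi.single_eq_of_ne hij]
    rw [h1] at this
    rw [this, Finset.sum_eq_single j]
    · simp
    · intro i _ hi
      simp [Pi.single_eq_of_ne hi]
    · simp
  · refine LinearEquiv.ext fun b => ?_
    choose a ha using fun j => hmk j (b j)
    obtain rfl : (fun j => Ideal.Quotient.mk _ (a j)) = b := funext ha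
    exact (hφ _ a).trans (hsum ψ.toLinearMap a).symm

end Gluing

/-! ### Torsion in direct sums of the modules K[X]/(p^e) -/

section Model

variable {K : Type*} [Field K]

/-- With `m = min e k`, the `f ^ k`-torsion of `K[X] / (f ^ e)` consists of the multiples of `f ^ (e
- m)` and is a copy of `K[X] / (f ^ m)`. -/
theorem finrank_torsionBy_quotient_pow {f : K[X]} (hf : f ≠ 0) (e k : ℕ) :
    Module.finrank K (Submodule.torsionBy K[X] (K[X] ⧸ Ideal.span {f ^ e}) (f ^ k)) =
      f.natDegree * min e k := by
  set m := min e k with hm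
  let φ : K[X] →ₗ[K[X]] Submodule.torsionBy K[X] (K[X] ⧸ Ideal.span {f ^ e}) (f ^ k) :=
    LinearMap.codRestrict _
      ((Submodule.mkQ (Ideal.span {f ^ e})).comp (LinearMap.lsmul K[X] K[X] (f ^ (e - m)))) (by
        intro a
        rw [Submodule.mem_torsionBy_iff, ← map_smul]
        refine (Submodule.Quotient.mk_eq_zero _).mpr (Ideal.mem_span_singleton.mpr ?_)
        simp only [LinearMap.lsmul_apply, smul_eq_mul]
        rw [← mul_assoc, ← pow_add]
        exact Dvd.dvd.mul_right (pow_dvd_pow _ (by omega)) _)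
  have hsurj : Function.Surjective φ := by
    rintro ⟨b, hb⟩
    obtain ⟨a, rfl⟩ := Submodule.mkQ_surjective _ b
    rw [Submodule.mem_torsionBy_iff, ← map_smul] at hb
    have h1 : f ^ e ∣ f ^ k * a :=
      Ideal.mem_span_singleton.mp ((Submodule.Quotient.mk_eq_zero _).mp hb)
    have h2 : f ^ (e - m) ∣ a := by
      rcases le_total e k with h | h
      · simp [hm, h]
      · rw [show m = k by omega]
        have : f ^ e = f ^ k * f ^ (e - k) := by rw [← pow_add]; congr 1; omega
        rwa [this, mul_dvd_mul_iff_left (pow_ne_zero _ hf)] at h1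
    obtain ⟨c, rfl⟩ := h2
    exact ⟨c, Subtype.ext rfl⟩
  have hker : LinearMap.ker φ = Ideal.span {f ^ m} := by
    ext a
    rw [LinearMap.mem_ker, Ideal.mem_span_singleton]
    have h1 : φ a = 0 ↔ f ^ e ∣ f ^ (e - m) * a := by
      rw [← Ideal.mem_span_singleton, ← Submodule.Quotient.mk_eq_zero, Subtype.ext_iff]
      rfl
    have : f ^ e = f ^ (e - m) * f ^ m := by rw [← pow_add]; congr 1; omega
    rw [h1, this, mul_dvd_mul_iff_left (pow_ne_zero _ hf)]
  have E := (φ.quotKerEquivOfSurjective hsurj).restrictScalars K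
  rw [← E.finrank_eq, hker, finrank_quotient_span_eq_natDegree, natDegree_pow, mul_comm]

theorem torsionBy_quotient_eq_bot {R : Type*} [CommRing R] {f g : R} (h : IsCoprime f g) :
    Submodule.torsionBy R (R ⧸ Ideal.span {g}) f = ⊥ := by
  rw [eq_bot_iff]
  intro b hb
  obtain ⟨a, rfl⟩ := Submodule.mkQ_surjective _ b
  rw [Submodule.mem_torsionBy_iff, ← map_smul] at hb
  have h1 : g ∣ f * a := Ideal.mem_span_singleton.mp ((Submodule.Quotient.mk_eq_zero _).mp hb)
  exact (Submodule.Quotient.mk_eq_zero _).mpr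
    (Ideal.mem_span_singleton.mpr (h.symm.dvd_of_dvd_mul_left h1))

theorem isCoprime_of_monic_of_irreducible {f g : K[X]} (hf : Irreducible f) (hg : Irreducible g)
    (hf' : f.Monic) (hg' : g.Monic) (h : f ≠ g) : IsCoprime f g := by
  rw [hf.coprime_iff_not_dvd]
  exact fun hd => h (eq_of_monic_of_associated hf' hg' (hf.associated_of_dvd hg hd))

theorem FrobOrbit.isCoprime {γ δ : FrobOrbit K} (h : γ ≠ δ) : IsCoprime γ.1 δ.1 :=
  isCoprime_of_monic_of_irreducible γ.2.2.1 δ.2.2.1 γ.2.1 δ.2.1 fun h' => h (Subtype.ext h')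

/-- Torsion is computed summand by summand. A summand with `p i ≠ f` contributes nothing, since
distinct monic irreducibles are coprime. -/
theorem finrank_torsionBy_model [DecidableEq K[X]] {ι : Type*} [Fintype ι] {M : Type*}
    [AddCommGroup M]
    [Module K[X] M] [Module K M] [IsScalarTower K K[X] M] (p : ι → K[X])
    (hp : ∀ i, Irreducible (p i)) (hp' : ∀ i, (p i).Monic) (e : ι → ℕ)
    (E : M ≃ₗ[K[X]] ∀ i, K[X] ⧸ Ideal.span {p i ^ e i})
    {f : K[X]} (hf : Irreducible f) (hf' : f.Monic) (k : ℕ) :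
    Module.finrank K (Submodule.torsionBy K[X] M (f ^ k)) =
      f.natDegree * ∑ i with p i = f, min (e i) k := by
  let E' : Submodule.torsionBy K[X] M (f ^ k) ≃ₗ[K[X]]
      ∀ i, Submodule.torsionBy K[X] (K[X] ⧸ Ideal.span {p i ^ e i}) (f ^ k) :=
    { toFun := fun x i => ⟨E x.1 i, by
        have : f ^ k • E x.1 = 0 := by
          rw [← map_smul, (Submodule.mem_torsionBy_iff _ _).mp x.2, map_zero]
        exact (Submodule.mem_torsionBy_iff _ _).mpr (congrFun this i)⟩
      map_add' := fun x y => by funext i; ext; simp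
      map_smul' := fun a x => by funext i; ext; simp
      invFun := fun y => ⟨E.symm fun i => (y i).1, by
        rw [Submodule.mem_torsionBy_iff, ← map_smul]
        rw [map_eq_zero_iff _ E.symm.injective]
        funext i
        exact (Submodule.mem_torsionBy_iff _ _).mp (y i).2⟩
      left_inv := fun x => by ext; simp
      right_inv := fun y => by funext i; ext; simp }
  have : ∀ i, FiniteDimensional K (K[X] ⧸ Ideal.span {p i ^ e i}) := fun i =>
    ((hp' i).pow _).finite_quotient
  have : ∀ i, FiniteDimensional K
      (Submodule.torsionBy K[X] (K[X] ⧸ Ideal.span {p i ^ e i}) (f ^ k)) := fun i =>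
    FiniteDimensional.of_injective ((Submodule.subtype _).restrictScalars K)
      Subtype.val_injective
  have : ∀ i, Module.Free K
      (Submodule.torsionBy K[X] (K[X] ⧸ Ideal.span {p i ^ e i}) (f ^ k)) := fun i =>
    Module.Free.of_divisionRing _ _
  rw [(E'.restrictScalars K).finrank_eq, Module.finrank_pi_fintype, Finset.sum_filter,
    Finset.mul_sum]
  refine Finset.sum_congr rfl fun i _ => ?_
  split_ifs with h
  · rw [h, finrank_torsionBy_quotient_pow hf.ne_zero]
  · rw [torsionBy_quotient_eq_bot, mul_zero]
    · exact finrank_bot K _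
    · exact ((isCoprime_of_monic_of_irreducible hf (hp i) hf' (hp' i) (Ne.symm h)).pow)

end Model

/-! ### Jordan blocks and determinant read off from a primary decomposition -/

section Jordan

variable {K : Type*} [Field K] {n : ℕ}

/-- The `K[X]`-module defined by a matrix. -/
abbrev MatrixModule (A : Matrix (Fin n) (Fin n) K) : Type _ := Module.AEval' (Matrix.toLin' A)

theorem kerDim_eq_finrank_torsionBy (A : Matrix (Fin n) (Fin n) K) (f : K[X]) (k : ℕ) :
    kerDim A f k = Module.finrank K (Submodule.torsionBy K[X] (MatrixModule A) (f ^ k)) := by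
  have h : Matrix.toLin' ((aeval A f) ^ k) = aeval (Matrix.toLin' A) (f ^ k) := by
    rw [← map_pow]
    exact (aeval_algHom_apply (Matrix.toLinAlgEquiv' : Matrix (Fin n) (Fin n) K ≃ₐ[K] _).toAlgHom
      A (f ^ k)).symm
  refine LinearEquiv.finrank_eq
    { toFun := fun x => ⟨Module.AEval'.of _ x.1, ?_⟩
      invFun := fun y => ⟨(Module.AEval'.of _).symm y.1, ?_⟩
      map_add' := fun x y => rfl
      map_smul' := fun a x => rfl
      left_inv := fun x => rfl
      right_inv := fun y => rfl }
  · have : Matrix.toLin' ((aeval A) f ^ k) x.1 = 0 := x.2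
    replace this := (LinearMap.congr_fun h x.1).symm.trans this
    rw [Submodule.mem_torsionBy_iff, ← Module.AEval.of_aeval_smul]
    change Module.AEval.of _ _ _ (aeval (Matrix.toLin' A) (f ^ k) x.1) = 0
    rw [this, map_zero]
  · have := y.2
    rw [Submodule.mem_torsionBy_iff] at this
    rw [LinearMap.mem_ker, h]
    have h2 := Module.AEval.of_symm_smul (Matrix.toLin' A) (f ^ k) y.1
    rw [this, map_zero] at h2
    exact h2.symm

theorem sum_map_min_eq (s : Multiset ℕ) {k : ℕ} (hk : k ≠ 0) :
    (s.map (min · k)).sum = (s.map (min · (k - 1))).sum + s.countP (k ≤ ·) := by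
  induction s using Multiset.induction with
  | empty => simp
  | cons a s ih =>
    simp only [Multiset.map_cons, Multiset.sum_cons, ih, Multiset.countP_cons]
    split_ifs <;> omega

theorem countP_le_eq (s : Multiset ℕ) (k : ℕ) :
    s.countP (k ≤ ·) = s.countP (k + 1 ≤ ·) + s.count k := by
  induction s using Multiset.induction with
  | empty => simp
  | cons a s ih =>
    simp only [Multiset.countP_cons, Multiset.count_cons, ih]
    split_ifs <;> omega

theorem kerDim_le (A : Matrix (Fin n) (Fin n) K) (f : K[X]) (k : ℕ) : kerDim A f k ≤ n := by
  simpa [kerDim] using Submodule.finrank_le (LinearMap.ker (Matrix.toLin' ((aeval A f) ^ k)))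

/-- First differences of `∑ min m k` in `k` count the parts of size at least `k`, and second
differences count those of size exactly `k`. Under the hypothesis the truncated subtractions and the
division by the degree are exact. -/
theorem jordanBlocks_eq_of_kerDim (A : Matrix (Fin n) (Fin n) K) {f : K[X]}
    (hf : f.natDegree ≠ 0) (s : Multiset ℕ) (hs : ∀ m ∈ s, m ≠ 0)
    (h : ∀ k, kerDim A f k = f.natDegree * (s.map (min · k)).sum) : jordanBlocks A f = s := by
  have hb : ∀ k, k ≠ 0 → blocksGE A f k = s.countP (k ≤ ·) := fun k hk => by
    rw [blocksGE, h, h, sum_map_min_eq s hk, mul_add, Nat.add_sub_cancel_left,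
      Nat.mul_div_cancel_left _ (Nat.pos_of_ne_zero hf)]
  -- No part exceeds `n`, so summing over `1 ≤ k ≤ n` in `jordanBlocks` loses nothing.
  have hle : ∀ m ∈ s, m ≤ n := fun m hm => by
    have h1 : m ≤ (s.map (min · m)).sum :=
      Multiset.single_le_sum (fun _ _ => Nat.zero_le _) _
        (Multiset.mem_map.mpr ⟨m, hm, min_self m⟩)
    have h2 := kerDim_le A f m
    rw [h] at h2
    exact (h1.trans (Nat.le_mul_of_pos_left _ (Nat.pos_of_ne_zero hf))).trans h2
  ext m
  rw [jordanBlocks, Multiset.count_sum']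
  simp only [Multiset.count_replicate]
  by_cases hm : m ∈ Finset.Icc 1 n
  · rw [Finset.sum_eq_single m (fun k _ hk => if_neg hk) (fun h => absurd hm h), if_pos rfl]
    rw [Finset.mem_Icc] at hm
    rw [hb m (by omega), hb (m + 1) (by omega), countP_le_eq s m, Nat.add_sub_cancel_left]
  · rw [Finset.sum_eq_zero fun k hk => if_neg (by rintro rfl; exact hm hk), eq_comm,
      Multiset.count_eq_zero]
    intro hms
    exact hm (Finset.mem_Icc.mpr ⟨Nat.one_le_iff_ne_zero.mpr (hs m hms), hle m hms⟩)

theorem det_blockDiagonal_sigma {ι : Type*} [Fintype ι] [hd : DecidableEq ι] {m : ι → Type*}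
    [∀ i, Fintype (m i)] [∀ i, DecidableEq (m i)] (B : ∀ i, Matrix (m i) (m i) K) :
    (Matrix.blockDiagonal' B).det = ∏ i, (B i).det := by
  -- The determinant formula for block triangular matrices needs an order on the index set; an
  -- arbitrary one will do.
  let L : LinearOrder ι := LinearOrder.lift' (Fintype.equivFin ι) (Fintype.equivFin ι).injective
  refine (Matrix.BlockTriangular.det_fintype
    (Matrix.blockTriangular_blockDiagonal' B)).trans (Finset.prod_congr rfl fun i _ => ?_)
  rw [← Matrix.det_submatrix_equiv_self (Equiv.sigmaSubtype i) (B i)]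
  congr 1
  ext ⟨⟨j, a⟩, hj⟩ ⟨⟨k, b⟩, hk⟩
  dsimp only at hj hk
  subst hj
  subst hk
  exact Matrix.blockDiagonal'_apply_eq _ _ _ _

theorem det_pi_map {ι : Type*} [Fintype ι] {M : ι → Type*} [∀ i, AddCommGroup (M i)]
    [∀ i, Module K (M i)] [∀ i, FiniteDimensional K (M i)] (φ : ∀ i, M i →ₗ[K] M i) :
    LinearMap.det (LinearMap.pi fun i => (φ i).comp (LinearMap.proj i) :
      (∀ i, M i) →ₗ[K] ∀ i, M i) = ∏ i, LinearMap.det (φ i) := by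
  classical
  let b := fun i => Module.finBasis K (M i)
  rw [← LinearMap.det_toMatrix (Pi.basis b)]
  have : LinearMap.toMatrix (Pi.basis b) (Pi.basis b)
      (LinearMap.pi fun i => (φ i).comp (LinearMap.proj i)) =
      Matrix.blockDiagonal' fun i => LinearMap.toMatrix (b i) (b i) (φ i) := by
    ext ⟨i, k⟩ ⟨j, l⟩
    rw [LinearMap.toMatrix_apply, Pi.basis_repr, Pi.basis_apply]
    by_cases h : i = j
    · subst h
      simp [Matrix.blockDiagonal'_apply_eq, LinearMap.toMatrix_apply]
    · rw [Matrix.blockDiagonal'_apply_ne _ _ _ h]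
      simp [Pi.single_eq_of_ne h]
  rw [this, det_blockDiagonal_sigma]
  exact Finset.prod_congr rfl fun i _ => LinearMap.det_toMatrix _ _

/-- This determinant is the norm of the class of `X`, the generator of the power basis of
`AdjoinRoot f`, whose minimal polynomial is `f`. -/
theorem det_X_quotient {f : K[X]} (hf : f.Monic) :
    LinearMap.det ((LinearMap.lsmul K[X] (K[X] ⧸ Ideal.span {f}) X).restrictScalars K) =
      (-1) ^ f.natDegree * f.coeff 0 := by
  have h1 := Algebra.PowerBasis.norm_gen_eq_coeff_zero_minpoly (AdjoinRoot.powerBasis hf.ne_zero)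
  rw [AdjoinRoot.powerBasis_gen, AdjoinRoot.minpoly_root hf.ne_zero, hf.leadingCoeff,
    AdjoinRoot.powerBasis_dim, inv_one, C_1, mul_one] at h1
  rw [← h1, Algebra.norm_apply]
  rfl

theorem finite_quotient_pow {ι : Type*} {p : ι → K[X]} {e : ι → ℕ} (hp' : ∀ i, (p i).Monic) (i : ι) :
    FiniteDimensional K (K[X] ⧸ Ideal.span {p i ^ e i}) :=
  ((hp' i).pow _).finite_quotient

variable {ι : Type*} [Fintype ι] {A : Matrix (Fin n) (Fin n) K} {p : ι → K[X]}
  {e : ι → ℕ}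

theorem kerDim_of_model [DecidableEq K[X]] (hp : ∀ i, Irreducible (p i)) (hp' : ∀ i, (p i).Monic)
    (E : MatrixModule A ≃ₗ[K[X]] ∀ i, K[X] ⧸ Ideal.span {p i ^ e i})
    {f : K[X]} (hf : Irreducible f) (hf' : f.Monic) (k : ℕ) :
    kerDim A f k = f.natDegree *
      (((Finset.univ.filter fun i => p i = f ∧ e i ≠ 0).val.map e).map (min · k)).sum := by
  rw [kerDim_eq_finrank_torsionBy, finrank_torsionBy_model p hp hp' e E hf hf', Multiset.map_map]
  congr 1
  change _ = ∑ i with p i = f ∧ e i ≠ 0, min (e i) k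
  rw [← Finset.filter_filter]
  -- The decomposition may contain trivial summands with `e i = 0`; they contribute `min 0 k = 0`.
  refine (Finset.sum_filter_of_ne (p := fun i => e i ≠ 0) fun i _ h h' => ?_).symm
  simp [h'] at h

theorem jordanBlocks_of_model [DecidableEq K[X]] (hp : ∀ i, Irreducible (p i)) (hp' : ∀ i, (p i).Monic)
    (E : MatrixModule A ≃ₗ[K[X]] ∀ i, K[X] ⧸ Ideal.span {p i ^ e i})
    {f : K[X]} (hf : Irreducible f) (hf' : f.Monic) :
    jordanBlocks A f = (Finset.univ.filter fun i => p i = f ∧ e i ≠ 0).val.map e := by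
  refine jordanBlocks_eq_of_kerDim A hf.natDegree_pos.ne' _ (fun m hm => ?_)
    (kerDim_of_model hp hp' E hf hf')
  obtain ⟨i, hi, rfl⟩ := Multiset.mem_map.mp hm
  exact (Finset.mem_filter.mp hi).2.2

theorem sum_natDegree_of_model (hp' : ∀ i, (p i).Monic)
    (E : MatrixModule A ≃ₗ[K[X]] ∀ i, K[X] ⧸ Ideal.span {p i ^ e i}) :
    ∑ i, e i * (p i).natDegree = n := by
  have := finite_quotient_pow (e := e) hp'
  have h := (((Module.AEval'.of (Matrix.toLin' A)).trans (E.restrictScalars K))).finrank_eq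
  rw [Module.finrank_fin_fun, Module.finrank_pi_fintype] at h
  rw [h]
  refine Finset.sum_congr rfl fun i _ => ?_
  rw [finrank_quotient_span_eq_natDegree, natDegree_pow]

theorem det_of_model (hp' : ∀ i, (p i).Monic)
    (E : MatrixModule A ≃ₗ[K[X]] ∀ i, K[X] ⧸ Ideal.span {p i ^ e i}) :
    A.det = ∏ i, ((-1) ^ (p i).natDegree * (p i).coeff 0) ^ e i := by
  have := finite_quotient_pow (e := e) hp'
  rw [← LinearMap.det_toLin', ← LinearMap.det_conj (Matrix.toLin' A)
    ((Module.AEval'.of (Matrix.toLin' A)).trans (E.restrictScalars K))]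
  have h : (((Module.AEval'.of (Matrix.toLin' A)).trans (E.restrictScalars K)) :
        _ →ₗ[K] ∀ i, K[X] ⧸ Ideal.span {p i ^ e i}) ∘ₗ Matrix.toLin' A ∘ₗ
      (((Module.AEval'.of (Matrix.toLin' A)).trans (E.restrictScalars K)).symm :
        (∀ i, K[X] ⧸ Ideal.span {p i ^ e i}) →ₗ[K] _) =
      LinearMap.pi fun i => ((LinearMap.lsmul K[X] (K[X] ⧸ Ideal.span {p i ^ e i})
        X).restrictScalars K).comp (LinearMap.proj i) := by
    refine LinearMap.ext fun y => ?_
    have h2 := Module.AEval'.X_smul_of (Matrix.toLin' A)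
      ((Module.AEval'.of (Matrix.toLin' A)).symm (E.symm y))
    change E (Module.AEval'.of (Matrix.toLin' A) (Matrix.toLin' A
      ((Module.AEval'.of (Matrix.toLin' A)).symm (E.symm y)))) = (X : K[X]) • y
    rw [← h2, LinearEquiv.apply_symm_apply, map_smul, LinearEquiv.apply_symm_apply]
  rw [h, det_pi_map]
  refine Finset.prod_congr rfl fun i _ => ?_
  rw [det_X_quotient ((hp' i).pow _), natDegree_pow, mul_pow, ← pow_mul, mul_comm (e i)]
  congr 1
  simp [coeff_zero_eq_eval_zero]

/-- The structure theorem over a principal ideal domain, with the irreducibles normalized to be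
monic so that associated factors become equal and name Frobenius orbits. -/
theorem exists_model {K : Type u} [Field K] {n : ℕ} (A : Matrix (Fin n) (Fin n) K) :
    ∃ (ι : Type u) (_ : Fintype ι) (p : ι → K[X]) (e : ι → ℕ), (∀ i, Irreducible (p i)) ∧
      (∀ i, (p i).Monic) ∧
      Nonempty (MatrixModule A ≃ₗ[K[X]] ∀ i, K[X] ⧸ Ideal.span {p i ^ e i}) := by
  classical
  obtain ⟨ι, _, p, hp, e, ⟨E⟩⟩ := Module.equiv_directSum_of_isTorsion
    (Module.AEval.isTorsion_of_finiteDimensional K (Fin n → K) (Matrix.toLin' A))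
  refine ⟨ι, inferInstance, fun i => normalize (p i), e,
    fun i => (associated_normalize (p i)).irreducible (hp i),
    fun i => monic_normalize (hp i).ne_zero,
    ⟨(E.trans (DirectSum.linearEquivFunOnFintype K[X] ι _)).trans
      (LinearEquiv.piCongrRight fun i => Submodule.quotEquivOfEq _ _ ?_)⟩⟩
  exact Ideal.span_singleton_eq_span_singleton.mpr ((associated_normalize (p i)).pow_pow)

end Jordan

/-! ### The centralizer polynomial of a partition -/

/-- The elements of a multiset of natural numbers, in decreasing order. -/
def sortedParts (s : Multiset ℕ) : Fin (s.sort (· ≥ ·)).length → ℕ := (s.sort (· ≥ ·)).get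

theorem sum_sortedParts {N : Type*} [AddCommMonoid N] (s : Multiset ℕ) (f : ℕ → N) :
    ∑ j, f (sortedParts s j) = (s.map f).sum := by
  conv_rhs => rw [← Multiset.sort_eq s (· ≥ ·)]
  rw [Multiset.map_coe, Multiset.sum_coe]
  exact Fin.sum_univ_fun_getElem _ _

theorem map_sortedParts (s : Multiset ℕ) :
    (Finset.univ : Finset (Fin (s.sort (· ≥ ·)).length)).val.map (sortedParts s) = s := by
  conv_rhs => rw [← Multiset.sort_eq s (· ≥ ·)]
  rw [Fin.univ_val_map]
  congr 1
  exact List.ofFn_get _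

theorem sortedParts_mem (s : Multiset ℕ) (j) : sortedParts s j ∈ s :=
  (Multiset.mem_sort _).mp (List.get_mem _ _)

theorem antitone_sortedParts (s : Multiset ℕ) : Antitone (sortedParts s) := by
  have h := Multiset.pairwise_sort s (· ≥ ·)
  intro i j hij
  rcases hij.eq_or_lt with rfl | hlt
  · exact le_rfl
  · exact List.pairwise_iff_get.mp h i j hlt

/-- The polynomial whose value at `q` is the order of the centralizer of a unipotent matrix over
`𝔽_q` whose Jordan blocks have the given sizes. -/
def centPoly (s : Multiset ℕ) : ℚ[X] :=
  ∏ j, (X ^ (s.map (min · (sortedParts s j))).sum -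
    X ^ ((s.map (min · (sortedParts s j - 1))).sum + (j : ℕ)))

/-- Each of the first `j + 1` parts is at least the `j`-th one, so lowering the truncation level by
one loses at least `j + 1`. This makes every factor of `centPoly` positive at `q > 1`. -/
theorem sum_map_min_lt (s : Multiset ℕ) (hs : ∀ m ∈ s, m ≠ 0) (j) :
    (s.map (min · (sortedParts s j - 1))).sum + (j : ℕ) <
      (s.map (min · (sortedParts s j))).sum := by
  rw [← sum_sortedParts, ← sum_sortedParts]
  have h1 : (j : ℕ) + 1 = ∑ i, if i ≤ j then 1 else 0 := by
    rw [Finset.sum_boole, Nat.cast_id]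
    have : (Finset.univ.filter fun i => i ≤ j) = Finset.Iic j := by ext; simp
    rw [this, Fin.card_Iic]
  have h2 : ∑ i, min (sortedParts s i) (sortedParts s j - 1) + ∑ i, (if i ≤ j then 1 else 0) ≤
      ∑ i, min (sortedParts s i) (sortedParts s j) := by
    rw [← Finset.sum_add_distrib]
    refine Finset.sum_le_sum fun i _ => ?_
    have := hs _ (sortedParts_mem s j)
    split_ifs with h
    · have := antitone_sortedParts s h
      omega
    · omega
  omega

theorem centPoly_eval_pos (s : Multiset ℕ) (hs : ∀ m ∈ s, m ≠ 0) {q : ℚ} (hq : 1 < q) :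
    0 < (centPoly s).eval q := by
  rw [centPoly, eval_prod]
  refine Finset.prod_pos fun j _ => ?_
  rw [eval_sub, eval_pow, eval_pow, eval_X, sub_pos]
  exact pow_lt_pow_right₀ hq (sum_map_min_lt s hs j)

/-! ### Sums and products over Frobenius orbits attached to an invertible matrix -/

section Jordan

variable {K : Type*} [Field K] {n : ℕ}

theorem ne_zero_of_mem_jordanBlocks {A : Matrix (Fin n) (Fin n) K} {f : K[X]} {m : ℕ}
    (hm : m ∈ jordanBlocks A f) : m ≠ 0 := by
  obtain ⟨k, hk, hm⟩ := Multiset.mem_sum.mp hm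
  rw [Multiset.eq_of_mem_replicate hm]
  have := Finset.mem_Icc.mp hk
  omega

theorem kerDim_eq_sum_jordanBlocks (A : Matrix (Fin n) (Fin n) K) {f : K[X]} (hf : Irreducible f)
    (hf' : f.Monic) (k : ℕ) :
    kerDim A f k = f.natDegree * ((jordanBlocks A f).map (min · k)).sum := by
  classical
  obtain ⟨ι, _, p, e, hp, hp', ⟨E⟩⟩ := exists_model A
  rw [kerDim_of_model hp hp' E hf hf', jordanBlocks_of_model hp hp' E hf hf']

/-- The norm to `K` of the elements of a Frobenius orbit. -/
def FrobOrbit.norm (γ : FrobOrbit K) : Kˣ :=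
  Units.mk0 ((-1) ^ γ.1.natDegree * γ.1.coeff 0) (mul_ne_zero (by simp) fun h => by
    have h1 : X ∣ γ.1 := X_dvd_iff.mpr h
    exact γ.2.2.2 (eq_of_monic_of_associated γ.2.1 monic_X
      (irreducible_X.associated_of_dvd γ.2.2.1 h1).symm))

/-- The summands are grouped by their irreducible polynomial. Keeping `φ` arbitrary gives both the
dimension formula and the determinant formula. -/
theorem prod_pow_of_model {ι : Type*} [Fintype ι] {p : ι → K[X]} {e : ι → ℕ} (g : GL (Fin n) K)
    (hp : ∀ i, Irreducible (p i)) (hp' : ∀ i, (p i).Monic)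
    (E : MatrixModule g.1 ≃ₗ[K[X]] ∀ i, K[X] ⧸ Ideal.span {p i ^ e i})
    (S : Finset (FrobOrbit K)) (hS : ∀ γ : FrobOrbit K, jordanBlocks g.1 γ.1 ≠ 0 → γ ∈ S)
    {N : Type*} [CommMonoid N] (φ : K[X] → N) :
    ∏ i, φ (p i) ^ e i = ∏ γ ∈ S, φ γ.1 ^ (jordanBlocks g.1 γ.1).sum := by
  classical
  -- A nontrivial summand at `X` would make the determinant vanish; the remaining irreducibles are
  -- Frobenius orbits.
  have hX : ∀ i, e i ≠ 0 → p i ≠ X := fun i hi h => by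
    have h1 := det_of_model hp' E
    have h2 : g.1.det ≠ 0 := ((Matrix.isUnit_iff_isUnit_det _).mp g.isUnit).ne_zero
    rw [h1] at h2
    refine Finset.prod_ne_zero_iff.mp h2 i (Finset.mem_univ i) ?_
    rw [h]
    simp [hi]
  rw [← Finset.prod_filter_of_ne (p := fun i => e i ≠ 0) (fun i _ h h' => h (by simp [h']))]
  rw [← Finset.prod_fiberwise_of_maps_to (t := S.image Subtype.val) (g := p)]
  · rw [Finset.prod_image fun _ _ _ _ h => Subtype.ext h]
    refine Finset.prod_congr rfl fun γ _ => ?_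
    rw [jordanBlocks_of_model hp hp' E γ.2.2.1 γ.2.1, Finset.filter_filter]
    change _ = φ γ.1 ^ (∑ i with p i = γ.1 ∧ e i ≠ 0, e i)
    rw [← Finset.prod_pow_eq_pow_sum]
    refine Finset.prod_congr (by ext; simp [and_comm]) fun i hi => ?_
    rw [(Finset.mem_filter.mp hi).2.1]
  · intro i hi
    have hi' := (Finset.mem_filter.mp hi).2
    refine Finset.mem_image.mpr ⟨⟨p i, hp' i, hp i, hX i hi'⟩, hS _ ?_, rfl⟩
    rw [jordanBlocks_of_model hp hp' E (hp i) (hp' i)]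
    intro h
    rw [Multiset.map_eq_zero, Finset.val_eq_zero] at h
    exact Finset.notMem_empty i (h ▸ Finset.mem_filter.mpr ⟨Finset.mem_univ _, rfl, hi'⟩)

theorem sum_jordanBlocks_mul_deg (g : GL (Fin n) K) (S : Finset (FrobOrbit K))
    (hS : ∀ γ : FrobOrbit K, jordanBlocks g.1 γ.1 ≠ 0 → γ ∈ S) :
    ∑ γ ∈ S, (jordanBlocks g.1 γ.1).sum * γ.deg = n := by
  obtain ⟨ι, _, p, e, hp, hp', ⟨E⟩⟩ := exists_model g.1
  -- Powers of `2` encode the additive identity in multiplicative form; injectivity of `2 ^ ·`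
  -- recovers it.
  have h := prod_pow_of_model g hp hp' E S hS fun f => 2 ^ f.natDegree
  simp only [← pow_mul] at h
  rw [Finset.prod_pow_eq_pow_sum, Finset.prod_pow_eq_pow_sum] at h
  have h2 := Nat.pow_right_injective le_rfl h
  refine Eq.trans ?_ (sum_natDegree_of_model hp' E)
  simp only [mul_comm] at h2 ⊢
  exact h2.symm

theorem det_eq_prod_norm (g : GL (Fin n) K) (S : Finset (FrobOrbit K))
    (hS : ∀ γ : FrobOrbit K, jordanBlocks g.1 γ.1 ≠ 0 → γ ∈ S) :
    Matrix.GeneralLinearGroup.det g = ∏ γ ∈ S, γ.norm ^ (jordanBlocks g.1 γ.1).sum := by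
  obtain ⟨ι, _, p, e, hp, hp', ⟨E⟩⟩ := exists_model g.1
  ext
  have h := prod_pow_of_model g hp hp' E S hS fun f => (-1) ^ f.natDegree * f.coeff 0
  rw [Matrix.GeneralLinearGroup.val_det_apply, det_of_model hp' E, h]
  push_cast
  rfl

end Jordan

/-! ### Counting isomorphisms from a block module -/

section Count

variable {K : Type*} [Field K] {n : ℕ}

instance [Finite K] (A : Matrix (Fin n) (Fin n) K) : Finite (MatrixModule A) :=
  inferInstanceAs (Finite (Fin n → K))

theorem card_quotient_span {f : K[X]} (hf : f.Monic) :
    Nat.card (K[X] ⧸ Ideal.span {f}) = Nat.card K ^ f.natDegree := by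
  have : FiniteDimensional K (K[X] ⧸ Ideal.span {f}) := hf.finite_quotient
  rw [Module.natCard_eq_pow_finrank (K := K), finrank_quotient_span_eq_natDegree]

theorem card_torsionBy_matrixModule (A : Matrix (Fin n) (Fin n) K) (γ : FrobOrbit K) (k : ℕ) :
    Nat.card (Submodule.torsionBy K[X] (MatrixModule A) (γ.1 ^ k)) =
      (Nat.card K ^ γ.deg) ^ ((jordanBlocks A γ.1).map (min · k)).sum := by
  have : FiniteDimensional K (Submodule.torsionBy K[X] (MatrixModule A) (γ.1 ^ k)) :=
    FiniteDimensional.of_injective ((Submodule.subtype _).restrictScalars K)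
      Subtype.val_injective
  rw [Module.natCard_eq_pow_finrank (K := K), ← kerDim_eq_finrank_torsionBy,
    kerDim_eq_sum_jordanBlocks A γ.2.2.1 γ.2.1, pow_mul]
  rfl

/-- The residue field `K[X] / (γ)` has `q ^ γ.deg` elements, so the count is the unipotent one with
`q` replaced by `q ^ γ.deg`. -/
theorem card_isCyclicFamily_matrixModule [Finite K] (A : Matrix (Fin n) (Fin n) K) (γ : FrobOrbit K) :
    (Nat.card {x : _ → MatrixModule A //
      IsCyclicFamily (fun j => γ.1 ^ sortedParts (jordanBlocks A γ.1) j) x} : ℚ) =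
      (centPoly (jordanBlocks A γ.1)).eval ((Nat.card K : ℚ) ^ γ.deg) := by
  rw [card_isCyclicFamily γ.2.2.1 _ (fun j => ne_zero_of_mem_jordanBlocks (sortedParts_mem _ j))
    (antitone_sortedParts _), centPoly, eval_prod]
  refine Finset.prod_congr rfl fun j _ => ?_
  rw [card_torsionBy_matrixModule, card_torsionBy_matrixModule, card_quotient_span γ.2.1]
  simp only [eval_sub, eval_pow, eval_X, eval_mul, pow_add]
  push_cast
  rfl

variable (S : Finset (FrobOrbit K)) (h : FrobOrbit K → Multiset ℕ)

/-- The index set of the cyclic summands of a module with the given elementary divisors. -/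
abbrev BlockIndex : Type _ := Σ γ : S, Fin ((h γ).sort (· ≥ ·)).length

/-- The module with the given elementary divisors. -/
abbrev BlockModule : Type _ :=
  ∀ z : BlockIndex S h, K[X] ⧸ Ideal.span {z.1.1.1 ^ sortedParts (h z.1) z.2}

theorem sum_blockIndex (φ : FrobOrbit K → ℕ → ℕ) :
    ∑ z : BlockIndex S h, φ z.1 (sortedParts (h z.1) z.2) =
      ∑ γ ∈ S, ((h γ).map (φ γ)).sum := by
  rw [Fintype.sum_sigma, ← Finset.sum_coe_sort S]
  exact Finset.sum_congr rfl fun γ _ => sum_sortedParts (h γ.1) (φ γ.1)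

/-- The condition `hn` equates the two cardinalities, so isomorphisms are cyclic families, and these
split over the coprime `γ`. -/
theorem card_blockModule_equiv [Finite K] (hn : ∑ γ ∈ S, (h γ).sum * γ.deg = n)
    (A : Matrix (Fin n) (Fin n) K) (hA : ∀ γ ∈ S, jordanBlocks A γ.1 = h γ) :
    (Nat.card (BlockModule S h ≃ₗ[K[X]] MatrixModule A) : ℚ) =
      ∏ γ ∈ S, (centPoly (h γ)).eval ((Nat.card K : ℚ) ^ γ.deg) := by
  classical
  have hcard : Nat.card (MatrixModule A) = ∏ z : BlockIndex S h,
      Nat.card (K[X] ⧸ Ideal.span {z.1.1.1 ^ sortedParts (h z.1) z.2}) := by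
    rw [Finset.prod_congr rfl fun z _ => card_quotient_span (z.1.1.2.1.pow _),
      Finset.prod_pow_eq_pow_sum]
    simp only [natDegree_pow]
    rw [sum_blockIndex S h fun γ m => m * γ.1.natDegree]
    change Nat.card (Fin n → K) = _
    rw [Nat.card_fun, Nat.card_fin, ← hn]
    congr 1
    refine Finset.sum_congr rfl fun γ _ => ?_
    rw [Multiset.sum_map_mul_right, Multiset.map_id']
    rfl
  rw [← Nat.card_congr (cyclicFamilyEquiv _ hcard),
    card_isCyclicFamily_sigma (fun γ : S => γ.1.1)
      (fun γ δ hne => FrobOrbit.isCoprime fun h => hne (Subtype.ext h))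
      (fun γ : S => sortedParts (h γ)), ← Finset.prod_coe_sort S, Nat.cast_prod]
  refine Finset.prod_congr rfl fun γ _ => ?_
  have := card_isCyclicFamily_matrixModule A γ.1
  rwa [hA γ.1 γ.2] at this

end Count

/-! ### Sizes of Jordan classes and centralizers in GL_n -/

section ClassCount

variable {K : Type*} [Field K] {n : ℕ} (S : Finset (FrobOrbit K)) (h : FrobOrbit K → Multiset ℕ)

/-- The `K`-linear coordinates on the block module in which the variable acts by the matrix `A`. -/
def IsCoordinates (A : Matrix (Fin n) (Fin n) K) (ψ : BlockModule S h ≃ₗ[K] (Fin n → K)) : Prop :=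
  ∀ w, ψ ((X : K[X]) • w) = Matrix.toLin' A (ψ w)

/-- Isomorphisms of `K[X]`-modules from the block module to the module defined by `A` are the
coordinates in which the variable acts by `A`. -/
def equivCoordinates (A : Matrix (Fin n) (Fin n) K) :
    (BlockModule S h ≃ₗ[K[X]] MatrixModule A) ≃ {ψ // IsCoordinates S h A ψ} where
  toFun φ := ⟨(φ.restrictScalars K).trans (Module.AEval'.of (Matrix.toLin' A)).symm, fun w => by
    change (Module.AEval'.of (Matrix.toLin' A)).symm (φ ((X : K[X]) • w)) = _
    rw [map_smul]
    exact Module.AEval'.of_symm_X_smul _ _⟩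
  invFun ψ := (LinearEquiv.ofAEval (Matrix.toLin' A) ψ.1.symm fun m => by
    apply ψ.1.injective
    rw [ψ.2, LinearEquiv.apply_symm_apply, LinearEquiv.apply_symm_apply]
    rfl).symm
  left_inv φ := by
    refine LinearEquiv.ext fun w => ?_
    rfl
  right_inv ψ := rfl

theorem IsCoordinates.jordanBlocks_eq {A : Matrix (Fin n) (Fin n) K}
    {ψ : BlockModule S h ≃ₗ[K] (Fin n → K)} (hψ : IsCoordinates S h A ψ)
    (hpos : ∀ γ ∈ S, ∀ m ∈ h γ, m ≠ 0) {γ : FrobOrbit K} (hγ : γ ∈ S) :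
    jordanBlocks A γ.1 = h γ := by
  classical
  have E := ((equivCoordinates S h A).symm ⟨ψ, hψ⟩).symm
  rw [jordanBlocks_of_model (fun z : BlockIndex S h => z.1.1.2.2.1) (fun z => z.1.1.2.1) E
    γ.2.2.1 γ.2.1]
  have : (Finset.univ.filter fun z : BlockIndex S h =>
      z.1.1.1 = γ.1 ∧ sortedParts (h z.1) z.2 ≠ 0) =
      Finset.univ.map ⟨fun j => (⟨⟨γ, hγ⟩, j⟩ : BlockIndex S h),
        fun i j hij => eq_of_heq (Sigma.mk.inj hij).2⟩ := by
    ext ⟨δ, j⟩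
    simp only [Finset.mem_filter, Finset.mem_univ, true_and, Finset.mem_map]
    constructor
    · rintro ⟨h1, -⟩
      obtain rfl : δ = ⟨γ, hγ⟩ := Subtype.ext (Subtype.ext h1)
      exact ⟨j, rfl⟩
    · rintro ⟨i, hi⟩
      obtain rfl : δ = ⟨γ, hγ⟩ := (congrArg Sigma.fst hi).symm
      exact ⟨rfl, hpos γ hγ _ (sortedParts_mem _ _)⟩
  rw [this, Finset.map_val, Multiset.map_map]
  exact map_sortedParts (h γ)

theorem IsCoordinates.det_ne_zero {A : Matrix (Fin n) (Fin n) K}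
    {ψ : BlockModule S h ≃ₗ[K] (Fin n → K)} (hψ : IsCoordinates S h A ψ) : A.det ≠ 0 := by
  have E := ((equivCoordinates S h A).symm ⟨ψ, hψ⟩).symm
  rw [det_of_model (fun z => z.1.1.2.1) E]
  exact Finset.prod_ne_zero_iff.mpr fun z _ => pow_ne_zero _ z.1.1.norm.ne_zero

theorem IsCoordinates.eq {A B : Matrix (Fin n) (Fin n) K}
    {ψ : BlockModule S h ≃ₗ[K] (Fin n → K)} (hA : IsCoordinates S h A ψ)
    (hB : IsCoordinates S h B ψ) : A = B := by
  apply Matrix.toLin'.injective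
  refine LinearMap.ext fun v => ?_
  have h1 := hA (ψ.symm v)
  have h2 := hB (ψ.symm v)
  rw [LinearEquiv.apply_symm_apply] at h1 h2
  exact h1.symm.trans h2

theorem exists_isCoordinates (ψ : BlockModule S h ≃ₗ[K] (Fin n → K)) :
    ∃ A, IsCoordinates S h A ψ := by
  refine ⟨LinearMap.toMatrix' (ψ.toLinearMap ∘ₗ
    ((LinearMap.lsmul K[X] (BlockModule S h) X).restrictScalars K) ∘ₗ ψ.symm.toLinearMap),
    fun w => ?_⟩
  rw [Matrix.toLin'_toMatrix']
  simp

theorem card_blockModule_linearEquiv (hn : ∑ γ ∈ S, (h γ).sum * γ.deg = n) :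
    Nat.card (BlockModule S h ≃ₗ[K] (Fin n → K)) = Nat.card (GL (Fin n) K) := by
  have hfin : ∀ z : BlockIndex S h,
      FiniteDimensional K (K[X] ⧸ Ideal.span {z.1.1.1 ^ sortedParts (h z.1) z.2}) := fun z =>
    (z.1.1.2.1.pow _).finite_quotient
  have hr : Module.finrank K (BlockModule S h) = Module.finrank K (Fin n → K) := by
    rw [Module.finrank_fin_fun, Module.finrank_pi_fintype]
    simp only [finrank_quotient_span_eq_natDegree, natDegree_pow]
    rw [sum_blockIndex S h fun γ m => m * γ.1.natDegree, ← hn]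
    refine Finset.sum_congr rfl fun γ _ => ?_
    rw [Multiset.sum_map_mul_right, Multiset.map_id']
    rfl
  let ψ := LinearEquiv.ofFinrankEq _ _ hr
  rw [Nat.card_congr (Matrix.GeneralLinearGroup.toLin (n := Fin n) (R := K)).toEquiv,
    Nat.card_congr (LinearMap.GeneralLinearGroup.generalLinearEquiv K (Fin n → K)).toEquiv]
  exact Nat.card_congr
    { toFun := fun φ => ψ.symm.trans φ
      invFun := fun φ => ψ.trans φ
      left_inv := fun φ => by ext; simp
      right_inv := fun φ => by ext; simp }

/-- Double counting of pairs `(g, ψ)` where `g` is multiplication by `X` in the coordinates `ψ`.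
Every `ψ` determines one `g`, and there are `|GL_n|` coordinates; every `g` in the class has the
same number of `ψ`. No conjugacy statement is needed, and nonemptiness of the class comes for free.
-/
theorem card_jordanClass_mul [Finite K] (hn : ∑ γ ∈ S, (h γ).sum * γ.deg = n)
    (hpos : ∀ γ ∈ S, ∀ m ∈ h γ, m ≠ 0) :
    (Nat.card {g : GL (Fin n) K // ∀ γ ∈ S, jordanBlocks g.1 γ.1 = h γ} : ℚ) *
      ∏ γ ∈ S, (centPoly (h γ)).eval ((Nat.card K : ℚ) ^ γ.deg) = Nat.card (GL (Fin n) K) := by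
  let T := {g : GL (Fin n) K // ∀ γ ∈ S, jordanBlocks g.1 γ.1 = h γ}
  have hT : Fintype T := Fintype.ofFinite _
  rw [← card_blockModule_linearEquiv S h hn]
  have hfin : Finite (BlockModule S h ≃ₗ[K] (Fin n → K)) := by
    refine (Nat.card_pos_iff.mp ?_).2
    rw [card_blockModule_linearEquiv S h hn]
    exact Nat.card_pos
  have hbij : Function.Bijective
      (fun z : Σ g : T, {ψ // IsCoordinates S h g.1.1 ψ} => z.2.1) := by
    constructor
    · rintro ⟨⟨g, hg⟩, ψ, hψ⟩ ⟨⟨g', hg'⟩, ψ', hψ'⟩ rfl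
      obtain rfl : g = g' := Units.ext (IsCoordinates.eq S h hψ hψ')
      rfl
    · intro ψ
      obtain ⟨A, hA⟩ := exists_isCoordinates S h ψ
      exact ⟨⟨⟨Matrix.GeneralLinearGroup.mkOfDetNeZero A (hA.det_ne_zero S h),
        fun γ hγ => hA.jordanBlocks_eq S h hpos hγ⟩, ψ, hA⟩, rfl⟩
  rw [← Nat.card_congr (Equiv.ofBijective _ hbij), Nat.card_sigma, Nat.cast_sum]
  rw [Finset.sum_congr rfl fun (g : T) _ => (congrArg Nat.cast (Nat.card_congr
    (equivCoordinates S h g.1.1).symm)).trans (card_blockModule_equiv S h hn g.1.1 g.2)]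
  rw [Finset.sum_const, nsmul_eq_mul, Finset.card_univ, Nat.card_eq_fintype_card]

/-- Fix coordinates `ψ` in which `X` acts by `g`. Then `c ↦ c ∘ ψ` identifies `GL_n` with all
coordinates, and `c` commutes with `g` iff `c ∘ ψ` is again adapted to `g`. -/
theorem card_centralizer_GL [Finite K] (g : GL (Fin n) K)
    (hS : ∀ γ : FrobOrbit K, jordanBlocks g.1 γ.1 ≠ 0 → γ ∈ S) :
    (Nat.card (Subgroup.centralizer {g}) : ℚ) =
      ∏ γ ∈ S, (centPoly (jordanBlocks g.1 γ.1)).eval ((Nat.card K : ℚ) ^ γ.deg) := by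
  set h : FrobOrbit K → Multiset ℕ := fun γ => jordanBlocks g.1 γ.1 with hh
  have h1 := card_blockModule_equiv S h (sum_jordanBlocks_mul_deg g S hS) g.1 fun γ _ => rfl
  -- Positivity of the count supplies the first isomorphism.
  have hpos : (0 : ℚ) < Nat.card (BlockModule S h ≃ₗ[K[X]] MatrixModule g.1) := by
    rw [h1]
    refine Finset.prod_pos fun γ _ => centPoly_eval_pos _
      (fun m hm => ne_zero_of_mem_jordanBlocks hm) (one_lt_pow₀ ?_ γ.2.2.1.natDegree_pos.ne')
    exact_mod_cast Finite.one_lt_card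
  rw [← h1]
  obtain ⟨ψ, hψ⟩ := equivCoordinates S h g.1 (Nat.card_pos_iff.mp (Nat.cast_pos.mp hpos)).1.some
  rw [Nat.card_congr (equivCoordinates S h g.1)]
  let Φ : GL (Fin n) K ≃ (BlockModule S h ≃ₗ[K] (Fin n → K)) :=
    (Matrix.GeneralLinearGroup.toLin.trans
      (LinearMap.GeneralLinearGroup.generalLinearEquiv K (Fin n → K))).toEquiv.trans
    { toFun := fun φ => ψ.trans φ
      invFun := fun φ => ψ.symm.trans φ
      left_inv := fun φ => by ext; simp
      right_inv := fun φ => by ext; simp }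
  have hΦ : ∀ c w, Φ c w = c.1.mulVec (ψ w) := fun c w => rfl
  refine congrArg Nat.cast (Nat.card_congr (Equiv.subtypeEquiv Φ fun c => ?_))
  rw [Subgroup.mem_centralizer_singleton_iff]
  constructor
  · intro hc w
    rw [hΦ, hψ, hΦ, Matrix.toLin'_apply, Matrix.toLin'_apply, Matrix.mulVec_mulVec,
      Matrix.mulVec_mulVec]
    exact congrArg (fun a : GL (Fin n) K => a.1.mulVec (ψ w)) hc
  · intro hc
    refine Units.ext (Matrix.toLin'.injective (LinearMap.ext fun v => ?_))
    have h2 := hc (ψ.symm v)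
    rw [hΦ, hψ, hΦ, LinearEquiv.apply_symm_apply, Matrix.toLin'_apply, Matrix.toLin'_apply,
      Matrix.mulVec_mulVec, Matrix.mulVec_mulVec] at h2
    exact h2

end ClassCount

/-! ### Multi-partitions and their centralizer polynomials -/

section MultiPartition

variable {r : ℕ}

theorem MultiPartition.ext_parts {μ ν : MultiPartition r}
    (h : ∀ i, (μ.2 i).parts = (ν.2 i).parts) : μ = ν := by
  obtain ⟨v, a⟩ := μ
  obtain ⟨w, b⟩ := ν
  obtain rfl : v = w := funext fun i => by rw [← (a i).parts_sum, ← (b i).parts_sum, h]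
  congr 1
  exact funext fun i => Nat.Partition.ext (h i)

theorem MultiPartition.size_apply (μ : MultiPartition r) (i : Fin r) :
    μ.size i = (μ.2 i).parts.sum := (μ.2 i).parts_sum.symm

theorem MultiPartition.size_eq_zero_iff (μ : MultiPartition r) :
    μ.size = 0 ↔ ∀ i, (μ.2 i).parts = 0 := by
  constructor
  · intro h i
    have h1 : (μ.2 i).parts.sum = 0 := by rw [← μ.size_apply, h]; rfl
    refine Multiset.eq_zero_of_forall_notMem fun m hm => ?_
    have h2 := (μ.2 i).parts_pos hm
    have h3 := Multiset.le_sum_of_mem hm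
    omega
  · intro h
    funext i
    rw [μ.size_apply, h i]
    rfl

/-- The polynomial whose value at `q` is the order of the centralizer of a unipotent element of
type `μ`. -/
def centralizerPoly (μ : MultiPartition r) : ℚ[X] := ∏ i, centPoly (μ.2 i).parts

theorem centralizerPoly_eval_pos (μ : MultiPartition r) {q : ℚ} (hq : 1 < q) :
    0 < (centralizerPoly μ).eval q := by
  rw [centralizerPoly, eval_prod]
  exact Finset.prod_pos fun i _ =>
    centPoly_eval_pos _ (fun m hm => ((μ.2 i).parts_pos hm).ne') hq

theorem centralizerPoly_of_size_eq_zero {μ : MultiPartition r} (h : μ.size = 0) :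
    centralizerPoly μ = 1 := by
  rw [centralizerPoly]
  refine Finset.prod_eq_one fun i _ => ?_
  rw [μ.size_eq_zero_iff.mp h i, centPoly]
  refine Finset.prod_eq_one fun j _ => ?_
  exact absurd (sortedParts_mem _ j) (Multiset.notMem_zero _)

end MultiPartition

/-! ### Classes, centralizers and types in GL_v -/

section GLv

variable {r : ℕ} {K : Type*} [Field K] {v : Fin r → ℕ}

theorem parts_jordanMap (g : GLv K v) (γ : FrobOrbit K) (i : Fin r) :
    ((jordanMap g γ).2 i).parts = jordanBlocks (g i).1 γ.1 := by
  change Multiset.filter _ _ = _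
  exact Multiset.filter_eq_self.mpr fun m hm => ne_zero_of_mem_jordanBlocks hm

theorem size_jordanMap (g : GLv K v) (γ : FrobOrbit K) (i : Fin r) :
    (jordanMap g γ).size i = (jordanBlocks (g i).1 γ.1).sum := rfl

variable {S : Finset (FrobOrbit K)}

theorem jordanBlocks_support {g : GLv K v} (hS : ∀ γ, (jordanMap g γ).size ≠ 0 → γ ∈ S) (i : Fin r)
    (γ : FrobOrbit K) (hγ : jordanBlocks (g i).1 γ.1 ≠ 0) : γ ∈ S := by
  refine hS γ fun h => hγ ?_
  rw [← parts_jordanMap]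
  exact (MultiPartition.size_eq_zero_iff _).mp h i

theorem sum_deg_mul_size {g : GLv K v} (hS : ∀ γ, (jordanMap g γ).size ≠ 0 → γ ∈ S) (i : Fin r) :
    ∑ γ ∈ S, γ.deg * (jordanMap g γ).size i = v i := by
  simp only [size_jordanMap, mul_comm (FrobOrbit.deg _)]
  exact sum_jordanBlocks_mul_deg (g i) S (jordanBlocks_support hS i)

/-- This bounds the relevant orbits uniformly in `g`, so that one finite set of orbits serves all of
`GL_v`. -/
theorem deg_le_of_size_ne_zero {g : GLv K v} {γ : FrobOrbit K} (h : (jordanMap g γ).size ≠ 0) :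
    γ.deg ≤ ∑ i, v i := by
  classical
  obtain ⟨i, hi⟩ := Function.ne_iff.mp h
  have h1 := sum_deg_mul_size (g := g) (S := (finite_jordanMap_size_ne_zero g).toFinset)
    (fun γ hγ => by simpa using hγ) i
  have h2 : γ.deg * (jordanMap g γ).size i ≤ v i := by
    rw [← h1]
    exact Finset.single_le_sum (f := fun γ => γ.deg * (jordanMap g γ).size i)
      (fun _ _ => Nat.zero_le _) (by simpa using h)
  calc γ.deg ≤ γ.deg * (jordanMap g γ).size i := Nat.le_mul_of_pos_right _ (Nat.pos_of_ne_zero hi)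
    _ ≤ v i := h2
    _ ≤ ∑ i, v i := Finset.single_le_sum (fun _ _ => Nat.zero_le _) (Finset.mem_univ i)

theorem finite_deg_le (K : Type*) [Field K] [Finite K] (N : ℕ) :
    {γ : FrobOrbit K | γ.deg ≤ N}.Finite := by
  have h1 : Finite (degreeLT K (N + 1)) :=
    Finite.of_equiv _ (degreeLTEquiv K (N + 1)).toEquiv.symm
  refine Set.Finite.of_finite_image (f := Subtype.val) (Set.Finite.subset
    (Set.toFinite (degreeLT K (N + 1) : Set K[X])) ?_) Subtype.val_injective.injOn
  rintro _ ⟨γ, hγ, rfl⟩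
  rw [SetLike.mem_coe, mem_degreeLT]
  exact lt_of_le_of_lt degree_le_natDegree (by exact_mod_cast Nat.lt_succ_of_le hγ)

/-- The Frobenius orbits of size at most `N`. -/
def orbitsLE (K : Type*) [Field K] [Finite K] (N : ℕ) : Finset (FrobOrbit K) :=
  (finite_deg_le K N).toFinset

theorem mem_orbitsLE [Finite K] {N : ℕ} {γ : FrobOrbit K} : γ ∈ orbitsLE K N ↔ γ.deg ≤ N := by
  simp [orbitsLE]

theorem card_centralizer [Finite K] {g : GLv K v} (hS : ∀ γ, (jordanMap g γ).size ≠ 0 → γ ∈ S) :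
    (Nat.card (Subgroup.centralizer {g}) : ℚ) =
      ∏ γ ∈ S, (centralizerPoly (jordanMap g γ)).eval ((Nat.card K : ℚ) ^ γ.deg) := by
  have e : Subgroup.centralizer {g} ≃ ∀ i, Subgroup.centralizer {g i} :=
    { toFun := fun c i => ⟨c.1 i, Subgroup.mem_centralizer_singleton_iff.mpr
        (congrFun (Subgroup.mem_centralizer_singleton_iff.mp c.2) i)⟩
      invFun := fun c => ⟨fun i => (c i).1, Subgroup.mem_centralizer_singleton_iff.mpr
        (funext fun i => Subgroup.mem_centralizer_singleton_iff.mp (c i).2)⟩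
      left_inv := fun c => rfl
      right_inv := fun c => rfl }
  rw [Nat.card_congr e, Nat.card_pi, Nat.cast_prod]
  simp only [card_centralizer_GL S (g _) (jordanBlocks_support hS _)]
  rw [Finset.prod_comm]
  refine Finset.prod_congr rfl fun γ _ => ?_
  rw [centralizerPoly, eval_prod]
  exact Finset.prod_congr rfl fun i _ => by rw [parts_jordanMap]

theorem card_class_mul [Finite K] (H : FrobOrbit K → MultiPartition r)
    (hH : ∀ i, ∑ γ ∈ S, γ.deg * (H γ).size i = v i) :
    (Nat.card {g : GLv K v // ∀ γ ∈ S, jordanMap g γ = H γ} : ℚ) *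
      ∏ γ ∈ S, (centralizerPoly (H γ)).eval ((Nat.card K : ℚ) ^ γ.deg) = Nat.card (GLv K v) := by
  have e : {g : GLv K v // ∀ γ ∈ S, jordanMap g γ = H γ} ≃
      ∀ i, {g : GL (Fin (v i)) K // ∀ γ ∈ S, jordanBlocks g.1 γ.1 = ((H γ).2 i).parts} :=
    { toFun := fun g i => ⟨g.1 i, fun γ hγ => by rw [← parts_jordanMap, g.2 γ hγ]⟩
      invFun := fun g => ⟨fun i => (g i).1, fun γ hγ => MultiPartition.ext_parts fun i => by
        rw [parts_jordanMap]; exact (g i).2 γ hγ⟩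
      left_inv := fun c => rfl
      right_inv := fun c => rfl }
  rw [Nat.card_congr e, Nat.card_pi, Nat.card_pi, Nat.cast_prod, Nat.cast_prod]
  simp only [centralizerPoly, eval_prod]
  rw [Finset.prod_comm, ← Finset.prod_mul_distrib]
  refine Finset.prod_congr rfl fun i _ => ?_
  refine card_jordanClass_mul S (fun γ => ((H γ).2 i).parts) ?_
    fun γ _ m hm => (((H γ).2 i).parts_pos hm).ne'
  rw [← hH i]
  exact Finset.sum_congr rfl fun γ _ => by rw [mul_comm, MultiPartition.size_apply]

theorem twistedChar_eq_prod {κ : Type*} [Field κ] (α : Kˣ →* κˣ) {g : GLv K v}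
    (hS : ∀ γ, (jordanMap g γ).size ≠ 0 → γ ∈ S) :
    twistedChar α v g = ∏ γ ∈ S, (α γ.norm : κ) ^ ∑ i, (jordanMap g γ).size i := by
  rw [twistedChar]
  simp only [det_eq_prod_norm (g _) S (jordanBlocks_support hS _), map_prod, map_pow,
    Units.coe_prod, Units.val_pow_eq_pow_val]
  rw [Finset.prod_comm]
  refine Finset.prod_congr rfl fun γ _ => ?_
  rw [Finset.prod_pow_eq_pow_sum]
  rfl

/-- The type records how often each pair (size, partition) occurs, so its product is an orbit
product with equal factors collected. Orbits outside the support contribute `1` by `hφ`. -/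
theorem prod_typeOf {N : Type*} [CommMonoid N] (φ : ℕ × MultiPartition r → N)
    (hφ : ∀ p : ℕ × MultiPartition r, p.2.size = 0 → φ p = 1) {g : GLv K v}
    (hS : ∀ γ, (jordanMap g γ).size ≠ 0 → γ ∈ S) :
    ((typeOf g).1.prod fun p m => φ p ^ m) = ∏ γ ∈ S, φ (γ.deg, jordanMap g γ) := by
  classical
  rw [← Finset.prod_filter_of_ne (p := fun γ => (jordanMap g γ).size ≠ 0)
    (fun γ _ h h' => h (hφ _ h'))]
  rw [Finset.prod_comp φ fun γ : FrobOrbit K => (γ.deg, jordanMap g γ)]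
  have hval : ∀ p : ℕ × MultiPartition r, p.2.size ≠ 0 → (typeOf g).1 p =
      {γ ∈ S.filter fun γ => (jordanMap g γ).size ≠ 0 | (γ.deg, jordanMap g γ) = p}.card := by
    intro p hp
    change (if p.2.size = 0 then 0
      else Set.ncard {γ : FrobOrbit K | γ.deg = p.1 ∧ jordanMap g γ = p.2}) = _
    rw [if_neg hp, ← Set.ncard_coe_finset]
    congr 1
    ext γ
    simp only [Set.mem_ofPred_eq, Finset.coe_filter, Finset.mem_filter, Prod.ext_iff]
    constructor
    · rintro ⟨h1, h2⟩
      have h3 : (jordanMap g γ).size ≠ 0 := by rwa [h2]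
      exact ⟨⟨hS γ h3, h3⟩, h1, h2⟩
    · exact fun h => h.2
  rw [Finsupp.prod]
  refine (Finset.prod_subset ?_ ?_).trans (Finset.prod_congr rfl ?_)
  · intro p hp
    have h1 := ((typeOf g).2 p hp).2
    rw [Finsupp.mem_support_iff, hval p h1] at hp
    obtain ⟨γ, hγ⟩ := Finset.card_ne_zero.mp hp
    exact Finset.mem_image.mpr ⟨γ, (Finset.mem_filter.mp hγ).1, (Finset.mem_filter.mp hγ).2⟩
  · intro p _ hp
    rw [Finsupp.notMem_support_iff.mp hp, pow_zero]
  · intro p hp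
    obtain ⟨γ, hγ, rfl⟩ := Finset.mem_image.mp hp
    rw [hval _ (Finset.mem_filter.mp hγ).2]

theorem prod_unipotentType {N : Type*} [CommMonoid N] (φ : ℕ × MultiPartition r → N)
    (hφ : ∀ p : ℕ × MultiPartition r, p.2.size = 0 → φ p = 1) (μ : MultiPartition r) :
    ((unipotentType μ).1.prod fun p m => φ p ^ m) = φ (1, μ) := by
  rw [unipotentType]
  split_ifs with h
  · exact Finsupp.prod_zero_index.trans (hφ (1, μ) h).symm
  · exact (Finsupp.prod_single_index (h := fun p m => φ p ^ m) (pow_zero _)).trans (pow_one _)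

theorem centralizerPoly_eval_eq_card [Finite K] (μ : MultiPartition r) (g : GLv K μ.size)
    (hg : typeOf g = unipotentType μ) :
    (centralizerPoly μ).eval (Nat.card K : ℚ) = (Nat.card (Subgroup.centralizer {g}) : ℚ) := by
  have hS : ∀ γ, (jordanMap g γ).size ≠ 0 → γ ∈ (finite_jordanMap_size_ne_zero g).toFinset :=
    fun γ hγ => by simpa using hγ
  let φ : ℕ × MultiPartition r → ℚ := fun p => (centralizerPoly p.2).eval ((Nat.card K : ℚ) ^ p.1)
  have hφ : ∀ p : ℕ × MultiPartition r, p.2.size = 0 → φ p = 1 := fun p hp => by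
    simp [φ, centralizerPoly_of_size_eq_zero hp]
  rw [card_centralizer hS]
  refine Eq.trans ?_ (prod_typeOf φ hφ hS)
  rw [hg, prod_unipotentType φ hφ μ]
  simp [φ]

/-- The class with Jordan map `μ` at the orbit of the eigenvalue `1` is nonempty by
`card_class_mul`, since `|GL_v|` is nonzero. -/
theorem exists_typeOf_eq_unipotentType (K : Type*) [Field K] [Finite K] (μ : MultiPartition r) :
    ∃ g : GLv K μ.size, typeOf g = unipotentType μ := by
  classical
  have hdeg : (X - C (1 : K)).natDegree = 1 := natDegree_X_sub_C 1
  let γ₀ : FrobOrbit K := ⟨X - C 1, monic_X_sub_C 1, irreducible_X_sub_C 1, fun h => by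
    have := congrArg (eval 0) h
    simp at this⟩
  have hd : γ₀.deg = 1 := hdeg
  have h1 := card_class_mul (S := {γ₀}) (v := μ.size) (fun _ : FrobOrbit K => μ)
    fun i => by simp [hd]
  have h2 : 0 < Nat.card {g : GLv K μ.size // ∀ γ ∈ ({γ₀} : Finset (FrobOrbit K)),
      jordanMap g γ = μ} := by
    rw [Nat.pos_iff_ne_zero]
    intro h
    rw [h, Nat.cast_zero, zero_mul] at h1
    exact Nat.card_pos.ne' (Nat.cast_eq_zero.mp h1.symm)
  obtain ⟨⟨g, hg⟩⟩ := (Nat.card_pos_iff.mp h2).1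
  have hg0 : jordanMap g γ₀ = μ := hg γ₀ (Finset.mem_singleton_self _)
  -- The blocks at `γ₀` already fill the whole dimension, leaving no room for another orbit.
  have hother : ∀ γ, γ ≠ γ₀ → (jordanMap g γ).size = 0 := fun γ hγ => by
    funext i
    have h3 := sum_deg_mul_size (g := g)
      (S := insert γ (insert γ₀ (finite_jordanMap_size_ne_zero g).toFinset))
      (fun γ hγ => by simp only [Finset.mem_insert, Set.Finite.mem_toFinset]; tauto) i
    have h4 : ∑ δ ∈ {γ, γ₀}, δ.deg * (jordanMap g δ).size i ≤ μ.size i := by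
      rw [← h3]
      refine Finset.sum_le_sum_of_subset ?_
      intro x
      simp only [Finset.mem_insert, Finset.mem_singleton]
      tauto
    rw [Finset.sum_pair hγ, hg0, hd, one_mul] at h4
    have h5 : γ.deg * (jordanMap g γ).size i = 0 := by omega
    exact (Nat.mul_eq_zero.mp h5).resolve_left γ.2.2.1.natDegree_pos.ne'
  refine ⟨g, Subtype.ext (Finsupp.ext fun p => ?_)⟩
  change (if p.2.size = 0 then 0
      else Set.ncard {γ : FrobOrbit K | γ.deg = p.1 ∧ jordanMap g γ = p.2}) = _
  have hmem : ∀ γ, p.2.size ≠ 0 → jordanMap g γ = p.2 → γ = γ₀ := fun γ h h' => by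
    by_contra hne
    exact h (h' ▸ hother γ hne)
  by_cases h3 : p.2.size = 0
  · rw [if_pos h3, unipotentType]
    split_ifs with h4
    · rfl
    · exact (Finsupp.single_eq_of_ne (by rintro rfl; exact h4 h3)).symm
  rw [if_neg h3]
  by_cases hp : p = (1, μ)
  · subst hp
    rw [unipotentType, dif_neg h3]
    refine Eq.trans ?_ Finsupp.single_eq_same.symm
    rw [Set.ncard_eq_one]
    refine ⟨γ₀, Set.eq_singleton_iff_unique_mem.mpr ⟨⟨hd, hg0⟩, fun γ hγ => hmem γ h3 hγ.2⟩⟩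
  · have h5 : {γ : FrobOrbit K | γ.deg = p.1 ∧ jordanMap g γ = p.2} = ∅ := by
      refine Set.eq_empty_of_forall_notMem fun γ hγ => hp ?_
      obtain rfl := hmem γ h3 hγ.2
      exact Prod.ext (hγ.1.symm.trans hd) (hγ.2.symm.trans hg0)
    rw [h5, Set.ncard_empty, unipotentType]
    split_ifs with h4
    · rfl
    · exact (Finsupp.single_eq_of_ne hp).symm

end GLv

/-! ### Evaluation of rational functions -/

section Eval

/-- The rational functions without a pole at `q`. -/
def regularAt (q : ℚ) : Subring (RatFunc ℚ) where
  carrier := {f | f.denom.eval q ≠ 0}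
  zero_mem' := by simp
  one_mem' := by simp
  add_mem' {f g} hf hg := fun h => by
    have h1 := eval_eq_zero_of_dvd_of_eval_eq_zero (RatFunc.denom_add_dvd f g) h
    rw [eval_mul] at h1
    exact mul_ne_zero hf hg h1
  mul_mem' {f g} hf hg := fun h => by
    have h1 := eval_eq_zero_of_dvd_of_eval_eq_zero (RatFunc.denom_mul_dvd f g) h
    rw [eval_mul] at h1
    exact mul_ne_zero hf hg h1
  neg_mem' {f} hf := fun h => by
    have h0 : (-f).denom ∣ f.denom := by
      rw [RatFunc.denom_dvd (RatFunc.denom_ne_zero f)]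
      refine ⟨-f.num, ?_⟩
      rw [map_neg, neg_div, RatFunc.num_div_denom]
    exact hf (eval_eq_zero_of_dvd_of_eval_eq_zero h0 h)

/-- Evaluation at `q` of the rational functions without a pole at `q`. -/
def evalRegular (q : ℚ) : regularAt q →+* ℚ where
  toFun f := f.1.eval (RingHom.id ℚ) q
  map_zero' := RatFunc.eval_zero _ _
  map_one' := RatFunc.eval_one _ _
  map_add' f g := RatFunc.eval_add _ _ f.2 g.2
  map_mul' f g := RatFunc.eval_mul _ _ f.2 g.2

/-- The value of a rational function at `q` (zero at a pole). -/
def valueAt (q : ℚ) (f : RatFunc ℚ) : ℚ := f.eval (RingHom.id ℚ) q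

variable {q : ℚ}

theorem valueAt_add {f g : RatFunc ℚ} (hf : f ∈ regularAt q) (hg : g ∈ regularAt q) :
    valueAt q (f + g) = valueAt q f + valueAt q g := map_add (evalRegular q) ⟨f, hf⟩ ⟨g, hg⟩

theorem valueAt_mul {f g : RatFunc ℚ} (hf : f ∈ regularAt q) (hg : g ∈ regularAt q) :
    valueAt q (f * g) = valueAt q f * valueAt q g := map_mul (evalRegular q) ⟨f, hf⟩ ⟨g, hg⟩

theorem valueAt_sum {ι : Type*} (s : Finset ι) (f : ι → RatFunc ℚ)
    (hf : ∀ i ∈ s, f i ∈ regularAt q) : valueAt q (∑ i ∈ s, f i) = ∑ i ∈ s, valueAt q (f i) := by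
  classical
  induction s using Finset.induction_on with
  | empty => exact RatFunc.eval_zero _ _
  | insert a s ha ih =>
    rw [Finset.sum_insert ha, Finset.sum_insert ha, valueAt_add (hf a (Finset.mem_insert_self a s))
      (sum_mem fun i hi => hf i (Finset.mem_insert_of_mem hi)),
      ih fun i hi => hf i (Finset.mem_insert_of_mem hi)]

theorem valueAt_prod {ι : Type*} (s : Finset ι) (f : ι → RatFunc ℚ)
    (hf : ∀ i ∈ s, f i ∈ regularAt q) : valueAt q (∏ i ∈ s, f i) = ∏ i ∈ s, valueAt q (f i) := by
  classical
  induction s using Finset.induction_on with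
  | empty => exact RatFunc.eval_one _ _
  | insert a s ha ih =>
    rw [Finset.prod_insert ha, Finset.prod_insert ha,
      valueAt_mul (hf a (Finset.mem_insert_self a s))
      (prod_mem fun i hi => hf i (Finset.mem_insert_of_mem hi)),
      ih fun i hi => hf i (Finset.mem_insert_of_mem hi)]

theorem algebraMap_mem_regularAt (p : ℚ[X]) : algebraMap ℚ[X] (RatFunc ℚ) p ∈ regularAt q := by
  change (RatFunc.denom (algebraMap ℚ[X] (RatFunc ℚ) p)).eval q ≠ 0
  rw [RatFunc.denom_algebraMap, eval_one]
  exact one_ne_zero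

theorem valueAt_algebraMap (p : ℚ[X]) : valueAt q (algebraMap ℚ[X] (RatFunc ℚ) p) = p.eval q :=
  RatFunc.eval_algebraMap _ _ (S := ℚ[X]) p

theorem div_mem_regularAt {f : RatFunc ℚ} (hf : f ∈ regularAt q) {p : ℚ[X]} (hp : p.eval q ≠ 0) :
    f / algebraMap ℚ[X] (RatFunc ℚ) p ∈ regularAt q := by
  rw [div_eq_mul_inv]
  refine mul_mem hf fun h => hp (eval_eq_zero_of_dvd_of_eval_eq_zero ?_ h)
  rw [RatFunc.denom_dvd fun h0 => hp (by rw [h0, eval_zero])]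
  exact ⟨1, by simp⟩

theorem valueAt_div {f : RatFunc ℚ} (hf : f ∈ regularAt q) {p : ℚ[X]} (hp : p.eval q ≠ 0) :
    valueAt q (f / algebraMap ℚ[X] (RatFunc ℚ) p) = valueAt q f / p.eval q := by
  have hp0 : algebraMap ℚ[X] (RatFunc ℚ) p ≠ 0 := fun h0 => hp (by
    rw [(map_eq_zero_iff _ (RatFunc.algebraMap_injective ℚ)).mp h0, eval_zero])
  rw [eq_div_iff hp, ← valueAt_algebraMap, ← valueAt_mul (div_mem_regularAt hf hp)
    (algebraMap_mem_regularAt p), div_mul_cancel₀ _ hp0]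

theorem ratCast_eq_algebraMap (a : ℚ) : (a : RatFunc ℚ) = algebraMap ℚ[X] (RatFunc ℚ) (C a) := by
  rw [RatFunc.algebraMap_C]
  exact (map_ratCast (RatFunc.C (K := ℚ)) a).symm

theorem ratCast_mem_regularAt (a : ℚ) : (a : RatFunc ℚ) ∈ regularAt q := by
  rw [ratCast_eq_algebraMap]
  exact algebraMap_mem_regularAt _

theorem valueAt_ratCast (a : ℚ) : valueAt q (a : RatFunc ℚ) = a := by
  rw [ratCast_eq_algebraMap, valueAt_algebraMap, eval_C]

variable {d : ℕ}

theorem nonZeroDivisors_le_comap_expand (hd : d ≠ 0) :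
    nonZeroDivisors ℚ[X] ≤ (nonZeroDivisors ℚ[X]).comap (expand ℚ d) := by
  intro p hp
  rw [Submonoid.mem_comap, mem_nonZeroDivisors_iff_ne_zero, ne_eq,
    expand_eq_zero (Nat.pos_of_ne_zero hd)]
  exact nonZeroDivisors.ne_zero hp

/-- The substitution `f(t) ↦ f(t ^ d)` as a homomorphism of rings. -/
def substPowHom (hd : d ≠ 0) : RatFunc ℚ →+* RatFunc ℚ :=
  RatFunc.mapRingHom (expand ℚ d) (nonZeroDivisors_le_comap_expand hd)

theorem substPow_eq_div (d : ℕ) (f : RatFunc ℚ) :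
    substPow d f = algebraMap ℚ[X] (RatFunc ℚ) (expand ℚ d f.num) /
      algebraMap ℚ[X] (RatFunc ℚ) (expand ℚ d f.denom) := by
  have h : ∀ p : ℚ[X], eval₂ (algebraMap ℚ (RatFunc ℚ)) (RatFunc.X ^ d) p =
      algebraMap ℚ[X] (RatFunc ℚ) (expand ℚ d p) := fun p => by
    rw [expand_eq_sum, eval₂_eq_sum, Polynomial.sum, Polynomial.sum, map_sum]
    refine Finset.sum_congr rfl fun n _ => ?_
    rw [map_mul, map_pow, map_pow, RatFunc.algebraMap_X, RatFunc.algebraMap_C,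
      eq_ratCast (algebraMap ℚ (RatFunc ℚ)), eq_ratCast RatFunc.C]
  rw [substPow, RatFunc.eval, h, h]

theorem substPowHom_apply (hd : d ≠ 0) (f : RatFunc ℚ) : substPowHom hd f = substPow d f := by
  rw [substPow_eq_div]
  exact RatFunc.map_apply _ (nonZeroDivisors_le_comap_expand hd) f

theorem substPow_mem_regularAt {f : RatFunc ℚ} (hf : f ∈ regularAt (q ^ d)) :
    substPow d f ∈ regularAt q := by
  rw [substPow_eq_div]
  refine div_mem_regularAt (algebraMap_mem_regularAt _) ?_
  rw [expand_eval]
  exact hf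

theorem valueAt_substPow {f : RatFunc ℚ} (hf : f ∈ regularAt (q ^ d)) :
    valueAt q (substPow d f) = valueAt (q ^ d) f := by
  rw [substPow_eq_div, valueAt_div (algebraMap_mem_regularAt _) (by rw [expand_eval]; exact hf),
    valueAt_algebraMap, expand_eval, expand_eval]
  rfl

theorem substPow_substPow {d e : ℕ} (hd : d ≠ 0) (f : RatFunc ℚ) :
    substPow d (substPow e f) = substPow (d * e) f := by
  rw [← substPowHom_apply hd, substPow_eq_div e, map_div₀, substPow_eq_div (d * e)]
  have h : ∀ p : ℚ[X], substPowHom hd (algebraMap ℚ[X] (RatFunc ℚ) (expand ℚ e p)) =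
      algebraMap ℚ[X] (RatFunc ℚ) (expand ℚ (d * e) p) := fun p => by
    rw [expand_mul]
    have h1 := RatFunc.map_apply_div (expand ℚ d) (nonZeroDivisors_le_comap_expand hd)
      (expand ℚ e p) 1
    rwa [map_one, map_one, map_one, div_one, div_one] at h1
  rw [h, h]

theorem substPow_one (f : RatFunc ℚ) : substPow 1 f = f := by
  rw [substPow_eq_div, expand_one, expand_one, RatFunc.num_div_denom]

theorem substPow_X (d : ℕ) : substPow d RatFunc.X = RatFunc.X ^ d := RatFunc.eval_X _ _

theorem takesValueAt_iff {κ : Type*} [DivisionRing κ] {f : RatFunc ℚ} {q : ℕ} {y : κ} :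
    TakesValueAt f q y ↔ f ∈ regularAt (q : ℚ) ∧ y = (valueAt q f : κ) := Iff.rfl

end Eval

/-! ### Log compatible families: regularity and factorization over orbits -/

section LogCompatible

variable {r : ℕ} {F : FunctionFamily.{u} r} {Fty : MultiType r → RatFunc ℚ}

theorem exists_finite_field_card {p : ℕ} (hp : p.Prime) {m : ℕ} (hm : m ≠ 0) :
    ∃ (K : Type u) (_ : Field K), Finite K ∧ Nat.card K = p ^ m := by
  have := Fact.mk hp
  refine ⟨ULift.{u} (GaloisField p m), inferInstance, inferInstance, ?_⟩
  rw [Nat.card_congr Equiv.ulift, GaloisField.card p m hm]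

/-- Log compatibility gives regularity only at field orders, for types of actual elements. Here `q ^
d` is the order of a finite field, and unipotent elements of type `μ` exist over it. -/
theorem IsLogCompatible.mem_regularAt (hF : IsLogCompatible F Fty) (K : Type*) [Field K] [Finite K]
    (μ : MultiPartition r) {d : ℕ} (hd : d ≠ 0) :
    Fty (unipotentType μ) ∈ regularAt ((Nat.card K : ℚ) ^ d) := by
  have := Fintype.ofFinite K
  obtain ⟨p, n, hp, hn, hq⟩ := FiniteField.isPrimePow_card K
  rw [← Nat.card_eq_fintype_card] at hq
  obtain ⟨L, _, hL, hcard⟩ := exists_finite_field_card.{u} hp.nat_prime (mul_ne_zero hn.ne' hd)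
  obtain ⟨g, hg⟩ := exists_typeOf_eq_unipotentType L μ
  have h1 := (hF.value L _ g).1
  rw [hg, hcard, pow_mul, hq] at h1
  exact_mod_cast h1

theorem IsLogCompatible.zero_type (hF : IsLogCompatible F Fty) {μ : MultiPartition r}
    (h : μ.size = 0) : Fty (unipotentType μ) = 1 := by
  rw [hF.prod, unipotentType, dif_pos h]
  exact Finsupp.prod_zero_index

theorem IsLogCompatible.value_eq_prod (hF : IsLogCompatible F Fty) {K : Type u} [Field K] [Finite K]
    {v : Fin r → ℕ} (g : GLv K v) {S : Finset (FrobOrbit K)}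
    (hS : ∀ γ, (jordanMap g γ).size ≠ 0 → γ ∈ S) :
    F K v g = ∏ γ ∈ S, valueAt ((Nat.card K : ℚ) ^ γ.deg) (Fty (unipotentType (jordanMap g γ))) := by
  have hdeg : ∀ γ : FrobOrbit K, γ.deg ≠ 0 := fun γ => γ.2.2.1.natDegree_pos.ne'
  have h1 := (takesValueAt_iff.mp (hF.value K v g)).2
  rw [hF.prod, prod_typeOf (fun p => substPow p.1 (Fty (unipotentType p.2))) _ hS] at h1
  · rw [h1, valueAt_prod, Rat.cast_id]
    · exact Finset.prod_congr rfl fun γ _ =>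
        valueAt_substPow (hF.mem_regularAt K _ (hdeg γ))
    · exact fun γ _ => substPow_mem_regularAt (hF.mem_regularAt K _ (hdeg γ))
  · intro p hp
    rw [hF.zero_type hp, substPow, RatFunc.eval_one]

end LogCompatible

/-! ### Logarithms of power series and the Euler operator -/

section Euler

variable {σ : Type*} {k : Type*} [Field k]

/-- The Euler operator `∑ Tᵢ ∂/∂Tᵢ`, which multiplies the coefficient of a monomial by its degree. -/
def euler (f : MvPowerSeries σ k) : MvPowerSeries σ k := fun v =>
  (v.degree : k) * MvPowerSeries.coeff v f

@[simp]
theorem coeff_euler (f : MvPowerSeries σ k) (v : σ →₀ ℕ) :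
    MvPowerSeries.coeff v (euler f) = (v.degree : k) * MvPowerSeries.coeff v f := rfl

theorem euler_add (f g : MvPowerSeries σ k) : euler (f + g) = euler f + euler g := by
  ext v
  simp [mul_add]

theorem euler_mul (f g : MvPowerSeries σ k) : euler (f * g) = euler f * g + f * euler g := by
  classical
  ext v
  rw [coeff_euler, map_add, MvPowerSeries.coeff_mul, MvPowerSeries.coeff_mul,
    MvPowerSeries.coeff_mul, Finset.mul_sum, ← Finset.sum_add_distrib]
  refine Finset.sum_congr rfl fun p hp => ?_
  rw [← Finset.HasAntidiagonal.mem_antidiagonal.mp hp, map_add, coeff_euler, coeff_euler]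
  push_cast
  ring

theorem euler_one : euler (1 : MvPowerSeries σ k) = 0 := by
  classical
  ext v
  rw [coeff_euler, MvPowerSeries.coeff_one]
  split_ifs with h
  · simp [h]
  · simp

theorem euler_pow (f : MvPowerSeries σ k) (n : ℕ) :
    euler (f ^ (n + 1)) = MvPowerSeries.C ((n : k) + 1) * (f ^ n * euler f) := by
  induction n with
  | zero => simp
  | succ n ih =>
    rw [pow_succ, euler_mul, ih, map_add, map_add]
    push_cast
    rw [map_add]
    simp only [map_one]
    ring

theorem coeff_pow_eq_zero {a : MvPowerSeries σ k} (ha : MvPowerSeries.constantCoeff a = 0)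
    {n : ℕ} {v : σ →₀ ℕ} (h : v.degree < n) : MvPowerSeries.coeff v (a ^ n) = 0 :=
  MvPowerSeries.coeff_of_lt_order (lt_of_lt_of_le (by exact_mod_cast h)
    (MvPowerSeries.le_order_pow_of_constantCoeff_eq_zero n ha))

theorem coeff_subst_eq_sum {a : MvPowerSeries σ k} (ha : MvPowerSeries.constantCoeff a = 0)
    (P : PowerSeries k) {v : σ →₀ ℕ} {N : ℕ} (h : v.degree < N) :
    MvPowerSeries.coeff v (PowerSeries.subst a P) =
      ∑ n ∈ Finset.range N, PowerSeries.coeff n P * MvPowerSeries.coeff v (a ^ n) := by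
  rw [PowerSeries.coeff_subst (PowerSeries.HasSubst.of_constantCoeff_zero ha)]
  refine finsum_eq_sum_of_support_subset _ fun n hn => ?_
  rw [Finset.mem_coe, Finset.mem_range]
  by_contra! hle
  exact hn (by
    change _ • MvPowerSeries.coeff v (a ^ n) = 0
    rw [coeff_pow_eq_zero ha (lt_of_lt_of_le h hle), smul_zero])

/-- The chain rule, checked on coefficients: powers of `a` beyond the degree of the monomial do not
contribute, so all sums are finite. -/
theorem euler_subst {a : MvPowerSeries σ k} (ha : MvPowerSeries.constantCoeff a = 0)
    (P : PowerSeries k) : euler (PowerSeries.subst a P) =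
      PowerSeries.subst a (PowerSeries.derivative k P) * euler a := by
  classical
  ext v
  set N := v.degree + 1 with hN
  rw [coeff_euler, coeff_subst_eq_sum ha P (N := N + 1) (by omega), MvPowerSeries.coeff_mul]
  have h1 : ∀ p ∈ Finset.HasAntidiagonal.antidiagonal v, MvPowerSeries.coeff p.1
      (PowerSeries.subst a (PowerSeries.derivative k P)) * MvPowerSeries.coeff p.2 (euler a) =
      ∑ n ∈ Finset.range N, (PowerSeries.coeff (n + 1) P * ((n : k) + 1)) *
        (MvPowerSeries.coeff p.1 (a ^ n) * MvPowerSeries.coeff p.2 (euler a)) := by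
    intro p hp
    have h2 : p.1.degree < N := by
      rw [hN, ← Finset.HasAntidiagonal.mem_antidiagonal.mp hp, map_add]
      omega
    rw [coeff_subst_eq_sum ha _ h2, Finset.sum_mul]
    refine Finset.sum_congr rfl fun n _ => ?_
    rw [PowerSeries.coeff_derivative, mul_assoc, mul_assoc]
  rw [Finset.sum_congr rfl h1, Finset.sum_comm, Finset.sum_range_succ', mul_add]
  have h0 : (v.degree : k) * (PowerSeries.coeff 0 P * MvPowerSeries.coeff v (a ^ 0)) = 0 := by
    have := congrArg (MvPowerSeries.coeff v) (euler_one (σ := σ) (k := k))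
    rw [coeff_euler, map_zero] at this
    rw [pow_zero, mul_left_comm, this, mul_zero]
  rw [h0, add_zero, Finset.mul_sum]
  refine Finset.sum_congr rfl fun n _ => ?_
  rw [← Finset.mul_sum, ← MvPowerSeries.coeff_mul, mul_left_comm, ← coeff_euler, euler_pow,
    MvPowerSeries.coeff_C_mul, mul_assoc]

/-- The series `L` is the logarithm of `f`. -/
structure IsLogOf (f L : MvPowerSeries σ k) : Prop where
  constantCoeff_left : MvPowerSeries.constantCoeff f = 1
  constantCoeff_right : MvPowerSeries.constantCoeff L = 0
  euler_eq : euler f = f * euler L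

/-- Substitute `f - 1` into `(1 + X) · log' = 1` and apply the chain rule. -/
theorem isLogOf_subst_log [Algebra ℚ k] {f : MvPowerSeries σ k}
    (hf : MvPowerSeries.constantCoeff f = 1) :
    IsLogOf f (PowerSeries.subst (f - 1) (PowerSeries.log k)) := by
  have ha : MvPowerSeries.constantCoeff (f - 1) = 0 := by simp [hf]
  have ha' := PowerSeries.HasSubst.of_constantCoeff_zero ha
  refine ⟨hf, PowerSeries.constantCoeff_subst_eq_zero ha _ PowerSeries.constantCoeff_log, ?_⟩
  have h1 : (1 + PowerSeries.X) * PowerSeries.derivative k (PowerSeries.log k) = 1 := by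
    rw [PowerSeries.deriv_log]
    ext n
    rw [add_mul, one_mul, map_add]
    cases n with
    | zero => simp
    | succ n =>
      rw [PowerSeries.coeff_succ_X_mul, PowerSeries.coeff_mk, PowerSeries.coeff_mk,
        PowerSeries.coeff_one, if_neg (Nat.succ_ne_zero n), pow_succ]
      simp
  have h2 := congrArg (PowerSeries.subst (f - 1)) h1
  rw [PowerSeries.subst_mul ha', PowerSeries.subst_add ha', PowerSeries.subst_X ha'] at h2
  have h3 : PowerSeries.subst (f - 1) (1 : PowerSeries k) = 1 := by
    rw [← PowerSeries.coe_substAlgHom ha', map_one]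
  rw [h3, add_sub_cancel] at h2
  have h4 : euler (f - 1) = euler f := by
    have := euler_add (f - 1) 1
    rw [sub_add_cancel, euler_one, add_zero] at this
    exact this.symm
  rw [euler_subst ha, ← mul_assoc, h2, one_mul, h4]

theorem exists_isLogOf [Algebra ℚ k] {L : MvPowerSeries σ k}
    (hL : MvPowerSeries.constantCoeff L = 0) : ∃ f, IsLogOf f L := by
  have hL' := PowerSeries.HasSubst.of_constantCoeff_zero hL
  refine ⟨PowerSeries.subst L (PowerSeries.exp k), ?_, hL, ?_⟩
  · rw [← MvPowerSeries.coeff_zero_eq_constantCoeff_apply, coeff_subst_eq_sum hL _ (N := 1)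
      (by simp)]
    simp
  · rw [euler_subst hL, PowerSeries.derivative_exp]

theorem isLogOf_one : IsLogOf (1 : MvPowerSeries σ k) 0 :=
  ⟨map_one _, map_zero _, by
    have : euler (0 : MvPowerSeries σ k) = 0 := by ext v; simp
    rw [euler_one, this, mul_zero]⟩

theorem IsLogOf.mul {f g L M : MvPowerSeries σ k} (h : IsLogOf f L) (h' : IsLogOf g M) :
    IsLogOf (f * g) (L + M) := by
  refine ⟨by simp [h.1, h'.1], by simp [h.2, h'.2], ?_⟩
  rw [euler_mul, h.3, h'.3, euler_add]
  ring

theorem IsLogOf.prod {ι : Type*} (s : Finset ι) {f L : ι → MvPowerSeries σ k}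
    (h : ∀ i ∈ s, IsLogOf (f i) (L i)) : IsLogOf (∏ i ∈ s, f i) (∑ i ∈ s, L i) := by
  classical
  induction s using Finset.induction_on with
  | empty => exact isLogOf_one
  | insert a s ha ih =>
    rw [Finset.prod_insert ha, Finset.sum_insert ha]
    exact (h a (Finset.mem_insert_self a s)).mul (ih fun i hi => h i (Finset.mem_insert_of_mem hi))

theorem IsLogOf.degree_mul_coeff {f L : MvPowerSeries σ k} (h : IsLogOf f L) [DecidableEq σ]
    (v : σ →₀ ℕ) : (v.degree : k) * MvPowerSeries.coeff v f =
      ∑ p ∈ Finset.HasAntidiagonal.antidiagonal v, MvPowerSeries.coeff p.1 f *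
        ((p.2.degree : k) * MvPowerSeries.coeff p.2 L) := by
  rw [← coeff_euler, h.euler_eq, MvPowerSeries.coeff_mul]
  rfl

variable [CharZero k]

/-- The differential equation gives a recursion for the coefficients of `f` from those of `L`, so
agreement up to degree `N` suffices. This permits truncating an infinite Euler product. -/
theorem IsLogOf.coeff_congr {f g L M : MvPowerSeries σ k} (h : IsLogOf f L) (h' : IsLogOf g M)
    (N : ℕ) (hLM : ∀ w : σ →₀ ℕ, w.degree ≤ N →
      MvPowerSeries.coeff w L = MvPowerSeries.coeff w M) (v : σ →₀ ℕ) (hv : v.degree ≤ N) :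
    MvPowerSeries.coeff v f = MvPowerSeries.coeff v g := by
  classical
  induction hn : v.degree using Nat.strong_induction_on generalizing v with
  | _ n ih =>
    by_cases h0 : v = 0
    · rw [h0, MvPowerSeries.coeff_zero_eq_constantCoeff_apply,
        MvPowerSeries.coeff_zero_eq_constantCoeff_apply, h.1, h'.1]
    · have hd : (v.degree : k) ≠ 0 := by
        rw [Nat.cast_ne_zero]
        exact fun h1 => h0 ((Finsupp.degree_eq_zero_iff v).mp h1)
      refine mul_left_cancel₀ hd ?_
      rw [h.degree_mul_coeff, h'.degree_mul_coeff]
      refine Finset.sum_congr rfl fun p hp => ?_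
      have hadd : p.1.degree + p.2.degree = v.degree := by
        rw [← map_add, Finset.HasAntidiagonal.mem_antidiagonal.mp hp]
      rw [hLM p.2 (by omega)]
      -- The term containing the coefficient of `f` at `v` itself has weight zero.
      by_cases hp2 : p.2.degree = 0
      · simp [hp2]
      · rw [ih p.1.degree (by omega) p.1 (by omega) rfl]

theorem IsLogOf.unique {f L M : MvPowerSeries σ k} (h : IsLogOf f L) (h' : IsLogOf f M) :
    L = M := by
  have hf : f ≠ 0 := fun h0 => by
    have := h.1
    rw [h0, map_zero] at this
    exact zero_ne_one this
  have h1 : euler L = euler M := mul_left_cancel₀ hf (h.3.symm.trans h'.3)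
  ext v
  by_cases h0 : v = 0
  · rw [h0, MvPowerSeries.coeff_zero_eq_constantCoeff_apply,
      MvPowerSeries.coeff_zero_eq_constantCoeff_apply, h.2, h'.2]
  · have hd : (v.degree : k) ≠ 0 := by
      rw [Nat.cast_ne_zero]
      exact fun h1 => h0 ((Finsupp.degree_eq_zero_iff v).mp h1)
    exact mul_left_cancel₀ hd (congrArg (MvPowerSeries.coeff v) h1)

/-- If the logarithm has no coefficients in positive degrees less than that of `v`, then `f` and its
logarithm have the same coefficient at `v`. -/
theorem IsLogOf.coeff_eq_of_vanishing {f L : MvPowerSeries σ k} (h : IsLogOf f L) {v : σ →₀ ℕ}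
    (hv : v ≠ 0) (hL : ∀ w : σ →₀ ℕ, w.degree < v.degree → MvPowerSeries.coeff w L = 0) :
    MvPowerSeries.coeff v f = MvPowerSeries.coeff v L := by
  classical
  have hd : (v.degree : k) ≠ 0 := by
    rw [Nat.cast_ne_zero]
    exact fun h1 => hv ((Finsupp.degree_eq_zero_iff v).mp h1)
  refine mul_left_cancel₀ hd ?_
  -- In any other pair either the second degree is smaller than that of `v`, where `L` vanishes, or
  -- the pair is `(0, v)` after all.
  rw [h.degree_mul_coeff, Finset.sum_eq_single (0, v)]
  · rw [MvPowerSeries.coeff_zero_eq_constantCoeff_apply, h.1, one_mul]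
  · intro p hp hne
    have hadd : p.1 + p.2 = v := Finset.HasAntidiagonal.mem_antidiagonal.mp hp
    have hdeg : p.1.degree + p.2.degree = v.degree := by rw [← map_add, hadd]
    by_cases h1 : p.1 = 0
    · rw [h1, zero_add] at hadd
      exact absurd (Prod.ext h1 hadd) hne
    · have : p.1.degree ≠ 0 := fun h2 => h1 ((Finsupp.degree_eq_zero_iff p.1).mp h2)
      rw [hL p.2 (by omega), mul_zero, mul_zero]
  · intro h1
    exact absurd (Finset.HasAntidiagonal.mem_antidiagonal.mpr (zero_add v)) h1

omit [CharZero k] in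
theorem IsLogOf.rescale {f L : MvPowerSeries σ k} (h : IsLogOf f L) (a : σ → k) :
    IsLogOf (MvPowerSeries.rescale a f) (MvPowerSeries.rescale a L) := by
  have hc : ∀ g : MvPowerSeries σ k, MvPowerSeries.constantCoeff (MvPowerSeries.rescale a g) =
      MvPowerSeries.constantCoeff g := fun g => by
    rw [← MvPowerSeries.coeff_zero_eq_constantCoeff_apply, MvPowerSeries.coeff_rescale,
      Finsupp.prod_zero_index, one_mul, MvPowerSeries.coeff_zero_eq_constantCoeff_apply]
  have he : ∀ g : MvPowerSeries σ k, euler (MvPowerSeries.rescale a g) =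
      MvPowerSeries.rescale a (euler g) := fun g => by
    ext v
    rw [coeff_euler, MvPowerSeries.coeff_rescale, MvPowerSeries.coeff_rescale, coeff_euler,
      mul_left_comm]
  refine ⟨by rw [hc, h.1], by rw [hc, h.2], ?_⟩
  rw [he, he, h.3, map_mul]

theorem degree_nsmul_finsupp (d : ℕ) (w : σ →₀ ℕ) : (d • w).degree = d * w.degree := by
  rw [map_nsmul, smul_eq_mul]

omit [CharZero k] in
theorem euler_expand {d : ℕ} (hd : d ≠ 0) (g : MvPowerSeries σ k) :
    euler (MvPowerSeries.expand d hd g) =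
      MvPowerSeries.C (d : k) * MvPowerSeries.expand d hd (euler g) := by
  ext v
  rw [coeff_euler, MvPowerSeries.coeff_C_mul]
  by_cases h : ∀ i, d ∣ v i
  · obtain ⟨w, rfl⟩ : ∃ w : σ →₀ ℕ, v = d • w :=
      ⟨v.mapRange (· / d) (Nat.zero_div d), by
        ext i
        simp [Nat.mul_div_cancel' (h i)]⟩
    rw [MvPowerSeries.coeff_expand_smul, MvPowerSeries.coeff_expand_smul, coeff_euler,
      degree_nsmul_finsupp]
    push_cast
    ring
  · obtain ⟨i, hi⟩ := not_forall.mp h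
    rw [MvPowerSeries.coeff_expand_of_not_dvd d hd _ hi,
      MvPowerSeries.coeff_expand_of_not_dvd d hd _ hi, mul_zero, mul_zero]

omit [CharZero k] in
theorem IsLogOf.expand {f L : MvPowerSeries σ k} (h : IsLogOf f L) {d : ℕ} (hd : d ≠ 0) :
    IsLogOf (MvPowerSeries.expand d hd f) (MvPowerSeries.expand d hd L) := by
  refine ⟨by rw [MvPowerSeries.constantCoeff_expand, h.1],
    by rw [MvPowerSeries.constantCoeff_expand, h.2], ?_⟩
  rw [euler_expand, euler_expand, h.3, map_mul]
  ring

end Euler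

/-! ### Specializing series of rational functions at q -/

section Values

variable {r : ℕ} {q : ℚ} {κ : Type*} [Field κ]

theorem coeff_mul_mem {R : Type*} [Field R] (A : Subring R) {f g : MvPowerSeries (Fin r) R}
    (hf : ∀ v, MvPowerSeries.coeff v f ∈ A) (hg : ∀ v, MvPowerSeries.coeff v g ∈ A)
    (v : Fin r →₀ ℕ) : MvPowerSeries.coeff v (f * g) ∈ A := by
  classical
  rw [MvPowerSeries.coeff_mul]
  exact sum_mem fun p _ => mul_mem (hf _) (hg _)

theorem coeff_one_mem {R : Type*} [Field R] (A : Subring R) (v : Fin r →₀ ℕ) :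
    MvPowerSeries.coeff v (1 : MvPowerSeries (Fin r) R) ∈ A := by
  classical
  rw [MvPowerSeries.coeff_one]
  split_ifs
  exacts [one_mem _, zero_mem _]

/-- Each coefficient is a polynomial with rational coefficients in those of `f`, so no pole is
created. -/
theorem coeff_subst_log_mem {f : Series r} (hf : ∀ v, MvPowerSeries.coeff v f ∈ regularAt q)
    (hf1 : MvPowerSeries.constantCoeff f = 1) (v : Fin r →₀ ℕ) :
    MvPowerSeries.coeff v (PowerSeries.subst (f - 1) (PowerSeries.log (RatFunc ℚ))) ∈
      regularAt q := by
  have hpow : ∀ n v, MvPowerSeries.coeff v ((f - 1) ^ n) ∈ regularAt q := fun n => by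
    induction n with
    | zero => exact fun v => by rw [pow_zero]; exact coeff_one_mem _ v
    | succ n ih =>
      rw [pow_succ]
      exact coeff_mul_mem _ ih fun v => by
        rw [map_sub]
        exact sub_mem (hf v) (coeff_one_mem _ v)
  rw [coeff_subst_eq_sum (by simp [hf1]) _ (Nat.lt_succ_self v.degree)]
  refine sum_mem fun n _ => mul_mem ?_ (hpow n v)
  rw [PowerSeries.coeff_log]
  split_ifs
  · exact zero_mem _
  · rw [eq_ratCast]
    exact ratCast_mem_regularAt _

/-- The series whose coefficients are the values at `q` of the coefficients of `f`. -/
def valueSeries (κ : Type*) [Field κ] (q : ℚ) (f : Series r) : MvPowerSeries (Fin r) κ := fun v =>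
  (valueAt q (MvPowerSeries.coeff v f) : κ)

theorem coeff_valueSeries (f : Series r) (v : Fin r →₀ ℕ) :
    MvPowerSeries.coeff v (valueSeries κ q f) = (valueAt q (MvPowerSeries.coeff v f) : κ) := rfl

/-- The Euler equation is a finite polynomial identity in each degree, so it survives evaluation at
a point where all coefficients are regular. -/
theorem IsLogOf.valueSeries [CharZero κ] {f L : Series r} (h : IsLogOf f L)
    (hf : ∀ v, MvPowerSeries.coeff v f ∈ regularAt q)
    (hL : ∀ v, MvPowerSeries.coeff v L ∈ regularAt q) :
    IsLogOf (valueSeries κ q f) (valueSeries κ q L) := by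
  classical
  refine ⟨?_, ?_, ?_⟩
  · rw [← MvPowerSeries.coeff_zero_eq_constantCoeff_apply, coeff_valueSeries,
      MvPowerSeries.coeff_zero_eq_constantCoeff_apply, h.1, valueAt, RatFunc.eval_one, Rat.cast_one]
  · rw [← MvPowerSeries.coeff_zero_eq_constantCoeff_apply, coeff_valueSeries,
      MvPowerSeries.coeff_zero_eq_constantCoeff_apply, h.2, valueAt, RatFunc.eval_zero,
      Rat.cast_zero]
  · ext v
    have hnat : ∀ n : ℕ, (n : RatFunc ℚ) ∈ regularAt q ∧ valueAt q (n : RatFunc ℚ) = n := fun n => by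
      rw [← Rat.cast_natCast (α := RatFunc ℚ)]
      exact ⟨ratCast_mem_regularAt _, valueAt_ratCast _⟩
    have h1 := congrArg (fun x : RatFunc ℚ => (valueAt q x : κ)) (h.degree_mul_coeff v)
    rw [valueAt_mul (hnat _).1 (hf v), (hnat _).2, valueAt_sum _ _ fun p _ =>
      mul_mem (hf _) (mul_mem (hnat _).1 (hL _))] at h1
    rw [coeff_euler, MvPowerSeries.coeff_mul, coeff_valueSeries]
    push_cast at h1
    rw [h1]
    refine Finset.sum_congr rfl fun p _ => ?_
    rw [valueAt_mul (hf _) (mul_mem (hnat _).1 (hL _)), valueAt_mul (hnat _).1 (hL _), (hnat _).2]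
    push_cast
    rfl

end Values

/-! ### Character sums over Frobenius orbits -/

section CharacterSums

variable {K : Type*} [Field K]

/-- The Frobenius orbit over `K` of a non-zero element of a finite extension of `K`. -/
def frobOrbitOf (K : Type*) [Field K] {L : Type*} [Field L] [Algebra K L] [FiniteDimensional K L]
    (x : Lˣ) : FrobOrbit K :=
  ⟨minpoly K (x : L), minpoly.monic (Algebra.IsIntegral.isIntegral _),
    minpoly.irreducible (Algebra.IsIntegral.isIntegral _), fun h => x.ne_zero (by
      have := minpoly.aeval K (x : L)
      rwa [h, aeval_X] at this)⟩

section Extension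

variable {L : Type*} [Field L] [Algebra K L] [FiniteDimensional K L]

theorem deg_frobOrbitOf_dvd (x : Lˣ) : (frobOrbitOf K x).deg ∣ Module.finrank K L :=
  minpoly.degree_dvd (Algebra.IsIntegral.isIntegral _)

/-- The norm from `K(x)` is the signed constant term of the minimal polynomial; passing up to `L`
raises it to the power `[L : K(x)]`. -/
theorem unitsMap_norm_eq (x : Lˣ) : Units.map (Algebra.norm K (S := L)) x =
    (frobOrbitOf K x).norm ^ (Module.finrank K L / (frobOrbitOf K x).deg) := by
  have hx : IsIntegral K (x : L) := Algebra.IsIntegral.isIntegral _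
  refine Units.ext ?_
  have h1 := IntermediateField.adjoin.finrank hx
  have h2 := Module.finrank_mul_finrank K (IntermediateField.adjoin K {(x : L)}) L
  have h3 := Algebra.PowerBasis.norm_gen_eq_coeff_zero_minpoly (IntermediateField.adjoin.powerBasis hx)
  rw [IntermediateField.adjoin.powerBasis_gen, IntermediateField.adjoin.powerBasis_dim,
    IntermediateField.minpoly_gen] at h3
  have h4 : Module.finrank K L / (frobOrbitOf K x).deg =
      Module.finrank (IntermediateField.adjoin K {(x : L)}) L := by
    rw [← h2, h1]
    exact Nat.mul_div_cancel_left _ (minpoly.natDegree_pos hx)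
  change Algebra.norm K (x : L) = _
  rw [h4, Algebra.norm_eq_norm_adjoin, h3, Units.val_pow_eq_pow_val]
  rfl

theorem frobOrbitOf_eq_iff (x : Lˣ) (γ : FrobOrbit K) : frobOrbitOf K x = γ ↔ aeval (x : L) γ.1 = 0 := by
  constructor
  · rintro rfl
    exact minpoly.aeval K (x : L)
  · exact fun h => Subtype.ext (minpoly.eq_of_irreducible_of_monic γ.2.2.1 h γ.2.1).symm

/-- The degree condition makes `γ` divide `X ^ |L| - X`, so it splits in `L`, with distinct roots
because `K` is perfect. -/
theorem card_frobOrbitOf_eq [Finite L] (γ : FrobOrbit K) (hγ : γ.deg ∣ Module.finrank K L) :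
    Nat.card {x : Lˣ // frobOrbitOf K x = γ} = γ.deg := by
  have hK : Finite K := Finite.of_injective _ (algebraMap K L).injective
  have := Fintype.ofFinite L
  have hsplit : (γ.1.map (algebraMap K L)).Splits := by
    have h1 := (FiniteField.isSplittingField_sub L K).splits
    have h2 : γ.1 ∣ X ^ Fintype.card L - X := by
      rw [← Nat.card_eq_fintype_card, Module.natCard_eq_pow_finrank (K := K) (V := L)]
      exact (γ.2.2.1.natDegree_dvd_iff_dvd_X_pow_card_pow_sub_X).mp hγ
    exact h1.of_dvd (map_ne_zero (FiniteField.X_pow_card_sub_X_ne_zero K Fintype.one_lt_card))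
      (Polynomial.map_dvd _ h2)
  rw [FrobOrbit.deg, ← card_rootSet_eq_natDegree (PerfectField.separable_of_irreducible γ.2.2.1) hsplit,
    ← Nat.card_eq_fintype_card]
  refine Nat.card_congr
    { toFun := fun x => ⟨(x.1 : L), mem_rootSet.mpr ⟨γ.2.1.ne_zero, (frobOrbitOf_eq_iff _ _).mp x.2⟩⟩
      invFun := fun x => ⟨Units.mk0 x.1 fun h => ?_, ?_⟩
      left_inv := fun x => by ext; rfl
      right_inv := fun x => by ext; rfl }
  · have h1 := (mem_rootSet.mp x.2).2
    rw [h, aeval_def, eval₂_at_zero, map_eq_zero] at h1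
    exact γ.norm.ne_zero (by simp [FrobOrbit.norm, h1])
  · exact (frobOrbitOf_eq_iff _ _).mpr (mem_rootSet.mp x.2).2

end Extension

theorem exists_extension (K : Type*) [Field K] [Finite K] {D : ℕ} (hD : D ≠ 0) :
    ∃ (L : Type) (_ : Field L) (_ : Algebra K L),
      Finite L ∧ FiniteDimensional K L ∧ Module.finrank K L = D := by
  obtain ⟨p, hp⟩ := CharP.exists K
  have := Fact.mk (CharP.char_is_prime K p)
  have := NeZero.mk hD
  exact ⟨FiniteField.Extension K p D, inferInstance, inferInstance,
    Module.finite_of_finite K, inferInstance, FiniteField.finrank_extension K p D⟩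

variable [Finite K] {κ : Type*} [Field κ]

open Classical in
/-- The sum of the `k`-th powers of the values of the character `θ` at the norms of the Frobenius
orbits of size `d`. -/
def charSum (θ : Kˣ →* κˣ) (d k : ℕ) : κ :=
  ∑ γ ∈ orbitsLE K d with γ.deg = d, (θ γ.norm : κ) ^ k

open Classical in
theorem charSum_eq (θ : Kˣ →* κˣ) {d N : ℕ} (h : d ≤ N) (k : ℕ) :
    charSum θ d k = ∑ γ ∈ orbitsLE K N with γ.deg = d, (θ γ.norm : κ) ^ k := by
  refine Finset.sum_congr (Finset.ext fun γ => ?_) fun _ _ => rfl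
  simp only [Finset.mem_filter, mem_orbitsLE]
  omega

open Classical in
-- Evaluate the sum of `θ ^ k ∘ norm` over the units of the extension of degree `D` in two ways.
-- Since the norm is surjective, it is a full or a vanishing character sum according to whether `θ ^
-- k` is trivial. Grouped by orbits, an orbit of size `e` supplies `e` units, each of norm the `D /
-- e`-th power of the norm of the orbit.
theorem sum_divisors_charSum (θ : Kˣ →* κˣ) {D : ℕ} (hD : D ≠ 0) (k : ℕ) :
    ∑ e ∈ D.divisors, (e : κ) * charSum θ e (D / e * k) =
      if θ ^ k = 1 then (Nat.card K : κ) ^ D - 1 else 0 := by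
  obtain ⟨L, _, _, _, _, hL⟩ := exists_extension K hD
  have := Fintype.ofFinite L
  have := Fintype.ofFinite Lˣ
  let N : Lˣ →* Kˣ := Units.map (Algebra.norm K (S := L))
  have h1 : ∑ x : Lˣ, (θ (N x) : κ) ^ k = if θ ^ k = 1 then (Nat.card K : κ) ^ D - 1 else 0 := by
    have h2 := sum_hom_units (((Units.coeHom κ).comp (θ ^ k)).comp N)
    have h3 : ((Units.coeHom κ).comp (θ ^ k)).comp N = 1 ↔ θ ^ k = 1 := by
      constructor
      · intro h
        ext y
        obtain ⟨x, rfl⟩ := FiniteField.unitsMap_norm_surjective K L y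
        exact DFunLike.congr_fun h x
      · intro h
        rw [h]
        ext x
        simp
    simp only [h3] at h2
    refine Eq.trans ?_ (h2.trans ?_)
    · exact Finset.sum_congr rfl fun x _ => by simp
    · split_ifs
      · rw [← Nat.card_eq_fintype_card, Nat.card_units, Module.natCard_eq_pow_finrank (K := K) (V := L),
          hL, Nat.cast_sub (Nat.one_le_pow _ _ Nat.card_pos)]
        simp
      · simp
  rw [← h1, ← Finset.sum_fiberwise_of_maps_to (t := D.divisors) (g := fun x => (frobOrbitOf K x).deg)
    fun x _ => Nat.mem_divisors.mpr ⟨hL ▸ deg_frobOrbitOf_dvd x, hD⟩]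
  refine Finset.sum_congr rfl fun e he => ?_
  rw [← Finset.sum_fiberwise_of_maps_to (t := (orbitsLE K e).filter fun γ => γ.deg = e)
    (g := fun x => frobOrbitOf K x), charSum, Finset.mul_sum]
  · refine Finset.sum_congr rfl fun γ hγ => ?_
    have hγe : γ.deg = e := (Finset.mem_filter.mp hγ).2
    have h4 : ∀ x ∈ {x ∈ ({x : Lˣ | (frobOrbitOf K x).deg = e} : Finset Lˣ) | frobOrbitOf K x = γ},
        (θ (N x) : κ) ^ k = (θ γ.norm : κ) ^ (D / e * k) := fun x hx => by
      have hx' := (Finset.mem_filter.mp hx).2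
      rw [unitsMap_norm_eq, hx', hL, hγe, map_pow, Units.val_pow_eq_pow_val, pow_mul]
    rw [Finset.sum_congr rfl h4, Finset.sum_const, nsmul_eq_mul]
    congr 2
    have h5 := card_frobOrbitOf_eq (L := L) γ (by
      rw [hL, hγe]
      exact Nat.dvd_of_mem_divisors he)
    have h6 : {x ∈ ({x : Lˣ | (frobOrbitOf K x).deg = e} : Finset Lˣ) | frobOrbitOf K x = γ} =
        ({x : Lˣ | frobOrbitOf K x = γ} : Finset Lˣ) := by
      ext x
      simp only [Finset.mem_filter, Finset.mem_univ, true_and]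
      exact ⟨fun h => h.2, fun h => ⟨by rw [h, hγe], h⟩⟩
    rw [h6, ← Fintype.card_subtype, ← Nat.card_eq_fintype_card, h5, hγe]
  · intro x hx
    rw [Finset.mem_filter, mem_orbitsLE]
    have := (Finset.mem_filter.mp hx).2
    exact ⟨this.le, this⟩

theorem charSum_one (d k : ℕ) : charSum (1 : Kˣ →* κˣ) d k = charSum (1 : Kˣ →* κˣ) d 0 := by
  simp [charSum]

theorem eq_of_sum_divisors_eq {f g : ℕ → κ} {m : ℕ} (hm : m ≠ 0)
    (h : ∀ D ∈ m.divisors, ∑ e ∈ D.divisors, f e = ∑ e ∈ D.divisors, g e) :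
    ∀ D ∈ m.divisors, f D = g D := by
  intro D
  induction D using Nat.strong_induction_on with
  | _ D ih =>
    intro hD
    have hD0 : D ≠ 0 := ne_zero_of_dvd_ne_zero hm (Nat.dvd_of_mem_divisors hD)
    have h1 := h D hD
    rw [← Nat.insert_self_properDivisors hD0, Finset.sum_insert Nat.self_notMem_properDivisors,
      Finset.sum_insert Nat.self_notMem_properDivisors, Finset.sum_congr rfl fun e he =>
        ih e (Nat.mem_properDivisors.mp he).2 (Nat.mem_divisors.mpr
          ⟨(Nat.mem_properDivisors.mp he).1.trans (Nat.dvd_of_mem_divisors hD), hm⟩)] at h1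
    exact add_right_cancel h1

open Classical in
-- The choice `k = m / D` turns the exponent `D / e * k` into `m / e`, independent of `D`, so that
-- inversion over the divisors of `m` applies.
theorem sum_divisors_charSum_of_dvd (θ : Kˣ →* κˣ) {m D : ℕ} (hm : m ≠ 0) (hD : D ∣ m) :
    ∑ e ∈ D.divisors, (e : κ) * charSum θ e (m / e) =
      if θ ^ (m / D) = 1 then (Nat.card K : κ) ^ D - 1 else 0 := by
  have hD0 : D ≠ 0 := ne_zero_of_dvd_ne_zero hm hD
  convert sum_divisors_charSum θ hD0 (m / D) using 1
  refine Finset.sum_congr rfl fun e he => ?_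
  obtain ⟨a, rfl⟩ := Nat.dvd_of_mem_divisors he
  obtain ⟨b, rfl⟩ := hD
  have he0 : 0 < e := Nat.pos_of_ne_zero (left_ne_zero_of_mul hD0)
  rw [Nat.mul_div_cancel_left _ he0, Nat.mul_div_cancel_left _ (Nat.pos_of_ne_zero hD0), mul_assoc,
    Nat.mul_div_cancel_left _ he0]

/-- Every exponent `m / D` is positive and below the order of `θ`, so all the divisor sums vanish.
-/
theorem charSum_eq_zero [CharZero κ] (θ : Kˣ →* κˣ) {m e : ℕ} (hm : m ≠ 0) (h : m < orderOf θ)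
    (he : e ∣ m) : charSum θ e (m / e) = 0 := by
  have h1 := eq_of_sum_divisors_eq (f := fun e => (e : κ) * charSum θ e (m / e)) (g := fun _ => 0) hm
    (fun D hD => by
      classical
      have hD' := Nat.dvd_of_mem_divisors hD
      rw [sum_divisors_charSum_of_dvd θ hm hD', if_neg, Finset.sum_const_zero]
      exact pow_ne_one_of_lt_orderOf (Nat.div_pos (Nat.le_of_dvd (Nat.pos_of_ne_zero hm) hD')
        (Nat.pos_of_dvd_of_pos hD' (Nat.pos_of_ne_zero hm))).ne'
        (lt_of_le_of_lt (Nat.div_le_self m D) h)) e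
      (Nat.mem_divisors.mpr ⟨he, hm⟩)
  exact (mul_eq_zero.mp h1).resolve_left (Nat.cast_ne_zero.mpr (ne_zero_of_dvd_ne_zero hm he))

/-- Now `θ ^ (m / D)` is trivial only for `D = 1`. The divisor sums are `q - 1` at `D = 1` and zero
elsewhere, as are those of `μ(e)(q - 1)`. -/
theorem mul_charSum_orderOf (θ : Kˣ →* κˣ) {m e : ℕ} (hm : m ≠ 0) (h : orderOf θ = m)
    (he : e ∣ m) : (e : κ) * charSum θ e (m / e) =
      (ArithmeticFunction.moebius e : κ) * ((Nat.card K : κ) - 1) := by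
  refine eq_of_sum_divisors_eq (f := fun e => (e : κ) * charSum θ e (m / e))
    (g := fun e => (ArithmeticFunction.moebius e : κ) * ((Nat.card K : κ) - 1)) hm
    (fun D hD => ?_) e (Nat.mem_divisors.mpr ⟨he, hm⟩)
  classical
  have hD' := Nat.dvd_of_mem_divisors hD
  have hD0 : D ≠ 0 := ne_zero_of_dvd_ne_zero hm hD'
  rw [sum_divisors_charSum_of_dvd θ hm hD', ← Finset.sum_mul, ← Int.cast_sum,
    ← ArithmeticFunction.coe_mul_zeta_apply, ArithmeticFunction.moebius_mul_coe_zeta,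
    ArithmeticFunction.one_apply]
  by_cases hD1 : D = 1
  · subst hD1
    rw [Nat.div_one, if_pos (by rw [← h, pow_orderOf_eq_one])]
    simp
  · rw [if_neg hD1, if_neg, Int.cast_zero, zero_mul]
    intro h2
    replace h2 := orderOf_dvd_of_pow_eq_one (x := θ) h2
    rw [h] at h2
    have h3 := Nat.le_of_dvd (Nat.div_pos (Nat.le_of_dvd (Nat.pos_of_ne_zero hm) hD')
      (Nat.pos_of_ne_zero hD0)) h2
    have h4 := Nat.div_lt_self (Nat.pos_of_ne_zero hm) (show 1 < D by omega)
    omega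

theorem mul_charSum_one {m : ℕ} (hm : m ≠ 0) (k : ℕ) : (m : κ) * charSum (1 : Kˣ →* κˣ) m k =
      ∑ e ∈ m.divisors, (ArithmeticFunction.moebius (m / e) : κ) * ((Nat.card K : κ) ^ e - 1) := by
  have h1 : ∀ n > 0, ∑ e ∈ Nat.divisors n, (fun e : ℕ => (e : κ) * charSum (1 : Kˣ →* κˣ) e 0) e =
      (fun n : ℕ => (Nat.card K : κ) ^ n - 1) n := fun n hn => by
    classical
    have h2 := sum_divisors_charSum_of_dvd (κ := κ) (1 : Kˣ →* κˣ) hn.ne' dvd_rfl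
    replace h2 := h2.trans (if_pos (one_pow (M := Kˣ →* κˣ) _))
    refine Eq.trans (Finset.sum_congr rfl fun e _ => ?_) h2
    rw [charSum_one _ (n / e)]
  rw [charSum_one, ← Nat.sum_divisorsAntidiagonal' (f := fun i j =>
    (ArithmeticFunction.moebius i : κ) * ((Nat.card K : κ) ^ j - 1))]
  exact ((ArithmeticFunction.sum_eq_iff_sum_mul_moebius_eq.mp h1) m (Nat.pos_of_ne_zero hm)).symm

end CharacterSums

/-! ### Averages over GL_v as coefficients of an Euler product -/

section GeneratingFunction

variable {r : ℕ}

/-- The multi-partitions `μ` with `d • |μ| = m`. -/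
def partitionsOf (d : ℕ) (m : Fin r →₀ ℕ) : Finset (MultiPartition r) :=
  if ∀ i, d ∣ m i then
    Finset.univ.map (Function.Embedding.sigmaMk (β := fun v : Fin r → ℕ => ∀ i, Nat.Partition (v i))
      fun i => m i / d)
  else ∅

theorem mem_partitionsOf {d : ℕ} (hd : d ≠ 0) {m : Fin r →₀ ℕ} {μ : MultiPartition r} :
    μ ∈ partitionsOf d m ↔ ∀ i, d * μ.size i = m i := by
  rw [partitionsOf]
  have hd' := Nat.pos_of_ne_zero hd
  split_ifs with h
  · rw [Finset.mem_map]
    constructor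
    · rintro ⟨a, -, rfl⟩ i
      exact Nat.mul_div_cancel' (h i)
    · intro h1
      obtain ⟨v, a⟩ := μ
      obtain rfl : v = fun i => m i / d := funext fun i => by
        rw [← h1 i]
        exact (Nat.mul_div_cancel_left _ hd').symm
      exact ⟨a, Finset.mem_univ _, rfl⟩
  · simp only [Finset.notMem_empty, false_iff]
    exact fun h1 => h fun i => ⟨_, (h1 i).symm⟩

theorem coeff_expand_eq {k : Type*} [CommRing k] {d : ℕ} (hd : d ≠ 0) (f : MvPowerSeries (Fin r) k)
    (v : Fin r →₀ ℕ) : MvPowerSeries.coeff v (MvPowerSeries.expand d hd f) =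
      if ∀ i, d ∣ v i then MvPowerSeries.coeff (v.mapRange (· / d) (Nat.zero_div d)) f else 0 := by
  split_ifs with h
  · conv_lhs => rw [show v = d • v.mapRange (· / d) (Nat.zero_div d) by
      ext i
      simp [Nat.mul_div_cancel' (h i)]]
    rw [MvPowerSeries.coeff_expand_smul]
  · obtain ⟨i, hi⟩ := not_forall.mp h
    rw [MvPowerSeries.coeff_expand_of_not_dvd d hd _ hi]

theorem coeff_rescale_const {k : Type*} [CommRing k] (c : k) (f : MvPowerSeries (Fin r) k)
    (v : Fin r →₀ ℕ) : MvPowerSeries.coeff v (MvPowerSeries.rescale (fun _ => c) f) =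
      c ^ v.degree * MvPowerSeries.coeff v f := by
  rw [MvPowerSeries.coeff_rescale, Finsupp.prod, Finset.prod_pow_eq_pow_sum]
  rfl

variable {K : Type*} [Field K] [Finite K] {κ : Type*} [Field κ] [CharZero κ]

theorem centralizerPoly_eval_card_pow_ne_zero (K : Type*) [Field K] [Finite K]
    (μ : MultiPartition r) {d : ℕ} (hd : d ≠ 0) :
    (centralizerPoly μ).eval ((Nat.card K : ℚ) ^ d) ≠ 0 :=
  (centralizerPoly_eval_pos μ (one_lt_pow₀ (by exact_mod_cast Finite.one_lt_card) hd)).ne'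

open Classical in
-- The group is partitioned first by how `v` is distributed over the orbits, then by the Jordan map
-- itself. Each resulting class has `|GL_v|` over the product of centralizer values as its size. The
-- right side has the shape of a coefficient of a product of series.
theorem sum_prod_jordanMap {v : Fin r →₀ ℕ} {N : ℕ} (hN : ∑ i, v i ≤ N)
    (a : FrobOrbit K → MultiPartition r → κ) [Fintype (GLv K v)] :
    (Nat.card (GLv K v) : κ)⁻¹ * ∑ g : GLv K v, ∏ γ ∈ orbitsLE K N, a γ (jordanMap g γ) =
      ∑ l ∈ Finset.finsuppAntidiag (orbitsLE K N) v, ∏ γ ∈ orbitsLE K N,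
        ∑ μ ∈ partitionsOf γ.deg (l γ),
          a γ μ / ((centralizerPoly μ).eval ((Nat.card K : ℚ) ^ γ.deg) : ℚ) := by
  set S := orbitsLE K N with hSdef
  have hdeg : ∀ γ : FrobOrbit K, γ.deg ≠ 0 := fun γ => γ.2.2.1.natDegree_pos.ne'
  have hS : ∀ (g : GLv K v) γ, (jordanMap g γ).size ≠ 0 → γ ∈ S := fun g γ h =>
    mem_orbitsLE.mpr ((deg_le_of_size_ne_zero h).trans hN)
  let ℓ : GLv K v → FrobOrbit K →₀ Fin r →₀ ℕ := fun g => Finsupp.onFinset S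
    (fun γ => γ.deg • Finsupp.equivFunOnFinite.symm (jordanMap g γ).size) fun γ h => hS g γ fun h0 =>
      h (by ext i; simp [h0])
  have hℓ : ∀ g γ i, ℓ g γ i = γ.deg * (jordanMap g γ).size i := fun g γ i => rfl
  have hℓmem : ∀ g, ℓ g ∈ Finset.finsuppAntidiag S v := fun g => by
    rw [Finset.mem_finsuppAntidiag]
    refine ⟨?_, Finsupp.support_onFinset_subset⟩
    ext i
    rw [Finsupp.finsetSum_apply]
    exact sum_deg_mul_size (hS g) i
  rw [← Finset.sum_fiberwise_of_maps_to (t := Finset.finsuppAntidiag S v) (g := ℓ)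
    fun g _ => hℓmem g, Finset.mul_sum]
  refine Finset.sum_congr rfl fun l hl => ?_
  rw [Finset.prod_sum]
  have hmaps : ∀ g ∈ (Finset.univ.filter fun g => ℓ g = l), (fun γ (_ : γ ∈ S) => jordanMap g γ) ∈
      S.pi fun γ => partitionsOf γ.deg (l γ) := fun g hg => by
    rw [Finset.mem_pi]
    intro γ _
    rw [mem_partitionsOf (hdeg γ), ← (Finset.mem_filter.mp hg).2]
    exact fun i => (hℓ g γ i).symm
  rw [← Finset.sum_fiberwise_of_maps_to hmaps, Finset.mul_sum]
  refine Finset.sum_congr rfl fun h hh => ?_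
  -- The value outside `S` is a filler; only orbits in `S` are used.
  let H : FrobOrbit K → MultiPartition r := fun γ =>
    if hγ : γ ∈ S then h γ hγ else ⟨0, fun _ => Nat.Partition.indiscrete 0⟩
  have hH : ∀ γ (hγ : γ ∈ S), H γ = h γ hγ := fun γ hγ => dif_pos hγ
  have hHl : ∀ γ ∈ S, ∀ i, γ.deg * (H γ).size i = l γ i := fun γ hγ => by
    rw [hH γ hγ]
    exact (mem_partitionsOf (hdeg γ)).mp (Finset.mem_pi.mp hh γ hγ)
  have hl' := Finset.mem_finsuppAntidiag.mp hl
  have hHv : ∀ i, ∑ γ ∈ S, γ.deg * (H γ).size i = v i := fun i => by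
    rw [Finset.sum_congr rfl fun γ hγ => hHl γ hγ i, ← hl'.1, Finsupp.finsetSum_apply]
  have hfib : (Finset.univ.filter fun g => ℓ g = l).filter
      (fun g => (fun γ (_ : γ ∈ S) => jordanMap g γ) = h) =
      Finset.univ.filter fun g : GLv K v => ∀ γ ∈ S, jordanMap g γ = H γ := by
    ext g
    simp only [Finset.mem_filter, Finset.mem_univ, true_and]
    constructor
    · rintro ⟨-, rfl⟩ γ hγ
      exact (hH γ hγ).symm
    · intro hg
      refine ⟨?_, funext fun γ => funext fun hγ => (hg γ hγ).trans (hH γ hγ)⟩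
      ext γ i
      by_cases hγ : γ ∈ S
      · rw [hℓ, hg γ hγ, hHl γ hγ]
      · rw [hℓ, not_not.mp fun h0 => hγ (hS g γ h0),
          Finsupp.notMem_support_iff.mp fun h0 => hγ (hl'.2 h0)]
        simp
  rw [hfib, Finset.sum_congr rfl fun g hg => Finset.prod_congr rfl fun γ hγ => by
    rw [(Finset.mem_filter.mp hg).2 γ hγ], Finset.sum_const, nsmul_eq_mul]
  have h1 := congrArg (fun x : ℚ => (x : κ)) (card_class_mul H hHv)
  rw [Nat.card_eq_fintype_card (α := {g : GLv K v // ∀ γ ∈ S, jordanMap g γ = H γ}),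
    Fintype.card_subtype] at h1
  push_cast at h1
  have h2 : ∏ x ∈ S.attach, a x.1 (h x.1 x.2) /
      (((centralizerPoly (h x.1 x.2)).eval ((Nat.card K : ℚ) ^ x.1.deg) : ℚ) : κ) =
      ∏ γ ∈ S, a γ (H γ) / (((centralizerPoly (H γ)).eval ((Nat.card K : ℚ) ^ γ.deg) : ℚ) : κ) := by
    rw [← Finset.prod_attach S]
    exact Finset.prod_congr rfl fun γ _ => by rw [hH γ.1 γ.2]
  have h3 : (∏ γ ∈ S, (((centralizerPoly (H γ)).eval ((Nat.card K : ℚ) ^ γ.deg) : ℚ) : κ)) ≠ 0 :=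
    Finset.prod_ne_zero_iff.mpr fun γ _ => Rat.cast_ne_zero.mpr
      (centralizerPoly_eval_card_pow_ne_zero K _ (hdeg γ))
  have h4 : (Nat.card (GLv K v) : κ) ≠ 0 := Nat.cast_ne_zero.mpr Nat.card_pos.ne'
  rw [h2, Finset.prod_div_distrib, eq_div_iff h3, inv_mul_eq_div, div_mul_eq_mul_div, div_eq_iff h4,
    ← h1]
  ring

end GeneratingFunction

section GeneratingFunction

variable {r : ℕ} {κ : Type*} [Field κ] [CharZero κ]

theorem coeff_expand_rescale_partitionSeries {H : MultiPartition r → RatFunc ℚ} {Q : ℚ}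
    (hH : ∀ μ, H μ ∈ regularAt Q) (c : κ) {d : ℕ} (hd : d ≠ 0) (m : Fin r →₀ ℕ) :
    MvPowerSeries.coeff m (MvPowerSeries.expand d hd
      (MvPowerSeries.rescale (fun _ => c) (valueSeries κ Q (partitionSeries H)))) =
      ∑ μ ∈ partitionsOf d m, c ^ (∑ i, μ.size i) * (valueAt Q (H μ) : κ) := by
  rw [coeff_expand_eq, partitionsOf]
  split_ifs with h
  · rw [coeff_rescale_const, coeff_valueSeries, Finset.sum_map]
    change _ * ((valueAt Q (∑ μ : (∀ i, Nat.Partition (m i / d)), H ⟨fun i => m i / d, μ⟩) : ℚ) : κ)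
      = _
    rw [valueAt_sum _ _ fun μ _ => hH _, Rat.cast_sum, Finset.mul_sum]
    refine Finset.sum_congr rfl fun μ _ => ?_
    rw [Finsupp.degree_eq_sum]
    rfl
  · rw [Finset.sum_empty]

theorem constantCoeff_partitionSeries {H : MultiPartition r → RatFunc ℚ}
    (hH : ∀ μ : MultiPartition r, μ.size = 0 → H μ = 1) :
    MvPowerSeries.constantCoeff (partitionSeries H) = 1 := by
  rw [← MvPowerSeries.coeff_zero_eq_constantCoeff_apply]
  change ∑ μ : (∀ i : Fin r, Nat.Partition 0), H ⟨fun _ => 0, μ⟩ = 1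
  rw [Fintype.sum_congr _ (fun _ => 1) fun μ => hH _ rfl]
  simp

theorem coeff_partitionSeries_mem {H : MultiPartition r → RatFunc ℚ} {Q : ℚ}
    (hH : ∀ μ, H μ ∈ regularAt Q) (v : Fin r →₀ ℕ) :
    MvPowerSeries.coeff v (partitionSeries H) ∈ regularAt Q :=
  sum_mem fun μ _ => hH ⟨v, μ⟩

/-- The function `μ ↦ F_μ(t) / Z_μ(t)`. -/
def unipotentQuotient (Fty : MultiType r → RatFunc ℚ) (μ : MultiPartition r) : RatFunc ℚ :=
  Fty (unipotentType μ) / algebraMap ℚ[X] (RatFunc ℚ) (centralizerPoly μ)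

variable {F : FunctionFamily.{u} r} {Fty : MultiType r → RatFunc ℚ}

theorem IsLogCompatible.unipotentQuotient_mem (hF : IsLogCompatible F Fty) (K : Type*) [Field K]
    [Finite K] {d : ℕ} (hd : d ≠ 0) (μ : MultiPartition r) :
    unipotentQuotient Fty μ ∈ regularAt ((Nat.card K : ℚ) ^ d) :=
  div_mem_regularAt (hF.mem_regularAt K μ hd) (centralizerPoly_eval_card_pow_ne_zero K μ hd)

theorem IsLogCompatible.constantCoeff_partitionSeries (hF : IsLogCompatible F Fty) :
    MvPowerSeries.constantCoeff (partitionSeries (unipotentQuotient Fty)) = 1 :=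
  LogCompat.constantCoeff_partitionSeries fun μ hμ => by
    rw [unipotentQuotient, hF.zero_type hμ, centralizerPoly_of_size_eq_zero hμ, map_one, div_one]

/-- The logarithm of the series `∑ F_μ(t) / Z_μ(t) T^{|μ|}`. -/
def logSeries (Fty : MultiType r → RatFunc ℚ) : Series r :=
  PowerSeries.subst (partitionSeries (unipotentQuotient Fty) - 1) (PowerSeries.log (RatFunc ℚ))

theorem IsLogCompatible.logSeries_mem (hF : IsLogCompatible F Fty) (K : Type*) [Field K]
    [Finite K] {d : ℕ} (hd : d ≠ 0) (v : Fin r →₀ ℕ) :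
    MvPowerSeries.coeff v (logSeries Fty) ∈ regularAt ((Nat.card K : ℚ) ^ d) :=
  coeff_subst_log_mem (coeff_partitionSeries_mem (hF.unipotentQuotient_mem K hd))
    hF.constantCoeff_partitionSeries v

theorem IsLogCompatible.isLogOf_logSeries (hF : IsLogCompatible F Fty) :
    IsLogOf (partitionSeries (unipotentQuotient Fty)) (logSeries Fty) :=
  isLogOf_subst_log hF.constantCoeff_partitionSeries

variable {K : Type u} [Field K] [Finite K]

/-- Here `f` is the Euler product over the orbits of size at most `|v|`, and `M` the sum of the
logarithms of its factors. Larger orbits do not affect degrees up to `|v|`, and grouping orbits by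
size produces the character sums. -/
theorem IsLogCompatible.exists_isLogOf_average (hF : IsLogCompatible F Fty) (θ : Kˣ →* κˣ)
    (v : Fin r →₀ ℕ) : ∃ f M : MvPowerSeries (Fin r) κ, IsLogOf f M ∧
      MvPowerSeries.coeff v f =
        (Nat.card (GLv K v) : κ)⁻¹ * ∑ᶠ g : GLv K v, (F K v g : κ) * twistedChar θ v g ∧
      ∀ w : Fin r →₀ ℕ, w.degree ≤ v.degree → MvPowerSeries.coeff w M =
        ∑ d ∈ Finset.Icc 1 w.degree, if ∀ i, d ∣ w i then
          charSum θ d (w.degree / d) * (valueAt ((Nat.card K : ℚ) ^ d)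
            (MvPowerSeries.coeff (w.mapRange (· / d) (Nat.zero_div d)) (logSeries Fty)) : κ)
        else 0 := by
  classical
  set S := orbitsLE K v.degree with hSdef
  have hdeg : ∀ γ : FrobOrbit K, γ.deg ≠ 0 := fun γ => γ.2.2.1.natDegree_pos.ne'
  have hsum : ∑ i, v i ≤ v.degree := (Finsupp.degree_eq_sum v).ge
  have hS : ∀ (g : GLv K v) γ, (jordanMap g γ).size ≠ 0 → γ ∈ S := fun g γ h =>
    mem_orbitsLE.mpr ((deg_le_of_size_ne_zero h).trans hsum)
  refine ⟨∏ γ ∈ S, MvPowerSeries.expand γ.deg (hdeg γ) (MvPowerSeries.rescale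
      (fun _ => (θ γ.norm : κ)) (valueSeries κ ((Nat.card K : ℚ) ^ γ.deg)
        (partitionSeries (unipotentQuotient Fty)))),
    ∑ γ ∈ S, MvPowerSeries.expand γ.deg (hdeg γ) (MvPowerSeries.rescale
      (fun _ => (θ γ.norm : κ)) (valueSeries κ ((Nat.card K : ℚ) ^ γ.deg) (logSeries Fty))),
    IsLogOf.prod S fun γ _ => ((hF.isLogOf_logSeries.valueSeries
      (coeff_partitionSeries_mem (hF.unipotentQuotient_mem K (hdeg γ)))
      (hF.logSeries_mem K (hdeg γ))).rescale _).expand _, ?_, ?_⟩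
  · have : Fintype (GLv K v) := Fintype.ofFinite _
    rw [finsum_eq_sum_of_fintype, MvPowerSeries.coeff_prod]
    refine Eq.trans ?_ ((sum_prod_jordanMap hsum fun γ μ => (θ γ.norm : κ) ^ (∑ i, μ.size i) *
      (valueAt ((Nat.card K : ℚ) ^ γ.deg) (Fty (unipotentType μ)) : κ)).symm.trans ?_)
    · refine Finset.sum_congr rfl fun l _ => Finset.prod_congr rfl fun γ _ => ?_
      rw [coeff_expand_rescale_partitionSeries (hF.unipotentQuotient_mem K (hdeg γ))]
      refine Finset.sum_congr rfl fun μ _ => ?_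
      rw [unipotentQuotient, valueAt_div (hF.mem_regularAt K μ (hdeg γ))
        (centralizerPoly_eval_card_pow_ne_zero K μ (hdeg γ)), Rat.cast_div, mul_div_assoc]
    · congr 1
      refine Finset.sum_congr rfl fun g _ => ?_
      rw [Finset.prod_mul_distrib, hF.value_eq_prod g (hS g), twistedChar_eq_prod θ (hS g), mul_comm]
      push_cast
      rfl
  · intro w hw
    rw [map_sum]
    simp only [coeff_expand_eq, coeff_rescale_const, coeff_valueSeries]
    by_cases hw0 : w = 0
    · subst hw0
      have h0 : MvPowerSeries.coeff (0 : Fin r →₀ ℕ) (logSeries Fty) = 0 := by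
        rw [MvPowerSeries.coeff_zero_eq_constantCoeff_apply]
        exact hF.isLogOf_logSeries.2
      simp [h0, valueAt]
    have hdvd : ∀ d, (∀ i, d ∣ w i) → d ∈ Finset.Icc 1 w.degree := fun d hd => by
      obtain ⟨i, hi⟩ := DFunLike.ne_iff.mp hw0
      have h1 := Nat.pos_of_ne_zero hi
      exact Finset.mem_Icc.mpr ⟨Nat.pos_of_dvd_of_pos (hd i) h1,
        (Nat.le_of_dvd h1 (hd i)).trans (Finsupp.le_degree i w)⟩
    rw [← Finset.sum_filter, ← Finset.sum_fiberwise_of_maps_to (t := Finset.Icc 1 w.degree)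
      (g := FrobOrbit.deg) fun γ hγ => hdvd _ (Finset.mem_filter.mp hγ).2]
    refine Finset.sum_congr rfl fun d hd => ?_
    have hd' := Finset.mem_Icc.mp hd
    split_ifs with h
    · rw [charSum_eq θ (hd'.2.trans hw), Finset.sum_mul]
      refine Finset.sum_congr ?_ fun γ hγ => ?_
      · ext γ
        simp only [Finset.mem_filter]
        constructor
        · exact fun h1 => ⟨h1.1.1, h1.2⟩
        · rintro ⟨h1, rfl⟩
          exact ⟨⟨h1, h⟩, rfl⟩
      · obtain rfl := (Finset.mem_filter.mp hγ).2
        congr 2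
        -- The rescaling acts before `T ↦ T ^ d`, so the exponent of the character value is `|w / d|
        -- = |w| / d`.
        have h2 : γ.deg * (w.mapRange (· / γ.deg) (Nat.zero_div _)).degree = w.degree := by
          rw [← degree_nsmul_finsupp]
          congr 1
          ext i
          simp [Nat.mul_div_cancel' (h i)]
        rw [← h2, Nat.mul_div_cancel_left _ hd'.1]
    · refine Finset.sum_eq_zero fun γ hγ => ?_
      obtain ⟨h1, rfl⟩ := Finset.mem_filter.mp hγ
      exact absurd (Finset.mem_filter.mp h1).2 h

end GeneratingFunction

/-! ### Adams operations and the inversion of Ψ -/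

section Plethysm

variable {r : ℕ}

/-- Along the ray of a primitive vector `u`, divisibility of `n • u` by `d` is divisibility of `n`,
which reduces plethystic identities to sums over divisors of one integer. -/
theorem exists_eq_nsmul_primitive {w : Fin r →₀ ℕ} (hw : w ≠ 0) :
    ∃ (n : ℕ) (u : Fin r →₀ ℕ), n ≠ 0 ∧ Finset.univ.gcd u = 1 ∧ w = n • u := by
  obtain ⟨i, hi⟩ := DFunLike.ne_iff.mp hw
  obtain ⟨g, hg, hg1⟩ := Finset.extract_gcd (s := Finset.univ) w ⟨i, Finset.mem_univ i⟩
  refine ⟨Finset.univ.gcd w, Finsupp.equivFunOnFinite.symm g, fun h => hi ?_, hg1, ?_⟩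
  · exact Finset.gcd_eq_zero_iff.mp h i (Finset.mem_univ i)
  · ext j
    exact hg j (Finset.mem_univ j)

theorem forall_dvd_nsmul_iff {u : Fin r →₀ ℕ} (hu : Finset.univ.gcd u = 1) (n d : ℕ) :
    (∀ i, d ∣ (n • u) i) ↔ d ∣ n := by
  constructor
  · intro h
    have h1 : d ∣ Finset.univ.gcd fun i => n * u i := Finset.dvd_gcd fun i _ => h i
    rwa [Finset.gcd_mul_left, hu, mul_one, normalize_eq] at h1
  · exact fun h i => h.mul_right _

theorem sum_Icc_degree_eq_sum_divisors {A : Type*} [AddCommMonoid A] {u : Fin r →₀ ℕ}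
    (hu : Finset.univ.gcd u = 1) {n : ℕ} (hn : n ≠ 0) (φ : ℕ → (Fin r →₀ ℕ) → A) :
    (∑ d ∈ Finset.Icc 1 (n • u).degree, if ∀ i, d ∣ (n • u) i then
      φ d ((n • u).mapRange (· / d) (Nat.zero_div d)) else 0) =
      ∑ d ∈ n.divisors, φ d ((n / d) • u) := by
  rw [← Finset.sum_filter]
  refine Finset.sum_congr ?_ fun d hd => ?_
  · have hu0 : u.degree ≠ 0 := fun h => by
      rw [(Finsupp.degree_eq_zero_iff u).mp h] at hu
      have h0 : Finset.univ.gcd (⇑(0 : Fin r →₀ ℕ)) = 0 := Finset.gcd_eq_zero_iff.mpr fun _ _ => rfl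
      rw [h0] at hu
      exact zero_ne_one hu
    ext d
    rw [Finset.mem_filter, forall_dvd_nsmul_iff hu, Finset.mem_Icc, Nat.mem_divisors,
      degree_nsmul_finsupp]
    constructor
    · exact fun h => ⟨h.2, hn⟩
    · rintro ⟨h, -⟩
      exact ⟨⟨Nat.pos_of_dvd_of_pos h (Nat.pos_of_ne_zero hn),
        (Nat.le_of_dvd (Nat.pos_of_ne_zero hn) h).trans
          (Nat.le_mul_of_pos_right n (Nat.pos_of_ne_zero hu0))⟩, h⟩
  · congr 1
    ext i
    obtain ⟨m, rfl⟩ := Nat.dvd_of_mem_divisors hd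
    have hd0 : 0 < d := Nat.pos_of_ne_zero (left_ne_zero_of_mul hn)
    simp only [Finsupp.mapRange_apply, Finsupp.smul_apply, smul_eq_mul]
    rw [Nat.mul_div_cancel_left _ hd0, mul_assoc, Nat.mul_div_cancel_left _ hd0]

theorem sum_divisors_sum_divisors {A : Type*} [AddCommMonoid A] (n : ℕ) (f : ℕ → ℕ → A) :
    ∑ d ∈ n.divisors, ∑ k ∈ (n / d).divisors, f d k =
      ∑ D ∈ n.divisors, ∑ d ∈ D.divisors, f d (D / d) := by
  rw [Finset.sum_sigma', Finset.sum_sigma']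
  refine Finset.sum_bij' (fun p _ => ⟨p.1 * p.2, p.1⟩) (fun p _ => ⟨p.2, p.1 / p.2⟩) ?_ ?_ ?_ ?_ ?_
  · rintro ⟨d, k⟩ h
    simp only [Finset.mem_sigma, Nat.mem_divisors] at h ⊢
    obtain ⟨⟨⟨m, rfl⟩, hn⟩, h2, -⟩ := h
    have hd0 : 0 < d := Nat.pos_of_ne_zero (left_ne_zero_of_mul hn)
    rw [Nat.mul_div_cancel_left _ hd0] at h2
    exact ⟨⟨mul_dvd_mul_left d h2, hn⟩, dvd_mul_right _ _,
      mul_ne_zero hd0.ne' (ne_zero_of_dvd_ne_zero (right_ne_zero_of_mul hn) h2)⟩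
  · rintro ⟨D, d⟩ h
    simp only [Finset.mem_sigma, Nat.mem_divisors] at h ⊢
    obtain ⟨⟨⟨m, rfl⟩, hn⟩, ⟨k, rfl⟩, hD⟩ := h
    have hd0 : 0 < d := Nat.pos_of_ne_zero (left_ne_zero_of_mul hD)
    rw [Nat.mul_div_cancel_left _ hd0, mul_assoc, Nat.mul_div_cancel_left _ hd0]
    rw [mul_assoc] at hn
    exact ⟨⟨dvd_mul_right _ _, hn⟩, dvd_mul_right _ _, right_ne_zero_of_mul hn⟩
  · rintro ⟨d, k⟩ h
    simp only [Finset.mem_sigma, Nat.mem_divisors] at h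
    have hd0 : 0 < d := Nat.pos_of_dvd_of_pos h.1.1 (Nat.pos_of_ne_zero h.1.2)
    simp only [Nat.mul_div_cancel_left _ hd0]
  · rintro ⟨D, d⟩ h
    simp only [Finset.mem_sigma, Nat.mem_divisors] at h
    simp only [Nat.mul_div_cancel' h.2.1]
  · rintro ⟨d, k⟩ h
    simp only [Finset.mem_sigma, Nat.mem_divisors] at h
    have hd0 : 0 < d := Nat.pos_of_dvd_of_pos h.1.1 (Nat.pos_of_ne_zero h.1.2)
    simp only [Nat.mul_div_cancel_left _ hd0]

/-- `Ψ(f) = ∑_{d ≥ 1} ψ_d(f) / d` for `f` without constant term. -/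
def psi (f : Series r) : Series r := fun v =>
  ∑ d ∈ Finset.Icc 1 v.degree, (d : RatFunc ℚ)⁻¹ * MvPowerSeries.coeff v (adams d f)

theorem coeff_psi_eq_sum (f : Series r) (v : Fin r →₀ ℕ) : MvPowerSeries.coeff v (psi f) =
    ∑ d ∈ Finset.Icc 1 v.degree, (d : RatFunc ℚ)⁻¹ * MvPowerSeries.coeff v (adams d f) := rfl

theorem coeff_psiInv_eq_sum (f : Series r) (v : Fin r →₀ ℕ) : MvPowerSeries.coeff v (psiInv f) =
    ∑ d ∈ Finset.Icc 1 v.degree, ((ArithmeticFunction.moebius d : RatFunc ℚ) / (d : RatFunc ℚ)) *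
      MvPowerSeries.coeff v (adams d f) := rfl

theorem constantCoeff_psi (f : Series r) : MvPowerSeries.constantCoeff (psi f) = 0 := by
  rw [← MvPowerSeries.coeff_zero_eq_constantCoeff_apply, coeff_psi_eq_sum]
  simp

theorem constantCoeff_psiInv (f : Series r) : MvPowerSeries.constantCoeff (psiInv f) = 0 := by
  rw [← MvPowerSeries.coeff_zero_eq_constantCoeff_apply, coeff_psiInv_eq_sum]
  simp

theorem coeff_adams (d : ℕ) (f : Series r) (v : Fin r →₀ ℕ) :
    MvPowerSeries.coeff v (adams d f) = if ∀ i, d ∣ v i then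
      substPow d (MvPowerSeries.coeff (v.mapRange (· / d) (Nat.zero_div d)) f) else 0 := rfl

variable {u : Fin r →₀ ℕ} {n : ℕ}

theorem coeff_psi (hu : Finset.univ.gcd u = 1) (hn : n ≠ 0) (f : Series r) :
    MvPowerSeries.coeff (n • u) (psi f) = ∑ d ∈ n.divisors,
      (d : RatFunc ℚ)⁻¹ * substPow d (MvPowerSeries.coeff ((n / d) • u) f) := by
  rw [coeff_psi_eq_sum]
  refine Eq.trans (Finset.sum_congr rfl fun d _ => ?_) (sum_Icc_degree_eq_sum_divisors hu hn
    fun d v => (d : RatFunc ℚ)⁻¹ * substPow d (MvPowerSeries.coeff v f))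
  rw [coeff_adams, mul_ite, mul_zero]

theorem coeff_psiInv (hu : Finset.univ.gcd u = 1) (hn : n ≠ 0) (f : Series r) :
    MvPowerSeries.coeff (n • u) (psiInv f) = ∑ d ∈ n.divisors,
      ((ArithmeticFunction.moebius d : RatFunc ℚ) / (d : RatFunc ℚ)) *
        substPow d (MvPowerSeries.coeff ((n / d) • u) f) := by
  rw [coeff_psiInv_eq_sum]
  refine Eq.trans (Finset.sum_congr rfl fun d _ => ?_) (sum_Icc_degree_eq_sum_divisors hu hn
    fun d v => ((ArithmeticFunction.moebius d : RatFunc ℚ) / (d : RatFunc ℚ)) *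
      substPow d (MvPowerSeries.coeff v f))
  rw [coeff_adams, mul_ite, mul_zero]

/-- Since `ψ_d ψ_k = ψ_{dk}`, the operator `ψ_D / D` appears with coefficient `∑_{d ∣ D} μ(d)`,
which is zero unless `D = 1`. -/
theorem psiInv_psi {f : Series r} (hf : MvPowerSeries.constantCoeff f = 0) : psiInv (psi f) = f := by
  ext w
  by_cases hw : w = 0
  · rw [hw, MvPowerSeries.coeff_zero_eq_constantCoeff_apply,
      MvPowerSeries.coeff_zero_eq_constantCoeff_apply, constantCoeff_psiInv, hf]
  obtain ⟨n, u, hn, hu, rfl⟩ := exists_eq_nsmul_primitive hw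
  rw [coeff_psiInv hu hn]
  have h1 : ∀ d ∈ n.divisors, ((ArithmeticFunction.moebius d : RatFunc ℚ) / (d : RatFunc ℚ)) *
      substPow d (MvPowerSeries.coeff ((n / d) • u) (psi f)) =
      ∑ k ∈ (n / d).divisors, (ArithmeticFunction.moebius d : RatFunc ℚ) *
        (((d * k : ℕ) : RatFunc ℚ)⁻¹ *
          substPow (d * k) (MvPowerSeries.coeff ((n / (d * k)) • u) f)) := fun d hd => by
    have hd' := Nat.dvd_of_mem_divisors hd
    have hd0 : d ≠ 0 := ne_zero_of_dvd_ne_zero hn hd'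
    rw [coeff_psi hu (Nat.div_pos (Nat.le_of_dvd (Nat.pos_of_ne_zero hn) hd')
      (Nat.pos_of_ne_zero hd0)).ne', ← substPowHom_apply hd0, map_sum, Finset.mul_sum]
    refine Finset.sum_congr rfl fun k _ => ?_
    rw [map_mul, substPowHom_apply hd0 (substPow _ _), substPow_substPow hd0, Nat.div_div_eq_div_mul,
      map_inv₀, map_natCast, Nat.cast_mul, mul_inv]
    ring
  rw [Finset.sum_congr rfl h1, sum_divisors_sum_divisors n fun d k =>
    (ArithmeticFunction.moebius d : RatFunc ℚ) * (((d * k : ℕ) : RatFunc ℚ)⁻¹ *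
      substPow (d * k) (MvPowerSeries.coeff ((n / (d * k)) • u) f)),
    Finset.sum_eq_single_of_mem 1 (Nat.one_mem_divisors.mpr hn)]
  · simp [substPow_one]
  · intro D _ hD1
    have h2 : ∀ d ∈ D.divisors, (ArithmeticFunction.moebius d : RatFunc ℚ) *
        (((d * (D / d) : ℕ) : RatFunc ℚ)⁻¹ *
          substPow (d * (D / d)) (MvPowerSeries.coeff ((n / (d * (D / d))) • u) f)) =
        (ArithmeticFunction.moebius d : RatFunc ℚ) *
          ((D : RatFunc ℚ)⁻¹ * substPow D (MvPowerSeries.coeff ((n / D) • u) f)) := fun d hd => by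
      rw [Nat.mul_div_cancel' (Nat.dvd_of_mem_divisors hd)]
    rw [Finset.sum_congr rfl h2, ← Finset.sum_mul, ← Int.cast_sum,
      ← ArithmeticFunction.coe_mul_zeta_apply, ArithmeticFunction.moebius_mul_coe_zeta,
      ArithmeticFunction.one_apply, if_neg hD1, Int.cast_zero, zero_mul]

/-- The polynomial `∑_{k ∣ D} μ(D / k) (t ^ k - 1) / D`, which counts the Frobenius orbits of size
`D`. -/
def orbitCountPoly (D : ℕ) : ℚ[X] :=
  ∑ k ∈ D.divisors, C ((ArithmeticFunction.moebius (D / k) : ℚ) / D) * (X ^ k - 1)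

theorem coeff_C_mul_psiInv (hu : Finset.univ.gcd u = 1) (hn : n ≠ 0) (L : Series r) :
    MvPowerSeries.coeff (n • u) (MvPowerSeries.C (RatFunc.X - 1) * psiInv L) =
      ∑ d ∈ n.divisors, algebraMap ℚ[X] (RatFunc ℚ)
        (C ((ArithmeticFunction.moebius d : ℚ) / d) * (X - 1)) *
          substPow d (MvPowerSeries.coeff ((n / d) • u) L) := by
  rw [MvPowerSeries.coeff_C_mul, coeff_psiInv hu hn, Finset.mul_sum]
  refine Finset.sum_congr rfl fun d _ => ?_
  rw [map_mul, map_sub, map_one, RatFunc.algebraMap_X, RatFunc.algebraMap_C, map_div₀, map_intCast,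
    map_natCast]
  ring

/-- `ψ_k` turns the factor `t - 1` into `t ^ k - 1`. Collecting the terms with `k * d = D` leaves
exactly the orbit-counting polynomial, which links plethysm with the Euler product. -/
theorem coeff_psi_C_mul_psiInv (hu : Finset.univ.gcd u = 1) (hn : n ≠ 0) (L : Series r) :
    MvPowerSeries.coeff (n • u) (psi (MvPowerSeries.C (RatFunc.X - 1) * psiInv L)) =
      ∑ D ∈ n.divisors, algebraMap ℚ[X] (RatFunc ℚ) (orbitCountPoly D) *
        substPow D (MvPowerSeries.coeff ((n / D) • u) L) := by
  rw [coeff_psi hu hn]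
  have h1 : ∀ k ∈ n.divisors, (k : RatFunc ℚ)⁻¹ * substPow k (MvPowerSeries.coeff ((n / k) • u)
      (MvPowerSeries.C (RatFunc.X - 1) * psiInv L)) =
      ∑ d ∈ (n / k).divisors, algebraMap ℚ[X] (RatFunc ℚ)
        (C ((ArithmeticFunction.moebius d : ℚ) / (k * d : ℕ)) * (X ^ k - 1)) *
          substPow (k * d) (MvPowerSeries.coeff ((n / (k * d)) • u) L) := fun k hk => by
    have hk' := Nat.dvd_of_mem_divisors hk
    have hk0 : k ≠ 0 := ne_zero_of_dvd_ne_zero hn hk'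
    rw [MvPowerSeries.coeff_C_mul, coeff_psiInv hu (Nat.div_pos (Nat.le_of_dvd
      (Nat.pos_of_ne_zero hn) hk') (Nat.pos_of_ne_zero hk0)).ne', ← substPowHom_apply hk0, map_mul,
      map_sum, Finset.mul_sum, Finset.mul_sum]
    refine Finset.sum_congr rfl fun d _ => ?_
    rw [map_mul, substPowHom_apply hk0 (substPow _ _), substPow_substPow hk0, Nat.div_div_eq_div_mul,
      map_sub, substPowHom_apply hk0 RatFunc.X, substPow_X, map_one, map_div₀, map_intCast,
      map_natCast, map_mul, map_sub, map_one, map_pow, RatFunc.algebraMap_X, RatFunc.algebraMap_C,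
      map_div₀, map_intCast, map_natCast, Nat.cast_mul, div_mul_eq_div_mul_one_div]
    ring
  rw [Finset.sum_congr rfl h1, sum_divisors_sum_divisors n fun k d => algebraMap ℚ[X] (RatFunc ℚ)
    (C ((ArithmeticFunction.moebius d : ℚ) / (k * d : ℕ)) * (X ^ k - 1)) *
      substPow (k * d) (MvPowerSeries.coeff ((n / (k * d)) • u) L)]
  refine Finset.sum_congr rfl fun D _ => ?_
  rw [orbitCountPoly, map_sum, Finset.sum_mul]
  refine Finset.sum_congr rfl fun k hk => ?_
  rw [Nat.mul_div_cancel' (Nat.dvd_of_mem_divisors hk)]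

/-- The recursion for the coefficients of `f` divides only by positive integers. -/
theorem IsLogOf.coeff_mem_regularAt {f L : Series r} (h : IsLogOf f L) {q : ℚ}
    (hL : ∀ v, MvPowerSeries.coeff v L ∈ regularAt q) (v : Fin r →₀ ℕ) :
    MvPowerSeries.coeff v f ∈ regularAt q := by
  classical
  induction hm : v.degree using Nat.strong_induction_on generalizing v with
  | _ m ih =>
    by_cases hv : v = 0
    · rw [hv, MvPowerSeries.coeff_zero_eq_constantCoeff_apply, h.1]
      exact one_mem _
    have hdeg : v.degree ≠ 0 := fun h1 => hv ((Finsupp.degree_eq_zero_iff v).mp h1)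
    have h1 : MvPowerSeries.coeff v f = (((v.degree : ℚ)⁻¹ : ℚ) : RatFunc ℚ) *
        ((v.degree : RatFunc ℚ) * MvPowerSeries.coeff v f) := by
      have : (v.degree : RatFunc ℚ) ≠ 0 := Nat.cast_ne_zero.mpr hdeg
      rw [Rat.cast_inv, Rat.cast_natCast, inv_mul_cancel_left₀ this]
    rw [h1, h.degree_mul_coeff]
    refine mul_mem (ratCast_mem_regularAt _) (sum_mem fun p hp => ?_)
    have hadd : p.1 + p.2 = v := Finset.HasAntidiagonal.mem_antidiagonal.mp hp
    have hsum : p.1.degree + p.2.degree = v.degree := by rw [← map_add, hadd]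
    by_cases h2 : p.2.degree = 0
    · rw [h2, Nat.cast_zero, zero_mul, mul_zero]
      exact zero_mem _
    · exact mul_mem (ih p.1.degree (by omega) p.1 rfl) (mul_mem (natCast_mem _ _) (hL _))

end Plethysm

/-! ### The averages of F_v and their twisted analogues -/

section Main

variable {r : ℕ} {κ : Type*} [Field κ] [CharZero κ]

omit [CharZero κ] in
-- The values of `α` are roots of unity, because `Kˣ` is finite.
theorem conj_twistedChar {K : Type*} [Field K] [Finite K] {conj : κ →+* κ}
    (hconj : InvertsRootsOfUnity conj) (α : Kˣ →* κˣ) (v : Fin r → ℕ) (x : GLv K v) :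
    conj (twistedChar α v x) = twistedChar α⁻¹ v x := by
  rw [twistedChar, twistedChar, map_prod]
  refine Finset.prod_congr rfl fun i _ => ?_
  rw [hconj (Nat.card Kˣ) _ Nat.card_pos, MonoidHom.inv_apply, Units.val_inv_eq_inv_val]
  rw [← Units.val_pow_eq_pow_val, ← map_pow, pow_card_eq_one', map_one, Units.val_one]

theorem charSum_one_eq_eval {K : Type*} [Field K] [Finite K] {d : ℕ} (hd : d ≠ 0) (k : ℕ) :
    charSum (1 : Kˣ →* κˣ) d k = (((orbitCountPoly d).eval (Nat.card K : ℚ) : ℚ) : κ) := by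
  have hd' : (d : κ) ≠ 0 := Nat.cast_ne_zero.mpr hd
  rw [← mul_right_inj' hd', mul_charSum_one hd, orbitCountPoly, eval_finsetSum, Rat.cast_sum,
    Finset.mul_sum]
  refine Finset.sum_congr rfl fun e _ => ?_
  simp only [eval_mul, eval_C, eval_sub, eval_pow, eval_X, eval_one]
  push_cast
  field_simp

variable {F : FunctionFamily.{u} r} {Fty : MultiType r → RatFunc ℚ}

theorem IsLogCompatible.mul_substPow_mem (hF : IsLogCompatible F Fty) (K : Type*) [Field K]
    [Finite K] {d : ℕ} (hd : d ≠ 0) (p : ℚ[X]) (w : Fin r →₀ ℕ) :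
    algebraMap ℚ[X] (RatFunc ℚ) p * substPow d (MvPowerSeries.coeff w (logSeries Fty)) ∈
      regularAt (Nat.card K : ℚ) ∧
    valueAt (Nat.card K : ℚ) (algebraMap ℚ[X] (RatFunc ℚ) p *
      substPow d (MvPowerSeries.coeff w (logSeries Fty))) = p.eval (Nat.card K : ℚ) *
        valueAt ((Nat.card K : ℚ) ^ d) (MvPowerSeries.coeff w (logSeries Fty)) := by
  have h1 := substPow_mem_regularAt (hF.logSeries_mem K hd w)
  refine ⟨mul_mem (algebraMap_mem_regularAt p) h1, ?_⟩
  rw [valueAt_mul (algebraMap_mem_regularAt p) h1, valueAt_algebraMap,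
    valueAt_substPow (hF.logSeries_mem K hd w)]

/-- The series `(t - 1) Log(∑ F_μ(t) / Z_μ(t) T^{|μ|})`. -/
def genericSeries (Fty : MultiType r → RatFunc ℚ) : Series r :=
  MvPowerSeries.C (RatFunc.X - 1) * psiInv (logSeries Fty)

theorem constantCoeff_genericSeries (Fty : MultiType r → RatFunc ℚ) :
    MvPowerSeries.constantCoeff (genericSeries Fty) = 0 := by
  rw [genericSeries, map_mul, constantCoeff_psiInv, mul_zero]

variable (K : Type u) [Field K] [Finite K]

theorem IsLogCompatible.psi_genericSeries_mem (hF : IsLogCompatible F Fty) (w : Fin r →₀ ℕ) :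
    MvPowerSeries.coeff w (psi (genericSeries Fty)) ∈ regularAt (Nat.card K : ℚ) := by
  by_cases hw : w = 0
  · rw [hw, MvPowerSeries.coeff_zero_eq_constantCoeff_apply, constantCoeff_psi]
    exact zero_mem _
  obtain ⟨n, u, hn, hu, rfl⟩ := exists_eq_nsmul_primitive hw
  rw [genericSeries, coeff_psi_C_mul_psiInv hu hn]
  exact sum_mem fun D hD => (hF.mul_substPow_mem K
    (ne_zero_of_dvd_ne_zero hn (Nat.dvd_of_mem_divisors hD)) _ _).1

/-- For the trivial character the sums count orbits, so the logarithm of the Euler product agrees up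
to degree `|v|` with the value at `q` of `psi (genericSeries Fty)`. Series whose logarithms agree so
far have the same coefficient at `v`. -/
theorem IsLogCompatible.takesValueAt_average (hF : IsLogCompatible F Fty) {f : Series r}
    (hf : IsLogOf f (psi (genericSeries Fty))) (v : Fin r →₀ ℕ) {conj : κ →+* κ} :
    TakesValueAt (MvPowerSeries.coeff v f) (Nat.card K)
      (inner conj (fun x : GLv K v => (F K v x : κ)) (fun _ => 1)) := by
  have hreg := hf.coeff_mem_regularAt (hF.psi_genericSeries_mem K)
  refine takesValueAt_iff.mpr ⟨hreg v, ?_⟩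
  obtain ⟨g, M, hgM, hg, hM⟩ := hF.exists_isLogOf_average (κ := κ) (1 : Kˣ →* κˣ) v
  rw [← coeff_valueSeries, ← hgM.coeff_congr (hf.valueSeries hreg (hF.psi_genericSeries_mem K))
    v.degree (fun w hw => ?_) v le_rfl, hg, inner]
  · simp [twistedChar]
  · by_cases hw0 : w = 0
    · rw [hw0, MvPowerSeries.coeff_zero_eq_constantCoeff_apply, hgM.2,
        MvPowerSeries.coeff_zero_eq_constantCoeff_apply,
        (hf.valueSeries (κ := κ) hreg (hF.psi_genericSeries_mem K)).2]
    rw [hM w hw]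
    obtain ⟨n, u, hn, hu, rfl⟩ := exists_eq_nsmul_primitive hw0
    rw [sum_Icc_degree_eq_sum_divisors hu hn fun d x =>
      charSum (1 : Kˣ →* κˣ) d ((n • u).degree / d) *
        (valueAt ((Nat.card K : ℚ) ^ d) (MvPowerSeries.coeff x (logSeries Fty)) : κ),
      coeff_valueSeries, genericSeries, coeff_psi_C_mul_psiInv hu hn]
    have hd0 : ∀ d ∈ n.divisors, d ≠ 0 := fun d hd =>
      ne_zero_of_dvd_ne_zero hn (Nat.dvd_of_mem_divisors hd)
    rw [valueAt_sum _ _ fun d hd => (hF.mul_substPow_mem K (hd0 d hd) _ _).1, Rat.cast_sum]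
    refine Finset.sum_congr rfl fun d hd => ?_
    rw [(hF.mul_substPow_mem K (hd0 d hd) _ _).2, charSum_one_eq_eval (hd0 d hd), Rat.cast_mul]

/-- Conjugation replaces `α` by its inverse, which has the same order `|v|`. The logarithm vanishes
below this degree, so the average is its coefficient at `v`. -/
theorem IsLogCompatible.takesValueAt_twisted_average (hF : IsLogCompatible F Fty)
    {v : Fin r →₀ ℕ} (hv : v ≠ 0) {conj : κ →+* κ} (hconj : InvertsRootsOfUnity conj)
    (α : Kˣ →* κˣ) (hα : orderOf α = v.degree) :
    TakesValueAt (MvPowerSeries.coeff v (genericSeries Fty)) (Nat.card K)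
      (inner conj (fun x : GLv K v => (F K v x : κ)) (twistedChar α v)) := by
  have hθ : orderOf α⁻¹ = v.degree := (orderOf_inv α).trans hα
  obtain ⟨g, M, hgM, hg, hM⟩ := hF.exists_isLogOf_average (κ := κ) α⁻¹ v
  have hsum : ∀ w : Fin r →₀ ℕ, w ≠ 0 → w.degree ≤ v.degree → ∃ (n : ℕ) (u : Fin r →₀ ℕ),
      n ≠ 0 ∧ Finset.univ.gcd u = 1 ∧ w = n • u ∧ MvPowerSeries.coeff w M =
        ∑ d ∈ n.divisors, charSum α⁻¹ d (w.degree / d) * (valueAt ((Nat.card K : ℚ) ^ d)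
            (MvPowerSeries.coeff ((n / d) • u) (logSeries Fty)) : κ) := fun w hw0 hw => by
    obtain ⟨n, u, hn, hu, rfl⟩ := exists_eq_nsmul_primitive hw0
    refine ⟨n, u, hn, hu, rfl, ?_⟩
    rw [hM _ hw]
    exact sum_Icc_degree_eq_sum_divisors hu hn fun d x =>
      charSum α⁻¹ d ((n • u).degree / d) *
        (valueAt ((Nat.card K : ℚ) ^ d) (MvPowerSeries.coeff x (logSeries Fty)) : κ)
  have hdvd : ∀ (n : ℕ) (u : Fin r →₀ ℕ), ∀ d ∈ n.divisors, d ∣ (n • u).degree := fun n u d hd => by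
    rw [degree_nsmul_finsupp]
    exact (Nat.dvd_of_mem_divisors hd).mul_right _
  have hvanish : ∀ w : Fin r →₀ ℕ, w.degree < v.degree → MvPowerSeries.coeff w M = 0 := by
    intro w hw
    by_cases hw0 : w = 0
    · rw [hw0, MvPowerSeries.coeff_zero_eq_constantCoeff_apply, hgM.2]
    obtain ⟨n, u, hn, hu, rfl, h⟩ := hsum w hw0 hw.le
    rw [h]
    refine Finset.sum_eq_zero fun d hd => ?_
    rw [charSum_eq_zero _ (fun h0 => hw0 ((Finsupp.degree_eq_zero_iff _).mp h0)) (hθ ▸ hw)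
      (hdvd n u d hd), zero_mul]
  have hinner : inner conj (fun x : GLv K v => (F K v x : κ)) (twistedChar α v) =
      MvPowerSeries.coeff v M := by
    rw [← hgM.coeff_eq_of_vanishing hv hvanish, hg, inner]
    simp only [conj_twistedChar hconj]
  rw [hinner, takesValueAt_iff]
  obtain ⟨n, u, hn, hu, rfl, h⟩ := hsum v hv le_rfl
  have hd0 : ∀ d ∈ n.divisors, d ≠ 0 := fun d hd =>
    ne_zero_of_dvd_ne_zero hn (Nat.dvd_of_mem_divisors hd)
  rw [h, genericSeries, coeff_C_mul_psiInv hu hn]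
  refine ⟨sum_mem fun d hd => (hF.mul_substPow_mem K (hd0 d hd) _ _).1, ?_⟩
  rw [valueAt_sum _ _ fun d hd => (hF.mul_substPow_mem K (hd0 d hd) _ _).1, Rat.cast_sum]
  refine Finset.sum_congr rfl fun d hd => ?_
  rw [(hF.mul_substPow_mem K (hd0 d hd) _ _).2, Rat.cast_mul]
  congr 1
  -- In degree `|v|` the character sum is `μ(d)(q - 1) / d`, the weight of `ψ_d` in `(t - 1) Ψ⁻¹`.
  have hd' : (d : κ) ≠ 0 := Nat.cast_ne_zero.mpr (hd0 d hd)
  rw [← mul_right_inj' hd', mul_charSum_orderOf _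
    (fun h0 => hv ((Finsupp.degree_eq_zero_iff _).mp h0)) hθ (hdvd n u d hd)]
  simp only [eval_mul, eval_C, eval_sub, eval_X, eval_one]
  push_cast
  field_simp

end Main

end LogCompat

end

theorem mainTheorem5 (r : ℕ) (F : LogCompat.FunctionFamily.{u} r)
    (Fty : LogCompat.MultiType r → RatFunc ℚ) (hF : LogCompat.IsLogCompatible F Fty) :
    ∃ (Z : LogCompat.MultiPartition r → Polynomial ℚ) (V Vgen : (Fin r → ℕ) → RatFunc ℚ),
      (∀ (μ : LogCompat.MultiPartition r) (K : Type u) [Field K] [Finite K]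
          (g : LogCompat.GLv K μ.size),
        LogCompat.IsUnipotent g → LogCompat.typeOf g = LogCompat.unipotentType μ →
          (Z μ).eval (Nat.card K : ℚ) = (Nat.card (Subgroup.centralizer {g}) : ℚ)) ∧
      (∀ (K : Type u) [Field K] [Finite K] (κ : Type w) [Field κ] [IsAlgClosed κ] [CharZero κ]
          (conj : κ →+* κ), LogCompat.InvertsRootsOfUnity conj → ∀ v : Fin r → ℕ,
        LogCompat.TakesValueAt (V v) (Nat.card K)
          (LogCompat.inner conj (fun x => (F K v x : κ)) (fun _ => 1))) ∧
      (∀ (K : Type u) [Field K] [Finite K] (κ : Type w) [Field κ] [IsAlgClosed κ] [CharZero κ]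
          (conj : κ →+* κ), LogCompat.InvertsRootsOfUnity conj → ∀ v : Fin r → ℕ, v ≠ 0 →
        ∀ α : Kˣ →* κˣ, orderOf α = ∑ i, v i →
        LogCompat.TakesValueAt (Vgen v) (Nat.card K)
          (LogCompat.inner conj (fun x => (F K v x : κ)) (LogCompat.twistedChar α v))) ∧
      MvPowerSeries.C (RatFunc.X - 1) *
          LogCompat.Log (LogCompat.partitionSeries fun μ =>
            Fty (LogCompat.unipotentType μ) / algebraMap (Polynomial ℚ) (RatFunc ℚ) (Z μ)) =
        LogCompat.Log (LogCompat.vectorSeries V) ∧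
      LogCompat.Log (LogCompat.vectorSeries V) = LogCompat.vectorSeriesPos Vgen := by
  classical
  -- The series of the `V v` is defined as the exponential of Ψ applied to `genericSeries Fty`, so
  -- its `Log` is `genericSeries Fty` by construction; the coefficients of the latter serve as
  -- `Vgen`.
  obtain ⟨f, hf⟩ := LogCompat.exists_isLogOf (LogCompat.constantCoeff_psi
    (LogCompat.genericSeries Fty))
  have hV : LogCompat.vectorSeries (fun v =>
      MvPowerSeries.coeff (Finsupp.equivFunOnFinite.symm v) f) = f := by
    ext w
    change MvPowerSeries.coeff (Finsupp.equivFunOnFinite.symm (w : Fin r → ℕ)) f = _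
    rw [Finsupp.equivFunOnFinite_symm_coe]
  have hLog : LogCompat.Log f = LogCompat.genericSeries Fty := by
    rw [LogCompat.Log, (LogCompat.isLogOf_subst_log hf.1).unique hf,
      LogCompat.psiInv_psi (LogCompat.constantCoeff_genericSeries Fty)]
  refine ⟨LogCompat.centralizerPoly,
    fun v => MvPowerSeries.coeff (Finsupp.equivFunOnFinite.symm v) f,
    fun v => MvPowerSeries.coeff (Finsupp.equivFunOnFinite.symm v) (LogCompat.genericSeries Fty),
    fun μ K _ _ g _ hg => LogCompat.centralizerPoly_eval_eq_card μ g hg,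
    fun K _ _ κ _ _ _ conj _ v => hF.takesValueAt_average K hf (Finsupp.equivFunOnFinite.symm v),
    fun K _ _ κ _ _ _ conj hconj v hv α hα => hF.takesValueAt_twisted_average K
      (fun h => hv (congrArg DFunLike.coe h)) hconj α
      (hα.trans (Finsupp.degree_eq_sum (Finsupp.equivFunOnFinite.symm v)).symm), ?_, ?_⟩
  · rw [hV, hLog]
    rfl
  · rw [hV, hLog]
    ext w
    change _ = if w = 0 then (0 : RatFunc ℚ) else
      MvPowerSeries.coeff (Finsupp.equivFunOnFinite.symm (w : Fin r → ℕ)) (LogCompat.genericSeries Fty)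
    split_ifs with h
    · rw [h, MvPowerSeries.coeff_zero_eq_constantCoeff_apply,
        LogCompat.constantCoeff_genericSeries]
    · rw [Finsupp.equivFunOnFinite_symm_coe]
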